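/- Let $k$ be a field, let $Q$ be a finite quiver without oriented cycles, let $I$ be an admissible two-sided ideal of the path algebra $kQ$, and let $A=kQ/I$ (a triangular algebra). Paths are composed from left to right. The ideal $I$ is *monomial* if it is generated by a set of paths, and *quadratic* if it is generated by linear combinations of paths of length two. Consider the following conditions on $(Q,I)$. - (S1) $I$ is monomial. - (S2) Each vertex of $Q$ is the source of at most two arrows and the target of at most two arrows. - (S3) For each arrow $\alpha$ there is at most one arrow $\beta$ with $\alpha\beta\notin I$ and at most one arrow $\gamma$ with $\gamma\alpha\notin I$. - (G1) For each arrow $\alpha$ there is at most one arrow $\beta$ such that $\alpha\beta$ is a path belonging to $I$, and at most one arrow $\gamma$ such that $\gamma\alpha$ is a path belonging to $I$. The algebra $A$ is a *string algebra* if (S1), (S2) and (S3) hold, and a *gentle algebra* if moreover (G1) holds and $I$ is quadratic. Let $\mathrm{HH}^n(A)=\mathrm{HH}^n(A,A)$ denote Hochschild cohomology, that is, the cohomology of the complex of $k$-multilinear maps $A^n\to A$ with the Hochschild differential, with the cup product induced by $$(f\cup g)(a_1,\dots,a_{n+m})=f(a_1,\dots,a_n)\,g(a_{n+1},\dots,a_{n+m}).$$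 **Theorem.** If $A$ is a quadratic string algebra, then $$\mathrm{HH}^n(A)\cup\mathrm{HH}^m(A)=0\qquad\text{for all } n>0 \text{ and } m>0.$$ More generally, the same conclusion holds whenever $I$ is monomial and quadratic and $(Q,I)$ satisfies (S3). In particular, it holds whenever $A$ is gentle. -/

import Mathlib

/-! ## Path algebras of finite quivers and their quotients -/

/-- All paths of a quiver (including the trivial path at each vertex), with source and target. -/
structure QuiverPath (Q : Type*) [Quiver Q] where
  {src : Q}
  {tgt : Q}
  path : Quiver.Path src tgt

/-- The path algebra `kQ`: the vector space with basis the paths of `Q`. -/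
def PathAlgebra (k Q : Type*) [Field k] [Quiver Q] : Type _ := QuiverPath Q →₀ k

namespace PathAlgebra

variable {k Q : Type*} [Field k] [Quiver Q]

noncomputable instance : AddCommGroup (PathAlgebra k Q) :=
  inferInstanceAs (AddCommGroup (QuiverPath Q →₀ k))

noncomputable instance : Module k (PathAlgebra k Q) :=
  inferInstanceAs (Module k (QuiverPath Q →₀ k))

/-- The basis element of `kQ` given by a path. -/
noncomputable def ofPath {a b : Q} (p : Quiver.Path a b) : PathAlgebra k Q :=
  Finsupp.single ⟨p⟩ 1

/-- The basis element of `kQ` given by an arrow. -/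
noncomputable def arrow {a b : Q} (α : a ⟶ b) : PathAlgebra k Q :=
  ofPath α.toPath

open Classical in
/-- The product in `kQ` of two paths: the path `p` followed by the path `q` if the target of `p`
is the source of `q`, and zero otherwise. -/
noncomputable def pathMul (p q : QuiverPath Q) : PathAlgebra k Q :=
  if h : p.tgt = q.src then ofPath (p.path.comp (q.path.cast h.symm rfl)) else 0

/-- The product of `kQ` as a bilinear map. -/
noncomputable def mulHom : PathAlgebra k Q →ₗ[k] PathAlgebra k Q →ₗ[k] PathAlgebra k Q :=
  Finsupp.lsum k fun p => LinearMap.toSpanSingleton k _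
    (Finsupp.lsum k fun q => LinearMap.toSpanSingleton k _ (pathMul p q))

noncomputable instance : Mul (PathAlgebra k Q) := ⟨fun x y => mulHom x y⟩

theorem mul_def (x y : PathAlgebra k Q) : x * y = mulHom x y := rfl

theorem mulHom_ofPath {a b c d : Q} (p : Quiver.Path a b) (q : Quiver.Path c d) :
    mulHom (k := k) (ofPath p) (ofPath q) = pathMul ⟨p⟩ ⟨q⟩ := by
  unfold mulHom ofPath
  erw [Finsupp.lsum_single, LinearMap.toSpanSingleton_apply, one_smul]
  erw [Finsupp.lsum_single, LinearMap.toSpanSingleton_apply, one_smul]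

theorem ofPath_mul_ofPath {a b c : Q} (p : Quiver.Path a b) (q : Quiver.Path b c) :
    (ofPath p * ofPath q : PathAlgebra k Q) = ofPath (p.comp q) := by
  rw [mul_def, mulHom_ofPath]
  simp [pathMul]

theorem ofPath_mul_ofPath_of_ne {a b c d : Q} (p : Quiver.Path a b) (q : Quiver.Path c d)
    (h : b ≠ c) : (ofPath p * ofPath q : PathAlgebra k Q) = 0 := by
  rw [mul_def, mulHom_ofPath]
  simp [pathMul, h]

theorem ind {P : PathAlgebra k Q → Prop} (x : PathAlgebra k Q) (zero : P 0)
    (add : ∀ x y, P x → P y → P (x + y))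
    (path : ∀ {a b : Q} (p : Quiver.Path a b) (r : k), P (r • ofPath p)) : P x := by
  induction x using Finsupp.induction_linear with
  | zero => exact zero
  | add f g hf hg => exact add f g hf hg
  | single p r =>
    have := path p.path r
    have e : r • (ofPath p.path : PathAlgebra k Q) = Finsupp.single p r := by
      change r • (Finsupp.single p (1 : k)) = _
      simp
    rwa [e] at this

theorem smul_mul' (r : k) (x y : PathAlgebra k Q) : (r • x) * y = r • (x * y) := by
  simp [mul_def]

theorem mul_smul' (r : k) (x y : PathAlgebra k Q) : x * (r • y) = r • (x * y) := by
  simp [mul_def]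

theorem add_mul' (x y z : PathAlgebra k Q) : (x + y) * z = x * z + y * z := by
  simp [mul_def]

theorem mul_add' (x y z : PathAlgebra k Q) : x * (y + z) = x * y + x * z := by
  simp [mul_def]

theorem zero_mul' (x : PathAlgebra k Q) : 0 * x = 0 := by
  simp [mul_def]

theorem mul_zero' (x : PathAlgebra k Q) : x * 0 = 0 := by
  simp [mul_def]

theorem mul_assoc' (x y z : PathAlgebra k Q) : x * y * z = x * (y * z) := by
  induction x using ind with
  | zero => simp only [zero_mul']
  | add x x' hx hx' => simp only [add_mul', hx, hx']
  | path p r =>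
  induction y using ind with
  | zero => simp only [zero_mul', mul_zero']
  | add y y' hy hy' => simp only [add_mul', mul_add', hy, hy']
  | path q s =>
  induction z using ind with
  | zero => simp only [mul_zero']
  | add z z' hz hz' => simp only [mul_add', hz, hz']
  | path u t =>
  simp only [smul_mul', mul_smul']
  congr 3
  rename_i a b c d e f
  by_cases h : b = c
  · subst h
    by_cases h' : d = e
    · subst h'
      simp only [ofPath_mul_ofPath, Quiver.Path.comp_assoc]
    · simp only [ofPath_mul_ofPath, ofPath_mul_ofPath_of_ne _ _ h', mul_zero']
  · rw [ofPath_mul_ofPath_of_ne _ _ h, zero_mul']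
    by_cases h' : d = e
    · subst h'
      rw [ofPath_mul_ofPath, ofPath_mul_ofPath_of_ne _ _ h]
    · rw [ofPath_mul_ofPath_of_ne _ _ h', mul_zero']

variable [Fintype Q]

/-- The unit of `kQ` is the sum of the trivial paths. -/
noncomputable instance : One (PathAlgebra k Q) := ⟨∑ v : Q, ofPath (Quiver.Path.nil : Quiver.Path v v)⟩

theorem one_def :
    (1 : PathAlgebra k Q) = ∑ v : Q, ofPath (Quiver.Path.nil : Quiver.Path v v) := rfl

theorem one_mul' (x : PathAlgebra k Q) : 1 * x = x := by
  induction x using ind with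
  | zero => rw [mul_zero']
  | add x y hx hy => rw [mul_add', hx, hy]
  | path p r =>
    rename_i a b
    rw [mul_smul', one_def, mul_def, map_sum, LinearMap.sum_apply, Finset.sum_eq_single a]
    · rw [← mul_def, ofPath_mul_ofPath, Quiver.Path.nil_comp]
    · intro v _ hv
      rw [← mul_def, ofPath_mul_ofPath_of_ne _ _ hv]
    · simp

theorem mul_one' (x : PathAlgebra k Q) : x * 1 = x := by
  induction x using ind with
  | zero => rw [zero_mul']
  | add x y hx hy => rw [add_mul', hx, hy]
  | path p r =>
    rename_i a b
    rw [smul_mul', one_def, mul_def, map_sum, Finset.sum_eq_single b]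
    · rw [← mul_def, ofPath_mul_ofPath, Quiver.Path.comp_nil]
    · intro v _ hv
      rw [← mul_def, ofPath_mul_ofPath_of_ne _ _ hv.symm]
    · simp

noncomputable instance : Ring (PathAlgebra k Q) :=
  { (inferInstance : AddCommGroup (PathAlgebra k Q)) with
    mul := (· * ·)
    one := 1
    left_distrib := mul_add'
    right_distrib := add_mul'
    zero_mul := zero_mul'
    mul_zero := mul_zero'
    mul_assoc := mul_assoc'
    one_mul := one_mul'
    mul_one := mul_one' }

noncomputable instance : Algebra k (PathAlgebra k Q) :=
  Algebra.ofModule smul_mul' mul_smul'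

end PathAlgebra

/-! ## Bound quivers: triangular, monomial, quadratic, string and gentle -/

/-- `Q` has no oriented cycles: every closed path is trivial. -/
def Quiver.NoOrientedCycles (Q : Type*) [Quiver Q] : Prop :=
  ∀ (a : Q) (p : Quiver.Path a a), p = Quiver.Path.nil

namespace BoundQuiver

open PathAlgebra

variable {k Q : Type*} [Field k] [Quiver Q] [Fintype Q]

/-- The set of all (basis elements given by) paths of length at least `m`. Its span is the `m`-th
power of the ideal of `kQ` generated by the arrows. -/
def longPaths (k Q : Type*) [Field k] [Quiver Q] (m : ℕ) : Set (PathAlgebra k Q) :=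
  {x | ∃ (a b : Q) (p : Quiver.Path a b), m ≤ p.length ∧ x = ofPath p}

/-- A two-sided ideal `I` of `kQ` is admissible if `R ^ m ⊆ I ⊆ R ^ 2` for some `m ≥ 2`, where `R`
is the ideal generated by the arrows. -/
def IsAdmissible (I : TwoSidedIdeal (PathAlgebra k Q)) : Prop :=
  I ≤ TwoSidedIdeal.span (longPaths k Q 2) ∧
    ∃ m : ℕ, 2 ≤ m ∧ TwoSidedIdeal.span (longPaths k Q m) ≤ I

/-- `I` is generated by a set of paths. -/
def IsMonomial (I : TwoSidedIdeal (PathAlgebra k Q)) : Prop :=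
  ∃ S : Set (PathAlgebra k Q), (∀ x ∈ S, ∃ (a b : Q) (p : Quiver.Path a b), x = ofPath p) ∧
    I = TwoSidedIdeal.span S

/-- `I` is generated by a set of linear combinations of paths of length two. -/
def IsQuadratic (I : TwoSidedIdeal (PathAlgebra k Q)) : Prop :=
  ∃ S : Set (PathAlgebra k Q),
    (∀ x ∈ S, x ∈ Submodule.span k {y | ∃ (a b : Q) (p : Quiver.Path a b),
      p.length = 2 ∧ y = ofPath p}) ∧
    I = TwoSidedIdeal.span S

/-- Each vertex is the source of at most two arrows and the target of at most two arrows. -/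
def AtMostTwoArrows (Q : Type*) [Quiver Q] : Prop :=
  ∀ v : Q, ENat.card (Quiver.Star v) ≤ 2 ∧ ENat.card (Quiver.Costar v) ≤ 2

/-- For an arrow `α` there is at most one arrow `β` with source the target of `α` and `αβ ∉ I`, and
at most one arrow `γ` with target the source of `α` and `γα ∉ I`. (If two arrows do not compose,
then their product is `0 ∈ I`.) -/
def UniqueNonzeroContinuation (I : TwoSidedIdeal (PathAlgebra k Q)) : Prop :=
  ∀ ⦃a b : Q⦄ (α : a ⟶ b),
    {β : Quiver.Star b | arrow α * arrow β.2 ∉ I}.Subsingleton ∧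
    {γ : Quiver.Costar a | arrow γ.2 * arrow α ∉ I}.Subsingleton

/-- For an arrow `α` there is at most one arrow `β` such that `αβ` is a path in `I`, and at most one
arrow `γ` such that `γα` is a path in `I`. -/
def UniqueZeroContinuation (I : TwoSidedIdeal (PathAlgebra k Q)) : Prop :=
  ∀ ⦃a b : Q⦄ (α : a ⟶ b),
    {β : Quiver.Star b | arrow α * arrow β.2 ∈ I}.Subsingleton ∧
    {γ : Quiver.Costar a | arrow γ.2 * arrow α ∈ I}.Subsingleton

/-- `kQ/I` is a string algebra. -/
structure IsString (I : TwoSidedIdeal (PathAlgebra k Q)) : Prop where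
  monomial : IsMonomial I
  atMostTwo : AtMostTwoArrows Q
  uniqueNonzero : UniqueNonzeroContinuation I

/-- `kQ/I` is a gentle algebra. -/
structure IsGentle (I : TwoSidedIdeal (PathAlgebra k Q)) : Prop extends IsString I where
  uniqueZero : UniqueZeroContinuation I
  quadratic : IsQuadratic I

/-- The algebra `kQ/I`. -/
abbrev QuotientAlgebra (I : TwoSidedIdeal (PathAlgebra k Q)) : Type _ := I.ringCon.Quotient

end BoundQuiver

/-! ## Hochschild cohomology and the cup product -/

namespace Hochschild

variable (k A : Type*) [Field k] [Ring A] [Algebra k A]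

/-- Hochschild `n`-cochains of `A` with coefficients in `A`: the `k`-multilinear maps `Aⁿ → A`,
that is, the `A`-bimodule maps from the `n`-th term of the bar resolution of `A` to `A`. -/
abbrev Cochain (n : ℕ) : Type _ := MultilinearMap k (fun _ : Fin n => A) A

variable {k A}

theorem contractNth_mul_update {n : ℕ} (j : Fin n) (a : Fin (n + 1) → A) (i : Fin (n + 1)) :
    ∃ (i' : Fin n) (φ : A →ₗ[k] A), ∀ x : A,
      Fin.contractNth j.castSucc (· * ·) (Function.update a i x) =
        Function.update (Fin.contractNth j.castSucc (· * ·) a) i' (φ x) := by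
  rcases lt_trichotomy (i : ℕ) (j : ℕ) with h | h | h
  · refine ⟨⟨i, by omega⟩, LinearMap.id, fun x => ?_⟩
    funext l
    simp only [Fin.contractNth, Function.update_apply, Fin.ext_iff, Fin.val_castSucc, Fin.val_succ,
      LinearMap.id_apply]
    split_ifs <;> first | rfl | omega
  · refine ⟨j, LinearMap.mulRight k (a j.succ), fun x => ?_⟩
    funext l
    simp only [Fin.contractNth, Function.update_apply, Fin.ext_iff, Fin.val_castSucc, Fin.val_succ,
      LinearMap.mulRight_apply]
    split_ifs <;> first | rfl | omega | skip
    have : l = j := Fin.ext (by omega)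
    subst this; rfl
  · by_cases h' : (i : ℕ) = j + 1
    · refine ⟨j, LinearMap.mulLeft k (a j.castSucc), fun x => ?_⟩
      funext l
      simp only [Fin.contractNth, Function.update_apply, Fin.ext_iff, Fin.val_castSucc,
        Fin.val_succ, LinearMap.mulLeft_apply]
      split_ifs <;> first | rfl | omega | skip
      have : l = j := Fin.ext (by omega)
      subst this; rfl
    · refine ⟨⟨i - 1, by omega⟩, LinearMap.id, fun x => ?_⟩
      funext l
      simp only [Fin.contractNth, Function.update_apply, Fin.ext_iff, Fin.val_castSucc,
        Fin.val_succ, LinearMap.id_apply]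
      split_ifs <;> first | rfl | omega

/-- The cochain `(a₀, …, aₙ) ↦ f (a₀, …, aⱼaⱼ₊₁, …, aₙ)`. -/
def contract {n : ℕ} (j : Fin n) (f : Cochain k A n) : Cochain k A (n + 1) :=
  MultilinearMap.mk' (fun a => f (Fin.contractNth j.castSucc (· * ·) a))
    (by
      intro a i x y
      obtain ⟨i', φ, h⟩ := contractNth_mul_update (k := k) j a i
      simp only [h, map_add, MultilinearMap.map_update_add])
    (by
      intro a i c x
      obtain ⟨i', φ, h⟩ := contractNth_mul_update (k := k) j a i
      simp only [h, map_smul, MultilinearMap.map_update_smul])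

section UpdateLemmas

variable {B : Type*}

theorem update_castAdd_left {n m : ℕ} (a : Fin (n + m) → B) (i : Fin n) (x : B) :
    (fun l : Fin n => Function.update a (Fin.castAdd m i) x (Fin.castAdd m l)) =
      Function.update (fun l => a (Fin.castAdd m l)) i x := by
  funext l
  simp [Function.update_apply]

theorem update_castAdd_right {n m : ℕ} (a : Fin (n + m) → B) (i : Fin n) (x : B) :
    (fun l : Fin m => Function.update a (Fin.castAdd m i) x (Fin.natAdd n l)) =
      fun l => a (Fin.natAdd n l) := by
  funext l
  refine Function.update_of_ne ?_ _ _
  simp only [ne_eq, Fin.ext_iff, Fin.val_natAdd, Fin.val_castAdd]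
  omega

theorem update_natAdd_left {n m : ℕ} (a : Fin (n + m) → B) (i : Fin m) (x : B) :
    (fun l : Fin n => Function.update a (Fin.natAdd n i) x (Fin.castAdd m l)) =
      fun l => a (Fin.castAdd m l) := by
  funext l
  refine Function.update_of_ne ?_ _ _
  simp only [ne_eq, Fin.ext_iff, Fin.val_natAdd, Fin.val_castAdd]
  omega

theorem update_natAdd_right {n m : ℕ} (a : Fin (n + m) → B) (i : Fin m) (x : B) :
    (fun l : Fin m => Function.update a (Fin.natAdd n i) x (Fin.natAdd n l)) =
      Function.update (fun l => a (Fin.natAdd n l)) i x := by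
  funext l
  simp [Function.update_apply]

theorem update_zero_succ {n : ℕ} (a : Fin (n + 1) → B) (x : B) :
    (fun l : Fin n => Function.update a 0 x l.succ) = fun l => a l.succ := by
  funext l
  simp

theorem update_succ_succ {n : ℕ} (a : Fin (n + 1) → B) (i : Fin n) (x : B) :
    (fun l : Fin n => Function.update a i.succ x l.succ) =
      Function.update (fun l => a l.succ) i x := by
  funext l
  simp [Function.update_apply]

theorem update_succ_zero {n : ℕ} (a : Fin (n + 1) → B) (i : Fin n) (x : B) :
    Function.update a i.succ x 0 = a 0 :=
  Function.update_of_ne (Fin.succ_ne_zero i).symm _ _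

theorem update_last_castSucc {n : ℕ} (a : Fin (n + 1) → B) (x : B) :
    (fun l : Fin n => Function.update a (Fin.last n) x l.castSucc) = fun l => a l.castSucc := by
  funext l
  exact Function.update_of_ne (Fin.castSucc_ne_last l) _ _

theorem update_castSucc_castSucc {n : ℕ} (a : Fin (n + 1) → B) (i : Fin n) (x : B) :
    (fun l : Fin n => Function.update a i.castSucc x l.castSucc) =
      Function.update (fun l => a l.castSucc) i x := by
  funext l
  simp [Function.update_apply]

theorem update_castSucc_last {n : ℕ} (a : Fin (n + 1) → B) (i : Fin n) (x : B) :
    Function.update a i.castSucc x (Fin.last n) = a (Fin.last n) :=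
  Function.update_of_ne (Fin.castSucc_ne_last i).symm _ _

end UpdateLemmas

/-- The cup product of cochains:
`(f ∪ g) (a₁, …, aₙ₊ₘ) = f (a₁, …, aₙ) * g (aₙ₊₁, …, aₙ₊ₘ)`. -/
def cup {n m : ℕ} (f : Cochain k A n) (g : Cochain k A m) : Cochain k A (n + m) :=
  MultilinearMap.mk'
    (fun a => f (fun i => a (Fin.castAdd m i)) * g (fun i => a (Fin.natAdd n i)))
    (by
      intro a i x y
      induction i using Fin.addCases with
      | left i => simp only [update_castAdd_left, update_castAdd_right,
          MultilinearMap.map_update_add, add_mul]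
      | right i => simp only [update_natAdd_left, update_natAdd_right,
          MultilinearMap.map_update_add, mul_add])
    (by
      intro a i c x
      induction i using Fin.addCases with
      | left i => simp only [update_castAdd_left, update_castAdd_right,
          MultilinearMap.map_update_smul, smul_mul_assoc]
      | right i => simp only [update_natAdd_left, update_natAdd_right,
          MultilinearMap.map_update_smul, mul_smul_comm])

/-- The cochain `(a₀, …, aₙ) ↦ a₀ * f (a₁, …, aₙ)`. -/
def leftMul {n : ℕ} (f : Cochain k A n) : Cochain k A (n + 1) :=
  MultilinearMap.mk' (fun a => a 0 * f (fun i => a i.succ))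
    (by
      intro a i x y
      induction i using Fin.cases with
      | zero => simp only [update_zero_succ, Function.update_self, add_mul]
      | succ i => simp only [update_succ_succ, update_succ_zero,
          MultilinearMap.map_update_add, mul_add])
    (by
      intro a i c x
      induction i using Fin.cases with
      | zero => simp only [update_zero_succ, Function.update_self, smul_mul_assoc]
      | succ i => simp only [update_succ_succ, update_succ_zero,
          MultilinearMap.map_update_smul, mul_smul_comm])

/-- The cochain `(a₀, …, aₙ) ↦ f (a₀, …, aₙ₋₁) * aₙ`. -/
def rightMul {n : ℕ} (f : Cochain k A n) : Cochain k A (n + 1) :=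
  MultilinearMap.mk' (fun a => f (fun i => a i.castSucc) * a (Fin.last n))
    (by
      intro a i x y
      induction i using Fin.lastCases with
      | last => simp only [update_last_castSucc, Function.update_self, mul_add]
      | cast i => simp only [update_castSucc_castSucc, update_castSucc_last,
          MultilinearMap.map_update_add, add_mul])
    (by
      intro a i c x
      induction i using Fin.lastCases with
      | last => simp only [update_last_castSucc, Function.update_self, mul_smul_comm]
      | cast i => simp only [update_castSucc_castSucc, update_castSucc_last,
          MultilinearMap.map_update_smul, smul_mul_assoc])

/-- The Hochschild differential:
`(d f) (a₀, …, aₙ) = a₀ f (a₁, …, aₙ) + ∑ⱼ (-1) ^ (j + 1) f (a₀, …, aⱼaⱼ₊₁, …, aₙ)`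
`+ (-1) ^ (n + 1) f (a₀, …, aₙ₋₁) aₙ`. -/
def d (n : ℕ) : Cochain k A n →ₗ[k] Cochain k A (n + 1) where
  toFun f := leftMul f + ∑ j : Fin n, (-1 : k) ^ ((j : ℕ) + 1) • contract j f +
    (-1 : k) ^ (n + 1) • rightMul f
  map_add' f g := by
    ext a
    simp [leftMul, rightMul, contract, mul_add, add_mul, Finset.sum_add_distrib]
    abel
  map_smul' c f := by
    ext a
    simp [leftMul, rightMul, contract, Finset.smul_sum, smul_comm c]

theorem d_apply (n : ℕ) (f : Cochain k A n) (a : Fin (n + 1) → A) :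
    d n f a = a 0 * f (fun i => a i.succ) +
      ∑ j : Fin n, (-1 : k) ^ ((j : ℕ) + 1) • f (Fin.contractNth j.castSucc (· * ·) a) +
      (-1 : k) ^ (n + 1) • (f (fun i => a i.castSucc) * a (Fin.last n)) := by
  simp [d, leftMul, rightMul, contract]

theorem cup_apply {n m : ℕ} (f : Cochain k A n) (g : Cochain k A m) (a : Fin (n + m) → A) :
    cup f g a = f (fun i => a (Fin.castAdd m i)) * g (fun i => a (Fin.natAdd n i)) := rfl

/-- The cup product of cochains as a bilinear map. -/
def cupHom (n m : ℕ) : Cochain k A n →ₗ[k] Cochain k A m →ₗ[k] Cochain k A (n + m) :=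
  LinearMap.mk₂ k cup
    (fun f f' g => by ext a; simp [cup_apply, add_mul])
    (fun c f g => by ext a; simp [cup_apply])
    (fun f g g' => by ext a; simp [cup_apply, mul_add])
    (fun c f g => by ext a; simp [cup_apply])

/-! The Leibniz rule. Index casts are avoided by evaluating cochains on (initial segments of)
infinite sequences. -/

/-- The value of a cochain on the first `n` terms of the sequence `s`. -/
def ev {n : ℕ} (f : Cochain k A n) (s : ℕ → A) : A := f fun i => s i

theorem ev_congr {n : ℕ} (f : Cochain k A n) {s t : ℕ → A} (h : ∀ i < n, s i = t i) :
    ev f s = ev f t :=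
  congrArg f (funext fun i => h i i.2)

theorem ext_ev {n : ℕ} {f g : Cochain k A n} (h : ∀ s : ℕ → A, ev f s = ev g s) : f = g := by
  ext a
  have := h fun i => if hi : i < n then a ⟨i, hi⟩ else 0
  simpa [ev] using this

/-- The sequence obtained from `s` by multiplying the `j`-th and the `(j+1)`-st terms. -/
def mulAt (j : ℕ) (s : ℕ → A) (i : ℕ) : A :=
  if i < j then s i else if i = j then s i * s (i + 1) else s (i + 1)

theorem ev_d {n : ℕ} (f : Cochain k A n) (s : ℕ → A) :
    ev (d n f) s = s 0 * ev f (fun i => s (i + 1)) +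
      ∑ j ∈ Finset.range n, (-1 : k) ^ (j + 1) • ev f (mulAt j s) +
      (-1 : k) ^ (n + 1) • (ev f s * s n) := by
  rw [ev, d_apply, Finset.sum_range]
  rfl

theorem ev_cup {n m : ℕ} (f : Cochain k A n) (g : Cochain k A m) (s : ℕ → A) :
    ev (cup f g) s = ev f s * ev g (fun i => s (n + i)) := rfl

theorem leibniz {n m : ℕ} (f : Cochain k A n) (g : Cochain k A m) (s : ℕ → A) :
    ev (d (n + m) (cup f g)) s =
      ev (cup (d n f) g) s + (-1 : k) ^ n • ev (cup f (d m g)) s := by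
  have h1 : ∀ j ∈ Finset.range n,
      (-1 : k) ^ (j + 1) • (ev f (mulAt j s) * ev g (fun i => mulAt j s (n + i))) =
      ((-1 : k) ^ (j + 1) • ev f (mulAt j s)) * ev g (fun i => s (n + 1 + i)) := by
    intro j hj
    rw [Finset.mem_range] at hj
    rw [smul_mul_assoc]
    congr 2
    refine ev_congr g fun i _ => ?_
    have e1 : ¬ (n + i < j) := by omega
    have e2 : ¬ (n + i = j) := by omega
    simp only [mulAt, e1, e2, if_false]
    congr 1
    omega
  have h2 : ∀ j ∈ Finset.range m,
      (-1 : k) ^ (n + j + 1) •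
        (ev f (mulAt (n + j) s) * ev g (fun i => mulAt (n + j) s (n + i))) =
      (-1 : k) ^ n • (ev f s * ((-1 : k) ^ (j + 1) • ev g (mulAt j fun i => s (n + i)))) := by
    intro j _
    rw [mul_smul_comm, smul_smul, ← pow_add, ← add_assoc]
    congr 2
    · refine ev_congr f fun i hi => ?_
      have e1 : i < n + j := by omega
      simp only [mulAt, e1, if_true]
    · refine ev_congr g fun i _ => ?_
      simp only [mulAt, Nat.add_lt_add_iff_left, Nat.add_left_cancel_iff, add_assoc]
  simp only [ev_d, ev_cup]
  rw [Finset.sum_range_add, Finset.sum_congr rfl h1, Finset.sum_congr rfl h2, ← Finset.sum_mul,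
    ← Finset.smul_sum, ← Finset.mul_sum]
  have e3 : (fun i => s (n + i + 1)) = fun i => s (n + 1 + i) := by
    funext i; congr 1; omega
  have e4 : (fun i => s (n + (i + 1))) = fun i => s (n + 1 + i) := by
    funext i; congr 1; omega
  have e5 : ((-1 : k) ^ (n + m + 1)) = (-1) ^ n * (-1) ^ (m + 1) := by ring
  have e6 : ((-1 : k) ^ (n + 1)) = - (-1) ^ n := by ring
  simp only [e3, e4, e5, e6, mul_add, add_mul, smul_add, mul_smul, mul_smul_comm, smul_mul_assoc,
    neg_smul, neg_mul, mul_assoc, add_zero]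
  abel

/-- The Hochschild `n`-cocycles of `A`. -/
def Cocycle (k A : Type*) [Field k] [Ring A] [Algebra k A] (n : ℕ) : Type _ :=
  LinearMap.ker (d (k := k) (A := A) n)

instance (n : ℕ) : AddCommGroup (Cocycle k A n) :=
  inferInstanceAs (AddCommGroup (LinearMap.ker (d (k := k) (A := A) n)))

instance (n : ℕ) : Module k (Cocycle k A n) :=
  inferInstanceAs (Module k (LinearMap.ker (d (k := k) (A := A) n)))

/-- The inclusion of the cocycles into the cochains. -/
def Cocycle.incl (n : ℕ) : Cocycle k A n →ₗ[k] Cochain k A n :=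
  (LinearMap.ker (d (k := k) (A := A) n)).subtype

theorem Cocycle.incl_injective (n : ℕ) :
    Function.Injective (Cocycle.incl n : Cocycle k A n →ₗ[k] Cochain k A n) :=
  Subtype.val_injective

theorem Cocycle.d_incl {n : ℕ} (f : Cocycle k A n) : d n (Cocycle.incl n f) = 0 := f.2

/-- The Hochschild `n`-coboundaries of `A`: the image of the differential. -/
def coboundaries (k A : Type*) [Field k] [Ring A] [Algebra k A] :
    (n : ℕ) → Submodule k (Cochain k A n)
  | 0 => ⊥
  | n + 1 => LinearMap.range (d n)

/-- The Hochschild cohomology group `HHⁿ(A) = HHⁿ(A, A)`, cocycles modulo coboundaries. Since `k`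
is a field, this is `Extⁿ` of `A` by `A` over the enveloping algebra of `A`, computed by means of
the bar resolution of `A`. -/
abbrev HH (k A : Type*) [Field k] [Ring A] [Algebra k A] (n : ℕ) : Type _ :=
  Cocycle k A n ⧸ (coboundaries k A n).comap (Cocycle.incl n)

theorem mem_coboundaries {N M : ℕ} (h : N = M + 1) (F : Cochain k A N) (G : Cochain k A M)
    (hFG : ∀ s : ℕ → A, ev F s = ev (d M G) s) : F ∈ coboundaries k A N := by
  subst h
  exact ⟨G, (ext_ev hFG).symm⟩

theorem ev_smul {n : ℕ} (c : k) (f : Cochain k A n) (s : ℕ → A) :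
    ev (c • f) s = c • ev f s := rfl

theorem ev_zero {n : ℕ} (s : ℕ → A) : ev (0 : Cochain k A n) s = 0 := rfl

theorem cup_zero' {n m : ℕ} (f : Cochain k A n) : cup f (0 : Cochain k A m) = 0 :=
  map_zero (cupHom n m f)

theorem zero_cup' {n m : ℕ} (g : Cochain k A m) : cup (0 : Cochain k A n) g = 0 :=
  LinearMap.map_zero₂ (cupHom n m) g

theorem cup_mem_coboundaries_left {n m : ℕ} {f : Cochain k A n} {g : Cochain k A m}
    (hf : f ∈ coboundaries k A n) (hg : d m g = 0) :
    cup f g ∈ coboundaries k A (n + m) := by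
  cases n with
  | zero =>
    rw [(Submodule.mem_bot k).1 hf, zero_cup']
    exact zero_mem _
  | succ n =>
    obtain ⟨h, rfl⟩ := hf
    refine mem_coboundaries (M := n + m) (by omega) _ (cup h g) fun s => ?_
    rw [leibniz, hg, cup_zero', ev_zero, smul_zero, add_zero]

theorem cup_mem_coboundaries_right {n m : ℕ} {f : Cochain k A n} {g : Cochain k A m}
    (hf : d n f = 0) (hg : g ∈ coboundaries k A m) :
    cup f g ∈ coboundaries k A (n + m) := by
  cases m with
  | zero =>
    rw [(Submodule.mem_bot k).1 hg, cup_zero']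
    exact zero_mem _
  | succ m =>
    obtain ⟨h, rfl⟩ := hg
    refine mem_coboundaries (M := n + m) (by omega) _ ((-1 : k) ^ n • cup f h) fun s => ?_
    rw [map_smul, ev_smul, leibniz, hf, zero_cup', ev_zero, zero_add, smul_smul, ← mul_pow,
      neg_one_mul, neg_neg, one_pow, one_smul]

/-- The cup product of two cocycles. -/
def cupCocycle {n m : ℕ} (f : Cocycle k A n) (g : Cocycle k A m) : Cocycle k A (n + m) :=
  ⟨cup (Cocycle.incl n f) (Cocycle.incl m g), ext_ev fun s => by
    rw [leibniz, Cocycle.d_incl, Cocycle.d_incl, cup_zero', zero_cup', ev_zero, ev_zero,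
      smul_zero, add_zero]⟩

theorem incl_cupCocycle {n m : ℕ} (f : Cocycle k A n) (g : Cocycle k A m) :
    Cocycle.incl (n + m) (cupCocycle f g) = cup (Cocycle.incl n f) (Cocycle.incl m g) := rfl

/-- The cup product of cocycles as a bilinear map. -/
def cupCocycleHom (n m : ℕ) :
    Cocycle k A n →ₗ[k] Cocycle k A m →ₗ[k] Cocycle k A (n + m) :=
  LinearMap.mk₂ k cupCocycle
    (fun f f' g => Cocycle.incl_injective _ <| by
      simp only [incl_cupCocycle, map_add]
      exact LinearMap.map_add₂ (cupHom n m) _ _ _)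
    (fun c f g => Cocycle.incl_injective _ <| by
      simp only [incl_cupCocycle, map_smul]
      exact LinearMap.map_smul₂ (cupHom n m) _ _ _)
    (fun f g g' => Cocycle.incl_injective _ <| by
      simp only [incl_cupCocycle, map_add]
      exact map_add (cupHom n m _) _ _)
    (fun c f g => Cocycle.incl_injective _ <| by
      simp only [incl_cupCocycle, map_smul]
      exact map_smul (cupHom n m _) _ _)

/-- The cup product `HHⁿ(A) × HHᵐ(A) → HHⁿ⁺ᵐ(A)` induced by the cup product of cochains. -/
def cupHH (n m : ℕ) (x : HH k A n) (y : HH k A m) : HH k A (n + m) :=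
  Quotient.liftOn₂' x y (fun f g => Submodule.Quotient.mk (cupCocycle f g)) (by
    intro f g f' g' hf hg
    rw [Submodule.quotientRel_def] at hf hg
    refine (Submodule.Quotient.eq _).2 ?_
    have e : cupCocycle f g - cupCocycle f' g' =
        cupCocycle (f - f') g + cupCocycle f' (g - g') := by
      change cupCocycleHom n m f g - cupCocycleHom n m f' g' =
        cupCocycleHom n m (f - f') g + cupCocycleHom n m f' (g - g')
      rw [LinearMap.map_sub₂, map_sub]
      abel
    rw [e]
    exact add_mem (cup_mem_coboundaries_left hf (Cocycle.d_incl g))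
      (cup_mem_coboundaries_right (Cocycle.d_incl f') hg))

theorem cupHH_mk {n m : ℕ} (f : Cocycle k A n) (g : Cocycle k A m) :
    cupHH n m (Submodule.Quotient.mk f) (Submodule.Quotient.mk g) =
      Submodule.Quotient.mk (cupCocycle f g) := rfl

/-- `HHⁿ(A) ∪ HHᵐ(A) = 0` for all `n, m > 0`. -/
def PositiveCupProductsVanish (k A : Type*) [Field k] [Ring A] [Algebra k A] : Prop :=
  ∀ n m : ℕ, 0 < n → 0 < m → ∀ (x : HH k A n) (y : HH k A m), cupHH n m x y = 0

end Hochschild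

/-!
The algebra `A = kQ/I` has as a basis the trivial paths `e v` and the words in the arrows all of
whose consecutive letters have nonzero product (`BoundQuiver.wordPresentation`): a quadratic
monomial ideal is spanned by the paths with two consecutive arrows whose product lies in it. The cup
product of two cocycles `f`, `g` of positive degree is shown to be a coboundary by reducing
everything to the values of cocycles at the chains of arrows `x₁, …, xₙ` in which each `xᵢ xᵢ₊₁` is
a path in `I`. These chains index the generators of the minimal bimodule resolution of `A`, which is
not constructed. Cochains are handled as functions on lists, so that the Hochschild differential
becomes a recursion on lists (`Hochschild.barD`).

* Every cocycle of positive degree is cohomologous to one that vanishes on the `e v`, by repeatedly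
  inserting the separability idempotent `∑ v, e v ⊗ e v` (`Hochschild.exists_vanishesBefore`). Such
  a cocycle is multilinear over the span of the `e v` (`Hochschild.Balanced`), and the cup product
  inherits this.
* A balanced cocycle that vanishes on all chains is a coboundary
  (`Hochschild.WordPresentation.mem_coboundaries_of_chains`). The primitive comes from the
  contraction of the bar resolution that splits the first letter off the first word of length at
  least two.
* Since there are no oriented cycles, the value of a balanced cocycle at a chain is a combination of
  words parallel to the chain, without trivial paths. If nonzero continuations of arrows are unique
  and all words occurring in these values have the first or the last arrow in common with the chain,
  then removing this arrow gives a primitive on chains, so the cocycle is a coboundary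
  (`Hochschild.WordPresentation.mem_coboundaries_of_shared_end`).
* The cup product satisfies the last hypothesis
  (`Hochschild.WordPresentation.shared_end_of_coeff_mul_ne_zero`). Let `v`, `w` be words occurring
  in `f` and `g` at the two parts `c`, `c'` of a chain, with `v w ≠ 0`. The last arrow of `c` times
  the first arrow of `c'` is zero, so `v` does not end or `w` does not begin as the chain does. If,
  say, the first arrow of `w` differs from that of `c'`, then, by uniqueness, the last arrow `x` of
  `v` has product zero with the first arrow of `c'`, so `x c'` is a chain. Now `x w` occurs in
  `x g(c')`, and the cocycle condition at `x c'` identifies `x g(c')` up to sign with an element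
  that ends in the last arrow of `c'`. Hence `w` ends in this arrow. The other case is symmetric.
-/

namespace Hochschild

/-! ### Cochains as functions on lists -/

section ListCochains

variable {k A : Type*} [Field k] [Ring A] [Algebra k A]

/-- The part of the Hochschild differential of `F`, evaluated at the list `a :: l`, that does not
involve the left action of `a`, with the sign for which the term merging `a` with the head of `l` is
positive. The recursion passes from `F` to the function `F (a :: ·)` with `a` inserted. -/
def barTail : (List A → A) → A → List A → A
  | F, a, [] => F [] * a
  | F, a, b :: l => F ((a * b) :: l) - barTail (fun m => F (a :: m)) b l

/-- The Hochschild differential on functions of lists of elements of `A`. -/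
def barD (F : List A → A) : List A → A
  | [] => 0
  | a :: l => a * F l - barTail F a l

theorem barTail_nil (F : List A → A) (a : A) : barTail F a [] = F [] * a := rfl

theorem barTail_cons (F : List A → A) (a b : A) (l : List A) :
    barTail F a (b :: l) = F ((a * b) :: l) - barTail (fun m => F (a :: m)) b l := rfl

theorem barD_cons (F : List A → A) (a : A) (l : List A) :
    barD F (a :: l) = a * F l - barTail F a l := rfl

theorem barTail_congr {F G : List A → A} {a : A} {l : List A}
    (h : ∀ m : List A, m.length = l.length → F m = G m) : barTail F a l = barTail G a l := by
  induction l generalizing F G a with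
  | nil => rw [barTail_nil, barTail_nil, h [] rfl]
  | cons b l ih =>
    rw [barTail_cons, barTail_cons, h _ (by simp),
      ih (F := fun m => F (a :: m)) (G := fun m => G (a :: m)) fun m hm => h _ (by simp [hm])]

theorem barTail_eq_zero {F : List A → A} (h : ∀ m, F m = 0) (a : A) (l : List A) :
    barTail F a l = 0 := by
  induction l generalizing F a with
  | nil => rw [barTail_nil, h, zero_mul]
  | cons b l ih => rw [barTail_cons, h, ih fun m => h (a :: m), sub_zero]

theorem barTail_sub (F G : List A → A) (a : A) (l : List A) :
    barTail (fun m => F m - G m) a l = barTail F a l - barTail G a l := by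
  induction l generalizing F G a with
  | nil => simp only [barTail_nil, sub_mul]
  | cons b l ih =>
    rw [barTail_cons, barTail_cons, barTail_cons,
      ih (fun m => F (a :: m)) (fun m => G (a :: m))]
    abel

theorem barTail_mul_left (c : A) (F : List A → A) (a : A) (l : List A) :
    barTail (fun m => c * F m) a l = c * barTail F a l := by
  induction l generalizing F a with
  | nil => simp only [barTail_nil, mul_assoc]
  | cons b l ih => rw [barTail_cons, barTail_cons, ih (fun m => F (a :: m)), mul_sub]

theorem barTail_sum {V : Type*} (s : Finset V) (F : V → List A → A) (a : A) (l : List A) :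
    barTail (fun m => ∑ v ∈ s, F v m) a l = ∑ v ∈ s, barTail (F v) a l := by
  induction l generalizing F a with
  | nil => simp only [barTail_nil, Finset.sum_mul]
  | cons b l ih =>
    simp only [barTail_cons, ih (fun v m => F v (a :: m)), Finset.sum_sub_distrib]

theorem barTail_barTail (F : List A → A) (a b : A) (l : List A) :
    barTail (barTail F a) b l = barTail F (a * b) l := by
  induction l generalizing F a b with
  | nil => simp only [barTail_nil, mul_assoc]
  | cons c l ih =>
    have h : (fun m => barTail F a (b :: m)) =
        fun m => F ((a * b) :: m) - barTail (fun m => F (a :: m)) b m := rfl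
    rw [barTail_cons, h, barTail_sub, ih (fun m => F (a :: m)) b c, barTail_cons, barTail_cons,
      mul_assoc]
    abel

theorem barD_barD (F : List A → A) (l : List A) (hl : 2 ≤ l.length) : barD (barD F) l = 0 := by
  match l, hl with
  | a :: b :: l, _ =>
    have h : (fun m => barD F (a :: m)) = fun m => a * F m - barTail F a m := rfl
    rw [barD_cons, barTail_cons, h, barTail_sub, barTail_mul_left, barD_cons, barD_cons,
      barTail_barTail, mul_sub, mul_assoc]
    abel

theorem barD_congr {F G : List A → A} {a : A} {l : List A}
    (h : ∀ m : List A, m.length = l.length → F m = G m) : barD F (a :: l) = barD G (a :: l) := by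
  rw [barD_cons, barD_cons, h l rfl, barTail_congr h]

variable (k) in
/-- A function on lists is linear in each entry of its argument. -/
def SlotwiseLinear (F : List A → A) : Prop :=
  ∀ c l : List A, ∃ φ : A →ₗ[k] A, ∀ x, F (c ++ x :: l) = φ x

theorem SlotwiseLinear.map_zero {F : List A → A} (h : SlotwiseLinear k F) (c l : List A) :
    F (c ++ 0 :: l) = 0 := by
  obtain ⟨φ, hφ⟩ := h c l
  rw [hφ, _root_.map_zero]

theorem SlotwiseLinear.map_sum {F : List A → A} (h : SlotwiseLinear k F) (c l : List A)
    {V : Type*} (s : Finset V) (x : V → A) :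
    F (c ++ (∑ v ∈ s, x v) :: l) = ∑ v ∈ s, F (c ++ x v :: l) := by
  obtain ⟨φ, hφ⟩ := h c l
  simp only [hφ, _root_.map_sum]

theorem SlotwiseLinear.sum {V : Type*} {s : Finset V} {F : V → List A → A}
    (h : ∀ v, SlotwiseLinear k (F v)) : SlotwiseLinear k (fun l => ∑ v ∈ s, F v l) := by
  intro c l
  choose φ hφ using fun v => h v c l
  exact ⟨∑ v ∈ s, φ v, fun x => by simp [hφ]⟩

theorem SlotwiseLinear.mul_left {F : List A → A} (h : SlotwiseLinear k F) (a : A) :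
    SlotwiseLinear k (fun l => a * F l) := by
  intro c l
  obtain ⟨φ, hφ⟩ := h c l
  exact ⟨(LinearMap.mulLeft k a).comp φ, fun x => by simp [hφ]⟩

theorem SlotwiseLinear.cons {F : List A → A} (h : SlotwiseLinear k F) (a : A) :
    SlotwiseLinear k (fun l => F (a :: l)) := fun c l => h (a :: c) l

/-- The function on lists given by an `n`-cochain: the value of the cochain on lists of length `n`,
and zero on all other lists. -/
def evalList {n : ℕ} (f : Cochain k A n) (l : List A) : A :=
  if l.length = n then ev f fun i => l.getD i 0 else 0

theorem evalList_of_length {n : ℕ} (f : Cochain k A n) {l : List A} (h : l.length = n) :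
    evalList f l = ev f fun i => l.getD i 0 := if_pos h

theorem evalList_of_length_ne {n : ℕ} (f : Cochain k A n) {l : List A} (h : l.length ≠ n) :
    evalList f l = 0 := if_neg h

theorem evalList_sub {n : ℕ} (f g : Cochain k A n) (l : List A) :
    evalList (f - g) l = evalList f l - evalList g l := by
  unfold evalList ev
  split_ifs <;> simp

theorem evalList_smul {n : ℕ} (c : k) (f : Cochain k A n) (l : List A) :
    evalList (c • f) l = c • evalList f l := by
  unfold evalList ev
  split_ifs <;> simp

theorem evalList_zero {n : ℕ} (l : List A) : evalList (0 : Cochain k A n) l = 0 := by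
  unfold evalList ev
  split_ifs <;> simp

theorem ext_evalList {n : ℕ} {f g : Cochain k A n}
    (h : ∀ l, l.length = n → evalList f l = evalList g l) : f = g := by
  refine ext_ev fun s => ?_
  have := h (List.ofFn fun i : Fin n => s i) (by simp)
  rw [evalList_of_length _ (by simp), evalList_of_length _ (by simp)] at this
  have e : ∀ i < n, (List.ofFn fun i : Fin n => s i).getD i 0 = s i := by
    intro i hi
    simp [List.getD, hi]
  rwa [ev_congr f e, ev_congr g e] at this

theorem slotwiseLinear_evalList {n : ℕ} (f : Cochain k A n) :
    SlotwiseLinear k (evalList f) := by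
  intro c l
  by_cases h : c.length + 1 + l.length = n
  · have hc : c.length < n := by omega
    refine ⟨f.toLinearMap (fun i => (c ++ 0 :: l).getD i 0) ⟨c.length, hc⟩, fun x => ?_⟩
    rw [evalList_of_length _ (by simp; omega), ev, MultilinearMap.toLinearMap_apply]
    congr 1
    funext i
    rw [Function.update_apply]
    split_ifs with hi
    · simp [hi]
    · have hi' : (i : ℕ) ≠ c.length := fun h => hi (Fin.ext h)
      rcases lt_or_gt_of_ne hi' with h1 | h1
      · simp [List.getElem?_append, h1]
      · obtain ⟨j, hj⟩ : ∃ j, (i : ℕ) - c.length = j + 1 := ⟨i - c.length - 1, by omega⟩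
        simp [List.getElem?_append, hj, show ¬ (i : ℕ) < c.length by omega]
  · refine ⟨0, fun x => ?_⟩
    rw [evalList_of_length_ne _ (by simp; omega), LinearMap.zero_apply]

/-- A slotwise linear function is given on lists of length `n` by a cochain. -/
theorem SlotwiseLinear.exists_cochain {G : List A → A} (hG : SlotwiseLinear k G) (n : ℕ) :
    ∃ g : Cochain k A n, ∀ l : List A, l.length = n → evalList g l = G l := by
  have key : ∀ (a : Fin n → A) (i : Fin n), ∃ c l : List A, ∀ x : A,
      List.ofFn (Function.update a i x) = c ++ x :: l := by
    intro a i
    refine ⟨(List.ofFn a).take i, (List.ofFn a).drop (i + 1), fun x => ?_⟩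
    have : List.ofFn (Function.update a i x) = (List.ofFn a).set i x := by
      refine List.ext_getElem (by simp) fun j h1 h2 => ?_
      rw [List.getElem_set]
      simp only [List.getElem_ofFn, Function.update_apply, Fin.ext_iff, eq_comm]
    rw [this, List.set_eq_take_append_cons_drop, if_pos (by simp)]
  refine ⟨MultilinearMap.mk' (fun a => G (List.ofFn a)) ?_ ?_, fun l hl => ?_⟩
  · intro a i x y
    obtain ⟨c, l, h⟩ := key a i
    obtain ⟨φ, hφ⟩ := hG c l
    simp only [h, hφ, map_add]
  · intro a i r x
    obtain ⟨c, l, h⟩ := key a i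
    obtain ⟨φ, hφ⟩ := hG c l
    simp only [h, hφ, map_smul]
  · rw [evalList_of_length _ hl, ev]
    change G (List.ofFn _) = G l
    congr 1
    refine List.ext_getElem (by simp [hl]) fun j h1 h2 => ?_
    simp [h2]

/-- The sequence `a, s 0, s 1, …`. -/
def consSeq (a : A) (s : ℕ → A) : ℕ → A
  | 0 => a
  | i + 1 => s i

theorem getD_cons_eq_consSeq (a : A) (l : List A) :
    (fun i => (a :: l).getD i 0) = consSeq a fun i => l.getD i 0 := by
  funext i
  cases i <;> rfl

theorem mulAt_zero_consSeq (a b : A) (s : ℕ → A) :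
    mulAt 0 (consSeq a (consSeq b s)) = consSeq (a * b) s := by
  funext i
  cases i <;> rfl

theorem mulAt_succ_consSeq (j : ℕ) (a : A) (s : ℕ → A) :
    mulAt (j + 1) (consSeq a s) = consSeq a (mulAt j s) := by
  funext i
  cases i with
  | zero => rfl
  | succ i => simp [mulAt, consSeq]

theorem barTail_eq_sum (Φ : (ℕ → A) → A) (a : A) (l : List A) :
    barTail (fun m => Φ fun i => m.getD i 0) a l =
      ∑ j ∈ Finset.range l.length, (-1 : k) ^ j • Φ (mulAt j fun i => (a :: l).getD i 0) +
      (-1 : k) ^ l.length •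
        (Φ (fun i => (a :: l).dropLast.getD i 0) * (a :: l).getD l.length 0) := by
  induction l generalizing Φ a with
  | nil => simp [barTail_nil]
  | cons b l ih =>
    have h : (fun m : List A => Φ fun i => (a :: m).getD i 0) =
        fun m => (fun s => Φ (consSeq a s)) fun i => m.getD i 0 := by
      funext m
      rw [getD_cons_eq_consSeq]
    rw [barTail_cons, h, ih fun s => Φ (consSeq a s), List.length_cons, Finset.sum_range_succ',
      getD_cons_eq_consSeq a (b :: l)]
    simp only [mulAt_succ_consSeq, List.dropLast_cons_cons, getD_cons_eq_consSeq]
    simp only [mulAt_zero_consSeq, pow_succ, pow_zero, one_smul, mul_neg, mul_one,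
      neg_smul, Finset.sum_neg_distrib]
    abel

theorem barD_evalList {n : ℕ} (f : Cochain k A n) (l : List A) :
    barD (evalList f) l = evalList (d n f) l := by
  cases l with
  | nil => rw [evalList_of_length_ne _ (by simp)]; rfl
  | cons a l =>
    by_cases h : l.length = n
    · subst h
      have h1 : barTail (evalList f) a l = barTail (fun m => ev f fun i => m.getD i 0) a l :=
        barTail_congr fun m hm => evalList_of_length f hm
      have h2 : ev f (fun i => (a :: l).dropLast.getD i 0) =
          ev f fun i => (a :: l).getD i 0 := by
        refine ev_congr f fun i hi => ?_
        rw [List.getD_eq_getElem _ _ (by simpa using hi),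
          List.getD_eq_getElem _ _ (by simp; omega), List.getElem_dropLast]
      rw [barD_cons, h1, barTail_eq_sum (k := k) (ev f), h2, evalList_of_length f rfl,
        evalList_of_length _ (by simp), ev_d]
      simp only [pow_succ, mul_neg, mul_one, neg_smul, Finset.sum_neg_distrib,
        List.getD_cons_succ, List.getD_cons_zero]
      abel
    · rw [evalList_of_length_ne _ (by simpa using h), barD_cons, evalList_of_length_ne _ h,
        barTail_congr (G := fun _ => 0) fun m hm => evalList_of_length_ne f (by omega),
        barTail_eq_zero fun _ => rfl]
      simp

theorem evalList_sub_d {n : ℕ} (f : Cochain k A (n + 1)) (g : Cochain k A n) (l : List A) :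
    evalList (f - d n g) l = evalList f l - barD (evalList g) l := by
  rw [evalList_sub, barD_evalList]

theorem barD_evalList_of_cocycle {n : ℕ} {f : Cochain k A n} (hf : d n f = 0) (l : List A) :
    barD (evalList f) l = 0 := by
  rw [barD_evalList, hf, evalList_zero]

theorem d_d {n : ℕ} (f : Cochain k A n) : d (n + 1) (d n f) = 0 := by
  refine ext_evalList fun l hl => ?_
  rw [← barD_evalList, evalList_zero, ← barD_barD (evalList f) l (by omega)]
  congr 1
  funext m
  rw [barD_evalList]

end ListCochains

/-! ### Normalization with respect to a complete set of orthogonal idempotents -/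

section Normalization

variable {k A V : Type*} [Field k] [Ring A] [Algebra k A] {e : V → A}

/-- `F` vanishes as soon as one of the first `r` entries of its argument is one of the `e v`. -/
def VanishesBefore (e : V → A) (r : ℕ) (F : List A → A) : Prop :=
  ∀ (c : List A) (v : V) (l : List A), c.length < r → F (c ++ e v :: l) = 0

/-- `F` vanishes on the `e v` in the first `r` entries of its argument, and the `e v` can be moved
across the boundaries of these entries. -/
structure BalancedBefore (e : V → A) (r : ℕ) (F : List A → A) : Prop where
  vanishes : VanishesBefore e r F
  left : 0 < r → ∀ v a l, F ((e v * a) :: l) = e v * F (a :: l)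
  mid : ∀ c a v b l, c.length + 1 < r →
    F (c ++ (a * e v) :: b :: l) = F (c ++ a :: (e v * b) :: l)

theorem VanishesBefore.mono {r r' : ℕ} {F : List A → A} (h : VanishesBefore e r F) (hr : r' ≤ r) :
    VanishesBefore e r' F := fun c v l hc => h c v l (by omega)

theorem VanishesBefore.tail {r : ℕ} {F : List A → A} (h : VanishesBefore e (r + 1) F) (a : A) :
    VanishesBefore e r fun m => F (a :: m) :=
  fun c v l hc => h (a :: c) v l (by simpa using hc)

/-- If `F` vanishes on the idempotents in an initial segment of its entries, then an idempotent in
this segment kills all terms of the differential but those that merge entries after it, those that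
merge the idempotent itself, and the last one. -/
theorem barTail_append_of_vanishesBefore {F : List A → A} (x : A) (c : List A) (a : A) (v : V)
    (l : List A) (h : VanishesBefore e (c.length + 2) F) :
    barTail F x (c ++ a :: e v :: l) =
      (-1 : k) ^ (c.length + 1) • barTail (fun m => F ((x :: c) ++ m)) a (e v :: l) := by
  induction c generalizing F x with
  | nil =>
    have h0 : F ((x * a) :: e v :: l) = 0 := h [x * a] v l (by simp)
    rw [List.nil_append, barTail_cons, h0]
    simp
  | cons y c ih =>
    have h0 : F ((x * y) :: (c ++ a :: e v :: l)) = 0 := by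
      have := h ((x * y) :: c ++ [a]) v l (by simp)
      simpa using this
    rw [List.cons_append, barTail_cons, h0, ih y (VanishesBefore.tail (by simpa using h) x),
      List.length_cons, pow_succ (-1 : k) (c.length + 1), mul_neg, mul_one, neg_smul, zero_sub]
    rfl

theorem barD_append_of_vanishesBefore {F : List A → A} (c : List A) (a : A) (v : V) (l : List A)
    (h : VanishesBefore e (c.length + 1) F) :
    barD F (c ++ a :: e v :: l) =
      (-1 : k) ^ (c.length + 1) • barTail (fun m => F (c ++ m)) a (e v :: l) := by
  cases c with
  | nil =>
    have h0 : F (e v :: l) = 0 := h [] v l (by simp)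
    rw [List.nil_append, barD_cons, h0]
    simp
  | cons x c =>
    have h0 : F (c ++ a :: e v :: l) = 0 := by
      have := h (c ++ [a]) v l (by simp)
      simpa using this
    rw [List.cons_append, barD_cons, h0, barTail_append_of_vanishesBefore (k := k) x c a v l h,
      List.length_cons, pow_succ (-1 : k) (c.length + 1)]
    simp

theorem barTail_eq_zero_of_balanced {F : List A → A} {r : ℕ} (h : VanishesBefore e r F)
    (hm : ∀ c a v b l, c.length + 1 < r →
      F (c ++ (a * e v) :: b :: l) = F (c ++ a :: (e v * b) :: l))
    (a : A) (c : List A) (v : V) (l : List A) (hc : c.length + 1 < r)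
    (hl : l ≠ [] ∨ ∀ c a v, F (c ++ [a * e v]) = F (c ++ [a]) * e v) :
    barTail F a (c ++ e v :: l) = 0 := by
  induction c generalizing F r a with
  | nil =>
    rw [List.nil_append, barTail_cons]
    cases l with
    | nil =>
      have := (hl.resolve_left (by simp)) [] a v
      rw [barTail_nil, sub_eq_zero]
      simpa using this
    | cons b l =>
      have h1 := hm [] a v b l hc
      simp only [List.nil_append] at h1
      have h2 : barTail (fun m => (fun m => F (a :: m)) (e v :: m)) b l = 0 :=
        barTail_eq_zero (fun m => h [a] v m (by simpa using hc)) b l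
      rw [barTail_cons, h2, sub_zero, h1, sub_self]
  | cons y c ih =>
    obtain ⟨r, rfl⟩ : ∃ s, r = s + 1 := ⟨r - 1, by omega⟩
    have h0 : F ((a * y) :: (c ++ e v :: l)) = 0 :=
      h ((a * y) :: c) v l (by simp at hc ⊢; omega)
    rw [List.cons_append, barTail_cons, h0, zero_sub, neg_eq_zero]
    refine ih (F := fun m => F (a :: m)) (h.tail a) (fun c' a' v b l hc' => ?_) y
      (by simp at hc ⊢; omega) ?_
    · exact hm (a :: c') a' v b l (by simp; omega)
    · exact hl.imp_right fun hr c' a' v => hr (a :: c') a' v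

/-- The differential of a balanced function vanishes on idempotents. -/
theorem barD_eq_zero_of_balanced {F : List A → A} {r : ℕ} (h : BalancedBefore e r F)
    (c : List A) (v : V) (l : List A) (hc : c.length < r)
    (hl : l ≠ [] ∨ F [] = 0 ∧ ∀ c a v, F (c ++ [a * e v]) = F (c ++ [a]) * e v) :
    barD F (c ++ e v :: l) = 0 := by
  cases c with
  | nil =>
    rw [List.nil_append, barD_cons]
    cases l with
    | nil =>
      have := (hl.resolve_left (by simp)).1
      rw [barTail_nil, this]
      simp
    | cons b l =>
      have h2 : barTail (fun m => F (e v :: m)) b l = 0 :=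
        barTail_eq_zero (fun m => h.vanishes [] v m hc) b l
      rw [barTail_cons, h2, sub_zero, h.left hc, sub_self]
  | cons a c =>
    have h0 : F (c ++ e v :: l) = 0 := h.vanishes c v l (by simp at hc; omega)
    rw [List.cons_append, barD_cons, h0, mul_zero, zero_sub, neg_eq_zero]
    exact barTail_eq_zero_of_balanced h.vanishes h.mid a c v l (by simpa using hc)
      (hl.imp_right And.right)

/-- A cocycle that vanishes on idempotents is balanced. -/
theorem BalancedBefore.of_vanishesBefore (k : Type*) [Field k] [Algebra k A] {F : List A → A}
    {r : ℕ} (hF : ∀ l, barD F l = 0) (h : VanishesBefore e r F) : BalancedBefore e r F where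
  vanishes := h
  left hr v a l := by
    have h0 := hF (e v :: a :: l)
    have h2 : barTail (fun m => F (e v :: m)) a l = 0 :=
      barTail_eq_zero (fun m => h [] v m hr) a l
    rw [barD_cons, barTail_cons, h2, sub_zero, sub_eq_zero] at h0
    exact h0.symm
  mid c a v b l hc := by
    have h0 := hF (c ++ a :: e v :: b :: l)
    have h2 : barTail (fun m => F (c ++ a :: e v :: m)) b l = 0 :=
      barTail_eq_zero (fun m => by
        have := h (c ++ [a]) v m (by simpa using hc)
        simpa using this) b l
    rw [barD_append_of_vanishesBefore (k := k) c a v (b :: l) (h.mono (by omega)),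
      barTail_cons, barTail_cons] at h0
    have h3 := (smul_eq_zero.1 h0).resolve_left (pow_ne_zero _ (neg_ne_zero.2 one_ne_zero))
    simp only [h2, sub_zero, sub_eq_zero] at h3
    exact h3

/-- Replaces the `j`-th entry `a` of a list by the two entries `a * u` and `u`. -/
def insertAfter : ℕ → A → List A → List A
  | 0, u, a :: l => (a * u) :: u :: l
  | j + 1, u, a :: l => a :: insertAfter j u l
  | _, _, [] => []

theorem insertAfter_append (c : List A) (u : A) (l : List A) :
    insertAfter c.length u (c ++ l) = c ++ insertAfter 0 u l := by
  induction c with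
  | nil => rfl
  | cons x c ih => simp [insertAfter, ih]

theorem insertAfter_append_of_lt {j : ℕ} (c : List A) (u a : A) (l : List A) (h : c.length < j) :
    insertAfter j u (c ++ a :: l) = c ++ a :: insertAfter (j - c.length - 1) u l := by
  induction c generalizing j with
  | nil =>
    obtain ⟨j, rfl⟩ : ∃ i, j = i + 1 := ⟨j - 1, by simp at h; omega⟩
    simp [insertAfter]
  | cons x c ih =>
    obtain ⟨j, rfl⟩ : ∃ i, j = i + 1 := ⟨j - 1, by simp at h; omega⟩
    simp only [List.cons_append, insertAfter, List.length_cons]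
    rw [ih (by simpa using h)]
    congr 4
    omega

theorem exists_insertAfter_cons (j : ℕ) (u : A) (l : List A) :
    ∃ (y : A) (r : List A), ∀ b, insertAfter j u (b :: l) = (b * y) :: r := by
  cases j with
  | zero => exact ⟨u, u :: l, fun b => rfl⟩
  | succ j => exact ⟨1, insertAfter j u l, fun b => by rw [mul_one]; rfl⟩

theorem SlotwiseLinear.insertAfter {F : List A → A} (hF : SlotwiseLinear k F) (j : ℕ) (u : A) :
    SlotwiseLinear k fun l => F (insertAfter j u l) := by
  intro c l
  suffices h : ∃ (c' l' : List A) (ψ : A →ₗ[k] A), ∀ x,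
      Hochschild.insertAfter j u (c ++ x :: l) = c' ++ ψ x :: l' by
    obtain ⟨c', l', ψ, h⟩ := h
    obtain ⟨φ, hφ⟩ := hF c' l'
    exact ⟨φ.comp ψ, fun x => by simp only [h, hφ, LinearMap.comp_apply]⟩
  induction c generalizing j with
  | nil =>
    cases j with
    | zero => exact ⟨[], u :: l, LinearMap.mulRight k u, fun x => rfl⟩
    | succ j => exact ⟨[], Hochschild.insertAfter j u l, LinearMap.id, fun x => rfl⟩
  | cons a c ih =>
    cases j with
    | zero => exact ⟨(a * u) :: u :: c, l, LinearMap.id, fun x => rfl⟩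
    | succ j =>
      obtain ⟨c', l', ψ, h⟩ := ih j
      exact ⟨a :: c', l', ψ, fun x => by simp [Hochschild.insertAfter, h]⟩

variable [Fintype V]

/-- If the terms of the differential of `F` that come from the entries after the first cancel, then
inserting the separability idempotent `∑ v, e v ⊗ e v` after the first entry yields a primitive of
`F` on the lists whose second entry is an idempotent. -/
theorem barTail_sum_insertAfter (he : CompleteOrthogonalIdempotents e) {F : List A → A}
    (hF : SlotwiseLinear k F) (hd : ∀ a v m, barTail F a (e v :: m) = 0) (a : A) (w : V)
    (m : List A) :
    barTail (fun m => ∑ v, F (insertAfter 0 (e v) m)) a (e w :: m) = F (a :: e w :: m) := by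
  classical
  have h1 : ∀ v, barTail (fun m => F ((a * e v) :: e v :: m)) (e w) m =
      F ((a * e v) :: (e v * e w) :: m) - F ((a * e v) :: e w :: m) := by
    intro v
    have := hd (a * e v) v (e w :: m)
    rw [barTail_cons, barTail_cons, mul_assoc, (he.idem v).eq] at this
    rw [eq_sub_iff_add_eq, ← sub_eq_zero, ← this]
    abel
  have hz : ∀ v, v ≠ w → F ((a * e v) :: (e v * e w) :: m) = 0 := fun v hv => by
    rw [he.ortho hv]
    exact hF.map_zero [a * e v] m
  have hz' : ∀ v, v ≠ w → F ((a * e w * e v) :: e v :: m) = 0 := fun v hv => by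
    rw [mul_assoc, he.ortho hv.symm, mul_zero]
    exact hF.map_zero [] (e v :: m)
  have hs : ∑ v, F ((a * e v) :: e w :: m) = F (a :: e w :: m) := by
    have := hF.map_sum [] (e w :: m) Finset.univ fun v => a * e v
    rw [← Finset.mul_sum, he.complete, mul_one] at this
    exact this.symm
  rw [barTail_cons]
  simp only [insertAfter]
  rw [barTail_sum, Finset.sum_congr rfl fun v _ => h1 v, Finset.sum_sub_distrib, hs,
    Finset.sum_eq_single w (fun v _ hv => hz v hv) (by simp),
    Finset.sum_eq_single w (fun v _ hv => hz' v hv) (by simp), mul_assoc, (he.idem w).eq]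
  abel

/-- A cocycle can be made to vanish on idempotents in its first entry, by subtracting the coboundary
of `l ↦ ∑ v, e v * f (e v :: l)`. -/
theorem exists_vanishesBefore_one (he : CompleteOrthogonalIdempotents e) {n : ℕ}
    {f : Cochain k A (n + 1)} (hf : d (n + 1) f = 0) :
    ∃ g : Cochain k A n, VanishesBefore e 1 (evalList (f - d n g)) := by
  classical
  set F := evalList f
  have hF : SlotwiseLinear k F := slotwiseLinear_evalList f
  obtain ⟨g, hg⟩ := SlotwiseLinear.exists_cochain
    (SlotwiseLinear.sum (s := Finset.univ) fun v : V => (hF.cons (e v)).mul_left (e v)) n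
  refine ⟨g, fun c w l hc => ?_⟩
  obtain rfl : c = [] := by simpa using hc
  rw [List.nil_append]
  by_cases hl : l.length = n
  swap
  · exact evalList_of_length_ne _ (by simpa using hl)
  have h1 : ∀ v, e v * barTail (fun m => F (e v :: m)) (e w) l =
      e v * F ((e v * e w) :: l) - e v * F (e w :: l) := by
    intro v
    have := congrArg (e v * ·) (barD_evalList_of_cocycle hf (e v :: e w :: l))
    simp only [barD_cons, barTail_cons, mul_zero, mul_sub, ← mul_assoc, (he.idem v).eq] at this
    rw [eq_sub_iff_add_eq, ← sub_eq_zero, ← this]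
    abel
  have hz : ∀ v, v ≠ w → e v * F ((e v * e w) :: l) = 0 := fun v hv => by
    rw [he.ortho hv, show F (0 :: l) = 0 from hF.map_zero [] l, mul_zero]
  have h2 : barD (evalList g) (e w :: l) = F (e w :: l) := by
    rw [barD_congr (l := l) fun m hm => hg m (by omega), barD_cons, barTail_sum]
    simp only [barTail_mul_left, h1]
    rw [Finset.sum_sub_distrib, ← Finset.sum_mul, he.complete, one_mul, Finset.mul_sum,
      Finset.sum_eq_single w (fun v _ hv => hz v hv) (by simp),
      Finset.sum_eq_single w
        (fun v _ hv => by rw [← mul_assoc, he.ortho hv.symm, zero_mul]) (by simp),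
      ← mul_assoc, (he.idem w).eq]
    abel
  rw [evalList_sub_d, h2, sub_self]

/-- A cocycle that vanishes on idempotents in its first `j + 1` entries can be made to vanish on
idempotents in one more entry. -/
theorem exists_vanishesBefore_succ (he : CompleteOrthogonalIdempotents e) {n j : ℕ} (hj : j < n)
    {f : Cochain k A (n + 1)} (hf : d (n + 1) f = 0) (hv : VanishesBefore e (j + 1) (evalList f)) :
    ∃ g : Cochain k A n, VanishesBefore e (j + 2) (evalList (f - d n g)) := by
  classical
  set F := evalList f
  have hF : SlotwiseLinear k F := slotwiseLinear_evalList f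
  have hFb : BalancedBefore e (j + 1) F :=
    .of_vanishesBefore k (barD_evalList_of_cocycle hf) hv
  obtain ⟨g, hg⟩ := SlotwiseLinear.exists_cochain
    (SlotwiseLinear.sum (s := Finset.univ) fun v : V => hF.insertAfter j (e v)) n
  have hgb : BalancedBefore e (j + 1) fun l => ∑ v, F (insertAfter j (e v) l) := by
    refine ⟨fun c w l hc => Finset.sum_eq_zero fun v _ => ?_, fun _ w a l => ?_,
      fun c a w b l hc => Finset.sum_congr rfl fun v _ => ?_⟩
    · rcases (Nat.lt_succ_iff.1 hc).lt_or_eq with hc | rfl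
      · rw [insertAfter_append_of_lt c _ _ _ hc]
        exact hv c w _ (by omega)
      · rw [insertAfter_append, insertAfter]
        by_cases hwv : w = v
        · rw [hwv, (he.idem v).eq]
          exact hv c v _ (by omega)
        · rw [he.ortho hwv]
          exact hF.map_zero _ _
    · rw [Finset.mul_sum]
      refine Finset.sum_congr rfl fun v _ => ?_
      obtain ⟨y, r, h⟩ := exists_insertAfter_cons j (e v) l
      rw [h, h, mul_assoc, hFb.left (by omega)]
    · have hc' : c.length < j := by omega
      obtain ⟨y, r, h⟩ := exists_insertAfter_cons (j - c.length - 1) (e v) l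
      rw [insertAfter_append_of_lt c _ _ _ hc', insertAfter_append_of_lt c _ _ _ hc', h, h,
        mul_assoc, hFb.mid c a w _ _ (by omega)]
  refine ⟨(-1 : k) ^ (j + 1) • g, fun c w l hc => ?_⟩
  by_cases hl : (c ++ e w :: l).length = n + 1
  swap
  · exact evalList_of_length_ne _ hl
  have hgD : barD (evalList g) (c ++ e w :: l) =
      barD (fun l => ∑ v, F (insertAfter j (e v) l)) (c ++ e w :: l) := by
    have hne : c ++ e w :: l ≠ [] := by simp
    obtain ⟨x, m, hxm⟩ := List.exists_cons_of_ne_nil hne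
    rw [hxm] at hl ⊢
    exact barD_congr fun m' hm' => hg m' (by simp at hl; omega)
  rw [map_smul, evalList_sub, evalList_smul, ← barD_evalList, hgD]
  rcases (Nat.lt_succ_iff.1 hc).lt_or_eq with hc | hc
  · have hl0 : l ≠ [] := by
      rintro rfl
      simp at hl
      omega
    rw [barD_eq_zero_of_balanced hgb c w l hc (Or.inl hl0), smul_zero, sub_zero]
    exact hv c w l hc
  · obtain ⟨c, a, rfl⟩ : ∃ c' a, c = c' ++ [a] :=
      ⟨c.dropLast, c.getLast (by rintro rfl; simp at hc), (List.dropLast_append_getLast _).symm⟩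
    obtain rfl : c.length = j := by simpa using hc
    have hG : (fun m => ∑ v, F (insertAfter c.length (e v) (c ++ m))) = fun m =>
        ∑ v, F (c ++ insertAfter 0 (e v) m) := by
      funext m
      refine Finset.sum_congr rfl fun v _ => ?_
      rw [insertAfter_append]
    have hFc : SlotwiseLinear k fun m => F (c ++ m) := fun c' l => by
      obtain ⟨φ, hφ⟩ := hF (c ++ c') l
      exact ⟨φ, fun x => by rw [← hφ, List.append_assoc]⟩
    have hQ : ∀ a v m, barTail (fun m => F (c ++ m)) a (e v :: m) = 0 := by
      intro a v m
      have := barD_evalList_of_cocycle hf (c ++ a :: e v :: m)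
      rw [barD_append_of_vanishesBefore (k := k) c a v m hv] at this
      exact (smul_eq_zero.1 this).resolve_left (pow_ne_zero _ (neg_ne_zero.2 one_ne_zero))
    rw [List.append_assoc, List.singleton_append,
      barD_append_of_vanishesBefore (k := k) c a w l hgb.vanishes, hG,
      barTail_sum_insertAfter he hFc hQ, smul_smul, ← mul_pow, neg_one_mul, neg_neg, one_pow,
      one_smul, sub_self]

/-- Every cocycle of positive degree is cohomologous to one that vanishes as soon as one of its
arguments is one of the idempotents `e v`. -/
theorem exists_vanishesBefore (he : CompleteOrthogonalIdempotents e) {n : ℕ}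
    {f : Cochain k A (n + 1)} (hf : d (n + 1) f = 0) :
    ∃ g : Cochain k A n, ∀ r, VanishesBefore e r (evalList (f - d n g)) := by
  have key : ∀ j ≤ n, ∃ g : Cochain k A n, VanishesBefore e (j + 1) (evalList (f - d n g)) := by
    intro j hj
    induction j with
    | zero => exact exists_vanishesBefore_one he hf
    | succ j ih =>
      obtain ⟨g, hg⟩ := ih (by omega)
      obtain ⟨g', hg'⟩ := exists_vanishesBefore_succ he (by omega)
        (by rw [map_sub, hf, d_d, sub_zero] : d (n + 1) (f - d n g) = 0) hg
      exact ⟨g + g', by rwa [map_add, ← sub_sub]⟩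
  obtain ⟨g, hg⟩ := key n le_rfl
  refine ⟨g, fun r c v l hc => ?_⟩
  by_cases hl : (c ++ e v :: l).length = n + 1
  · exact hg c v l (by simp at hl; omega)
  · exact evalList_of_length_ne _ hl

end Normalization

section Balanced

variable {k A V : Type*} [Field k] [Ring A] [Algebra k A] {e : V → A}

/-- `F` vanishes as soon as an entry of its argument is one of the `e v`, and it is multilinear over
the span of the `e v`. -/
structure Balanced (e : V → A) (F : List A → A) : Prop where
  vanishes : ∀ c v l, F (c ++ e v :: l) = 0
  left : ∀ v a l, F ((e v * a) :: l) = e v * F (a :: l)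
  mid : ∀ c a v b l, F (c ++ (a * e v) :: b :: l) = F (c ++ a :: (e v * b) :: l)
  right : ∀ c a v, F (c ++ [a * e v]) = F (c ++ [a]) * e v

theorem Balanced.of_cocycle (k : Type*) [Field k] [Algebra k A] {F : List A → A}
    (hF : ∀ l, barD F l = 0) (h : ∀ r, VanishesBefore e r F) : Balanced e F where
  vanishes c v l := h _ c v l (Nat.lt_succ_self _)
  left := (BalancedBefore.of_vanishesBefore k hF (h 1)).left one_pos
  mid c a v b l := (BalancedBefore.of_vanishesBefore k hF (h _)).mid c a v b l (Nat.lt_succ_self _)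
  right c a v := by
    have h0 := hF (c ++ a :: e v :: [])
    rw [barD_append_of_vanishesBefore (k := k) c a v [] (h _), barTail_cons, barTail_nil] at h0
    exact sub_eq_zero.1
      ((smul_eq_zero.1 h0).resolve_left (pow_ne_zero _ (neg_ne_zero.2 one_ne_zero)))

theorem Balanced.barD_vanishes {F : List A → A} (h : Balanced e F) (h0 : F [] = 0) (c : List A)
    (v : V) (l : List A) : barD F (c ++ e v :: l) = 0 :=
  barD_eq_zero_of_balanced (r := c.length + 1)
    ⟨fun c v l _ => h.vanishes c v l, fun _ => h.left, fun c a v b l _ => h.mid c a v b l⟩ c v l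
    (Nat.lt_succ_self _) (Or.inr ⟨h0, h.right⟩)

end Balanced

/-! ### Multilinear extension from a basis -/

section Extension

variable {k A ι : Type*} [Field k] [Ring A] [Algebra k A] (b : Module.Basis ι k A)

/-- The slotwise linear function with prescribed values on lists of basis elements. -/
noncomputable def extendBasis : (List ι → A) → List A → A
  | val, [] => val []
  | val, a :: l => b.constr k (fun i => extendBasis (fun m => val (i :: m)) l) a

theorem extendBasis_eq_zero {val : List ι → A} {l : List A}
    (h : ∀ m, m.length = l.length → val m = 0) : extendBasis b val l = 0 := by
  induction l generalizing val with
  | nil => exact h [] rfl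
  | cons a l ih =>
    have : (fun i => extendBasis b (fun m => val (i :: m)) l) = fun _ => 0 := by
      funext i
      exact ih fun m hm => h _ (by simp [hm])
    rw [extendBasis, this, show (fun _ : ι => (0 : A)) = 0 from rfl, map_zero,
      LinearMap.zero_apply]

theorem extendBasis_basis_cons (val : List ι → A) (i : ι) (l : List A) :
    extendBasis b val (b i :: l) = extendBasis b (fun m => val (i :: m)) l := by
  rw [extendBasis, Module.Basis.constr_basis]

theorem extendBasis_map (val : List ι → A) (m : List ι) :
    extendBasis b val (m.map b) = val m := by
  induction m generalizing val with
  | nil => rfl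
  | cons i m ih => rw [List.map_cons, extendBasis_basis_cons, ih]

theorem slotwiseLinear_extendBasis (val : List ι → A) :
    SlotwiseLinear k (extendBasis b val) := by
  intro c l
  induction c generalizing val with
  | nil => exact ⟨b.constr k fun i => extendBasis b (fun m => val (i :: m)) l, fun x => rfl⟩
  | cons a c ih =>
    choose φ hφ using fun i => ih fun m => val (i :: m)
    refine ⟨(LinearMap.applyₗ a).comp ((b.constr k).toLinearMap.comp (LinearMap.pi φ)),
      fun x => ?_⟩
    rw [List.cons_append, extendBasis]
    simp only [hφ]
    rfl

/-- A slotwise linear function that vanishes on lists of basis elements is zero. -/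
theorem SlotwiseLinear.eq_zero_of_basis {F : List A → A} (hF : SlotwiseLinear k F)
    (h : ∀ m : List ι, F (m.map b) = 0) (l : List A) : F l = 0 := by
  suffices H : ∀ m : List ι, F (m.map b ++ l) = 0 from H []
  induction l with
  | nil => intro m; rw [List.append_nil]; exact h m
  | cons a l ih =>
    intro m
    obtain ⟨φ, hφ⟩ := hF (m.map b) l
    have : φ = 0 := b.ext fun i => by
      have := ih (m ++ [i])
      rw [List.map_append, List.append_assoc] at this
      rw [← hφ, LinearMap.zero_apply]
      exact this
    rw [hφ, this, LinearMap.zero_apply]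

/-- A basis all of whose elements are homogeneous for the idempotents `e v` on both sides. -/
structure HomogeneousBasis {V : Type*} (e : V → A) (src tgt : ι → V) : Prop where
  src_mul : ∀ i, e (src i) * b i = b i
  mul_tgt : ∀ i, b i * e (tgt i) = b i
  ne_mul : ∀ i v, v ≠ src i → e v * b i = 0
  mul_ne : ∀ i v, v ≠ tgt i → b i * e v = 0
  exists_eq : ∀ v, ∃ i, b i = e v

section

variable {V : Type*} {e : V → A} {src tgt : ι → V} {b} {val : List ι → A}

theorem extendBasis_append_idem (hb : HomogeneousBasis b e src tgt)
    (h : ∀ c i v l, b i = e v → val (c ++ i :: l) = 0) (c : List A) (v : V) (l : List A) :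
    extendBasis b val (c ++ e v :: l) = 0 := by
  induction c generalizing val with
  | nil =>
    obtain ⟨i, hi⟩ := hb.exists_eq v
    rw [List.nil_append, ← hi, extendBasis_basis_cons]
    exact extendBasis_eq_zero b fun m _ => h [] i v m hi
  | cons a c ih =>
    have : (fun i => extendBasis b (fun m => val (i :: m)) (c ++ e v :: l)) = 0 := by
      funext i
      exact ih fun c' => h (i :: c')
    rw [List.cons_append, extendBasis, this, map_zero, LinearMap.zero_apply]

theorem extendBasis_idem_mul (hb : HomogeneousBasis b e src tgt)
    (h : ∀ i l, e (src i) * val (i :: l) = val (i :: l)) (he : OrthogonalIdempotents e)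
    (v : V) (a : A) (l : List A) :
    extendBasis b val ((e v * a) :: l) = e v * extendBasis b val (a :: l) := by
  have key : ∀ i, e (src i) * extendBasis b (fun m => val (i :: m)) l =
      extendBasis b (fun m => val (i :: m)) l := by
    intro i
    have hi : (fun m => val (i :: m)) = fun m => e (src i) * val (i :: m) := by
      funext m
      rw [h]
    have hs : SlotwiseLinear k fun l => e (src i) * extendBasis b (fun m => val (i :: m)) l -
        extendBasis b (fun m => val (i :: m)) l := by
      intro c l
      obtain ⟨φ, hφ⟩ := slotwiseLinear_extendBasis b (fun m => val (i :: m)) c l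
      exact ⟨(LinearMap.mulLeft k (e (src i))).comp φ - φ, fun x => by simp [hφ]⟩
    refine sub_eq_zero.1 (hs.eq_zero_of_basis b (fun m => ?_) l)
    rw [extendBasis_map, h, sub_self]
  have : (b.constr k fun i => extendBasis b (fun m => val (i :: m)) l).comp
        (LinearMap.mulLeft k (e v)) =
      (LinearMap.mulLeft k (e v)).comp
        (b.constr k fun i => extendBasis b (fun m => val (i :: m)) l) := by
    refine b.ext fun i => ?_
    simp only [LinearMap.comp_apply, LinearMap.mulLeft_apply, Module.Basis.constr_basis]
    by_cases hv : v = src i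
    · rw [hv, hb.src_mul, Module.Basis.constr_basis, key]
    · rw [hb.ne_mul i v hv, map_zero, ← key, ← mul_assoc, he.ortho hv, zero_mul]
  exact LinearMap.congr_fun this a

theorem extendBasis_mul_idem (hb : HomogeneousBasis b e src tgt)
    (h : ∀ c i j l, tgt i ≠ src j → val (c ++ i :: j :: l) = 0) (c : List A) (a : A) (v : V)
    (x : A) (l : List A) :
    extendBasis b val (c ++ (a * e v) :: x :: l) =
      extendBasis b val (c ++ a :: (e v * x) :: l) := by
  classical
  induction c generalizing val with
  | nil =>
    have : (b.constr k fun i => extendBasis b (fun m => val (i :: m)) (x :: l)).comp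
          (LinearMap.mulRight k (e v)) =
        b.constr k fun i => extendBasis b (fun m => val (i :: m)) ((e v * x) :: l) := by
      refine b.ext fun i => ?_
      have h1 : (b.constr k fun j => extendBasis b (fun m => val (i :: j :: m)) l).comp
            (LinearMap.mulLeft k (e v)) =
          if v = tgt i then b.constr k fun j => extendBasis b (fun m => val (i :: j :: m)) l
          else 0 := by
        refine b.ext fun j => ?_
        rw [LinearMap.comp_apply, LinearMap.mulLeft_apply]
        have hz : tgt i ≠ src j → extendBasis b (fun m => val (i :: j :: m)) l = 0 := fun hij =>
          extendBasis_eq_zero b fun m _ => h [] i j m hij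
        by_cases hv : v = src j
        · subst hv
          rw [hb.src_mul, Module.Basis.constr_basis]
          split_ifs with hi
          · rw [Module.Basis.constr_basis]
          · exact hz fun hi' => hi hi'.symm
        · rw [hb.ne_mul j v hv, map_zero]
          split_ifs with hi
          · rw [Module.Basis.constr_basis, hz (hi ▸ hv)]
          · rfl
      have h2 := LinearMap.congr_fun h1 x
      rw [LinearMap.comp_apply, LinearMap.mulLeft_apply] at h2
      rw [LinearMap.comp_apply, LinearMap.mulRight_apply, Module.Basis.constr_basis, extendBasis,
        h2]
      by_cases hv : v = tgt i
      · rw [if_pos hv, hv, hb.mul_tgt, Module.Basis.constr_basis, extendBasis]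
      · rw [if_neg hv, hb.mul_ne i v hv, map_zero, LinearMap.zero_apply]
    exact LinearMap.congr_fun this a
  | cons y c ih =>
    rw [List.cons_append, List.cons_append, extendBasis, extendBasis]
    congr 2
    funext i
    exact ih fun c' => h (i :: c')

theorem extendBasis_append_mul_idem (hb : HomogeneousBasis b e src tgt)
    (h : ∀ c i, val (c ++ [i]) * e (tgt i) = val (c ++ [i])) (he : OrthogonalIdempotents e)
    (c : List A) (a : A) (v : V) :
    extendBasis b val (c ++ [a * e v]) = extendBasis b val (c ++ [a]) * e v := by
  induction c generalizing val with
  | nil =>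
    have : (b.constr k fun i => val [i]).comp (LinearMap.mulRight k (e v)) =
        (LinearMap.mulRight k (e v)).comp (b.constr k fun i => val [i]) := by
      refine b.ext fun i => ?_
      simp only [LinearMap.comp_apply, LinearMap.mulRight_apply, Module.Basis.constr_basis]
      have hi : val [i] * e (tgt i) = val [i] := h [] i
      by_cases hv : v = tgt i
      · rw [hv, hb.mul_tgt, Module.Basis.constr_basis, hi]
      · rw [hb.mul_ne i v hv, map_zero, ← hi, mul_assoc, he.ortho (Ne.symm hv), mul_zero]
    exact LinearMap.congr_fun this a
  | cons y c ih =>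
    have h1 : b.constr k (fun i => extendBasis b (fun m => val (i :: m)) (c ++ [a * e v])) =
        (LinearMap.mulRight k (e v)).comp
          (b.constr k fun i => extendBasis b (fun m => val (i :: m)) (c ++ [a])) := by
      refine b.ext fun i => ?_
      simp only [LinearMap.comp_apply, LinearMap.mulRight_apply, Module.Basis.constr_basis]
      exact ih fun c' => h (i :: c')
    exact LinearMap.congr_fun h1 y

theorem balanced_extendBasis (he : OrthogonalIdempotents e)
    (hb : HomogeneousBasis b e src tgt)
    (vanishes : ∀ c i v l, b i = e v → val (c ++ i :: l) = 0)
    (left : ∀ i l, e (src i) * val (i :: l) = val (i :: l))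
    (mid : ∀ c i j l, tgt i ≠ src j → val (c ++ i :: j :: l) = 0)
    (right : ∀ c i, val (c ++ [i]) * e (tgt i) = val (c ++ [i])) :
    Balanced e (extendBasis b val) where
  vanishes := extendBasis_append_idem hb vanishes
  left := extendBasis_idem_mul hb left he
  mid := extendBasis_mul_idem hb mid
  right := extendBasis_append_mul_idem hb right he

end

end Extension

/-! ### Algebras with a basis of words and quadratic monomial relations -/

/-- A presentation of `A` as a quadratic monomial algebra on a quiver with vertices `V` and arrows
`X`: the trivial paths `e v` and the nonempty words in the arrows all of whose consecutive letters
are related by `rel` form a basis, and products of unrelated arrows vanish. Words without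
prescribed end points replace the paths of the quiver; the empty word is not in the basis. -/
structure WordPresentation (k A V X : Type*) [Field k] [Ring A] [Algebra k A] [Fintype V] where
  src : X → V
  tgt : X → V
  /-- The product of the two arrows is nonzero in `A`. -/
  rel : X → X → Prop
  e : V → A
  ar : X → A
  idem : CompleteOrthogonalIdempotents e
  e_mul_ar : ∀ x, e (src x) * ar x = ar x
  ar_mul_e : ∀ x, ar x * e (tgt x) = ar x
  tgt_eq_src : ∀ x y, rel x y → tgt x = src y
  ar_mul_ar : ∀ x y, ¬ rel x y → ar x * ar y = 0
  basis : Module.Basis (V ⊕ {u : List X // u ≠ [] ∧ u.IsChain rel}) k A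
  basis_inl : ∀ v, basis (Sum.inl v) = e v
  basis_inr : ∀ u, basis (Sum.inr u) = (u.1.map ar).prod

namespace WordPresentation

variable {k A V X : Type*} [Field k] [Ring A] [Algebra k A] [Fintype V]
  (p : WordPresentation k A V X)

/-- The element of `A` given by a word in the arrows. -/
def word (u : List X) : A := (u.map p.ar).prod

/-- The words in the basis: the nonempty ones that are nonzero in `A`. -/
def IsWord (u : List X) : Prop := u ≠ [] ∧ u.IsChain p.rel

/-- The arrows can be composed, but their product vanishes in `A`. -/
def zrel (x y : X) : Prop := p.tgt x = p.src y ∧ ¬ p.rel x y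

/-- Consecutive letters of a word can be composed as arrows of the quiver. -/
def Composable (u : List X) : Prop := u.IsChain fun x y => p.tgt x = p.src y

variable {p}

theorem word_singleton (x : X) : p.word [x] = p.ar x := by simp [word]

theorem word_cons (x : X) (u : List X) : p.word (x :: u) = p.ar x * p.word u := by simp [word]

theorem word_append (u v : List X) : p.word (u ++ v) = p.word u * p.word v := by simp [word]

theorem word_eq_zero {u : List X} (h : ¬ u.IsChain p.rel) : p.word u = 0 := by
  induction u with
  | nil => exact absurd .nil h
  | cons x u ih =>
    cases u with
    | nil => exact absurd (.singleton x) h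
    | cons y u =>
      by_cases hxy : p.rel x y
      · rw [word_cons, ih fun hu => h (List.isChain_cons_cons.2 ⟨hxy, hu⟩), mul_zero]
      · rw [word_cons, word_cons, ← mul_assoc, p.ar_mul_ar x y hxy, zero_mul]

theorem map_word_eq_zero {F : List A → A} (hF : SlotwiseLinear k F) {L : List (List X)}
    (h : ¬ ∀ u ∈ L, u.IsChain p.rel) : F (L.map p.word) = 0 := by
  push Not at h
  obtain ⟨u, hu, hu'⟩ := h
  obtain ⟨L₁, L₂, rfl⟩ := List.append_of_mem hu
  rw [List.map_append, List.map_cons, word_eq_zero hu', hF.map_zero]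

theorem map_word_singletons (c : List X) : (c.map fun x => [x]).map p.word = c.map p.ar := by
  simp [Function.comp_def, word_singleton]

theorem flatten_singletons (c : List X) : (c.map fun x => [x]).flatten = c := by
  induction c with
  | nil => rfl
  | cons x c ih => simp [ih]

theorem IsWord.composable {u : List X} (h : p.IsWord u) : p.Composable u :=
  h.2.imp fun x y => p.tgt_eq_src x y

theorem isWord_singleton (x : X) : p.IsWord [x] := ⟨by simp, .singleton x⟩

theorem IsWord.tail {x y : X} {u : List X} (h : p.IsWord (x :: y :: u)) : p.IsWord (y :: u) :=
  ⟨by simp, (List.isChain_cons_cons.1 h.2).2⟩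

variable (p)

/-- The idempotent at the source of a nonempty word. -/
def leftIdem : List X → A
  | [] => 0
  | x :: _ => p.e (p.src x)

/-- The idempotent at the target of a nonempty word. -/
def rightIdem (u : List X) : A := (u.getLast?.map fun x => p.e (p.tgt x)).getD 0

variable {p}

@[simp] theorem leftIdem_cons (x : X) (u : List X) : p.leftIdem (x :: u) = p.e (p.src x) := rfl

@[simp] theorem rightIdem_append_singleton (x : X) (u : List X) :
    p.rightIdem (u ++ [x]) = p.e (p.tgt x) := by simp [rightIdem]

theorem leftIdem_mul_leftIdem (u : List X) : p.leftIdem u * p.leftIdem u = p.leftIdem u := by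
  cases u with
  | nil => simp [leftIdem]
  | cons x u => exact (p.idem.idem _).eq

theorem rightIdem_mul_rightIdem (u : List X) : p.rightIdem u * p.rightIdem u = p.rightIdem u := by
  induction u using List.reverseRecOn with
  | nil => simp [rightIdem]
  | append_singleton u x => rw [rightIdem_append_singleton]; exact (p.idem.idem _).eq

theorem leftIdem_append {u : List X} (h : u ≠ []) (v : List X) :
    p.leftIdem (u ++ v) = p.leftIdem u := by
  cases u with
  | nil => exact absurd rfl h
  | cons x u => rfl

theorem rightIdem_append (u : List X) {v : List X} (h : v ≠ []) :
    p.rightIdem (u ++ v) = p.rightIdem v := by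
  simp [rightIdem, List.getLast?_append_of_ne_nil _ h]

theorem leftIdem_mul_word {u : List X} (h : u ≠ []) : p.leftIdem u * p.word u = p.word u := by
  cases u with
  | nil => exact absurd rfl h
  | cons x u => rw [leftIdem_cons, word_cons, ← mul_assoc, p.e_mul_ar]

theorem word_mul_rightIdem {u : List X} (h : u ≠ []) : p.word u * p.rightIdem u = p.word u := by
  induction u using List.reverseRecOn with
  | nil => exact absurd rfl h
  | append_singleton u x =>
    rw [rightIdem_append_singleton, word_append, word_singleton, mul_assoc, p.ar_mul_e]

variable (p)

open Classical in
/-- The projection of `A` onto the span of the elements parallel to a word, if its letters can be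
composed, and the zero map otherwise. -/
noncomputable def parallelProj (u : List X) : A →ₗ[k] A :=
  if p.Composable u then
    (LinearMap.mulLeft k (p.leftIdem u)).comp (LinearMap.mulRight k (p.rightIdem u))
  else 0

variable {p}

theorem parallelProj_of_composable {u : List X} (h : p.Composable u) (a : A) :
    p.parallelProj u a = p.leftIdem u * (a * p.rightIdem u) := by
  rw [parallelProj, if_pos h]
  rfl

theorem parallelProj_of_not_composable {u : List X} (h : ¬ p.Composable u) (a : A) :
    p.parallelProj u a = 0 := by
  rw [parallelProj, if_neg h, LinearMap.zero_apply]

theorem leftIdem_mul_parallelProj (u : List X) (a : A) :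
    p.leftIdem u * p.parallelProj u a = p.parallelProj u a := by
  by_cases h : p.Composable u
  · rw [parallelProj_of_composable h, ← mul_assoc, leftIdem_mul_leftIdem]
  · rw [parallelProj_of_not_composable h, mul_zero]

theorem parallelProj_mul_rightIdem (u : List X) (a : A) :
    p.parallelProj u a * p.rightIdem u = p.parallelProj u a := by
  by_cases h : p.Composable u
  · rw [parallelProj_of_composable h, mul_assoc, mul_assoc, rightIdem_mul_rightIdem]
  · rw [parallelProj_of_not_composable h, zero_mul]

theorem balanced_eq_zero {F : List A → A} (hF : SlotwiseLinear k F) (hb : Balanced p.e F)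
    {u v : List X} (hu : u ≠ []) (hv : v ≠ []) (huv : ¬ ∀ x ∈ u.getLast?, ∀ y ∈ v.head?,
      p.tgt x = p.src y) (c l : List A) : F (c ++ p.word u :: p.word v :: l) = 0 := by
  obtain ⟨u, x, rfl⟩ : ∃ u' x, u = u' ++ [x] :=
    ⟨u.dropLast, u.getLast hu, (List.dropLast_append_getLast hu).symm⟩
  obtain ⟨y, v, rfl⟩ := List.exists_cons_of_ne_nil hv
  have hxy : p.tgt x ≠ p.src y := by simpa using huv
  rw [← word_mul_rightIdem hu, rightIdem_append_singleton, hb.mid, ← leftIdem_mul_word hv,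
    leftIdem_cons, ← mul_assoc, p.idem.ortho hxy, zero_mul]
  have := hF.map_zero (c ++ [p.word (u ++ [x])]) l
  simpa using this

/-- A multilinear function over the span of the idempotents takes on words a value parallel to their
concatenation. -/
theorem balanced_parallel {F : List A → A} (hF : SlotwiseLinear k F) (hb : Balanced p.e F)
    {L : List (List X)} (hL : L ≠ []) (hL' : ∀ u ∈ L, u ≠ []) :
    p.parallelProj L.flatten (F (L.map p.word)) = F (L.map p.word) := by
  by_cases h : p.Composable L.flatten
  · obtain ⟨u, M, rfl⟩ := List.exists_cons_of_ne_nil hL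
    have h1 : p.leftIdem (u :: M).flatten * F ((u :: M).map p.word) = F ((u :: M).map p.word) := by
      have hu : u ≠ [] := hL' u (by simp)
      obtain ⟨x, u', hx⟩ := List.exists_cons_of_ne_nil hu
      have h2 : p.leftIdem u = p.e (p.src x) := by rw [hx]; rfl
      rw [List.flatten_cons, leftIdem_append hu, h2, List.map_cons, ← hb.left, ← h2,
        leftIdem_mul_word hu]
    have h2 : F ((u :: M).map p.word) * p.rightIdem (u :: M).flatten =
        F ((u :: M).map p.word) := by
      obtain ⟨N, w, hN⟩ : ∃ N w, u :: M = N ++ [w] :=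
        ⟨_, _, (List.dropLast_append_getLast hL).symm⟩
      have hw : w ≠ [] := hL' w (by rw [hN]; simp)
      have h3 : p.rightIdem w = p.e (p.tgt (w.getLast hw)) := by
        simp [rightIdem, List.getLast?_eq_some_getLast hw]
      rw [hN, List.flatten_append, List.flatten_singleton, rightIdem_append _ hw, h3,
        List.map_append, List.map_singleton, ← hb.right, ← h3, word_mul_rightIdem hw]
    rw [parallelProj_of_composable h, h2, h1]
  · rw [parallelProj_of_not_composable h]
    by_cases hc : ∀ u ∈ L, p.Composable u
    · have h1 : ¬ L.IsChain fun u v => ∀ x ∈ u.getLast?, ∀ y ∈ v.head?, p.tgt x = p.src y :=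
        fun h' => h ((List.isChain_flatten (by simpa using fun h => hL' [] h rfl)).2 ⟨hc, h'⟩)
      obtain ⟨L₁, u, v, L₂, rfl, huv⟩ : ∃ L₁ u v L₂, L = L₁ ++ u :: v :: L₂ ∧
          ¬ ∀ x ∈ u.getLast?, ∀ y ∈ v.head?, p.tgt x = p.src y := by
        by_contra! H
        exact h1 (List.isChain_iff_forall_rel_of_append_cons_cons.2 fun u v L₁ L₂ h =>
          H L₁ u v L₂ h)
      have := balanced_eq_zero hF hb (hL' u (by simp)) (hL' v (by simp)) huv (L₁.map p.word)
        (L₂.map p.word)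
      simpa using this.symm
    · exact (map_word_eq_zero hF fun h => hc fun u hu =>
        (h u hu).imp fun x y => p.tgt_eq_src x y).symm

variable (p)

/-- The word of a basis element; the empty word stands for the trivial paths. -/
def wordOf : V ⊕ {u : List X // u ≠ [] ∧ u.IsChain p.rel} → List X
  | .inl _ => []
  | .inr u => u.1

/-- The source of a basis element. -/
def basisSrc : V ⊕ {u : List X // u ≠ [] ∧ u.IsChain p.rel} → V
  | .inl v => v
  | .inr u => p.src (u.1.head u.2.1)

/-- The target of a basis element. -/
def basisTgt : V ⊕ {u : List X // u ≠ [] ∧ u.IsChain p.rel} → V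
  | .inl v => v
  | .inr u => p.tgt (u.1.getLast u.2.1)

variable {p}

theorem leftIdem_eq {u : List X} (h : u ≠ []) : p.leftIdem u = p.e (p.src (u.head h)) := by
  cases u with
  | nil => exact absurd rfl h
  | cons x u => rfl

theorem rightIdem_eq {u : List X} (h : u ≠ []) : p.rightIdem u = p.e (p.tgt (u.getLast h)) := by
  simp [rightIdem, List.getLast?_eq_some_getLast h]

theorem basis_inr' (u : {u : List X // u ≠ [] ∧ u.IsChain p.rel}) :
    p.basis (Sum.inr u) = p.word u.1 := p.basis_inr u

theorem homogeneousBasis : HomogeneousBasis p.basis p.e p.basisSrc p.basisTgt where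
  src_mul i := by
    rcases i with v | u
    · rw [p.basis_inl]; exact (p.idem.idem v).eq
    · rw [basis_inr', basisSrc, ← leftIdem_eq, leftIdem_mul_word u.2.1]
  mul_tgt i := by
    rcases i with v | u
    · rw [p.basis_inl]; exact (p.idem.idem v).eq
    · rw [basis_inr', basisTgt, ← rightIdem_eq, word_mul_rightIdem u.2.1]
  ne_mul i v hv := by
    rcases i with w | u
    · rw [p.basis_inl]; exact p.idem.ortho hv
    · rw [basisSrc] at hv
      rw [basis_inr', ← leftIdem_mul_word u.2.1, leftIdem_eq u.2.1, ← mul_assoc, p.idem.ortho hv,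
        zero_mul]
  mul_ne i v hv := by
    rcases i with w | u
    · rw [p.basis_inl]; exact p.idem.ortho (Ne.symm hv)
    · rw [basisTgt] at hv
      rw [basis_inr', ← word_mul_rightIdem u.2.1, rightIdem_eq u.2.1, mul_assoc,
        p.idem.ortho (Ne.symm hv), mul_zero]
  exists_eq v := ⟨Sum.inl v, p.basis_inl v⟩

/-- Values on tuples of basis words, projected to elements parallel to the words, extend to a
cochain that is multilinear over the span of the idempotents and vanishes on the idempotents. -/
theorem exists_balanced_extension (n : ℕ) (g : List (List X) → A) :
    ∃ f : Cochain k A n, Balanced p.e (evalList f) ∧ ∀ L : List (List X), L.length = n →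
      (∀ u ∈ L, p.IsWord u) →
      evalList f (L.map p.word) = p.parallelProj L.flatten (g L) := by
  classical
  set val : List (V ⊕ {u : List X // u ≠ [] ∧ u.IsChain p.rel}) → A := fun m =>
    if m.length = n ∧ ∀ i ∈ m, p.wordOf i ≠ [] then
      p.parallelProj (m.map p.wordOf).flatten (g (m.map p.wordOf)) else 0 with hval
  obtain ⟨f, hf⟩ := (slotwiseLinear_extendBasis p.basis val).exists_cochain n
  have hf' : evalList f = extendBasis p.basis val := by
    funext l
    by_cases hl : l.length = n
    · exact hf l hl
    · rw [evalList_of_length_ne f hl, extendBasis_eq_zero]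
      intro m hm
      exact if_neg fun h => hl (hm ▸ h.1)
  refine ⟨f, ?_, fun L hL hw => ?_⟩
  · rw [hf']
    refine balanced_extendBasis p.idem.toOrthogonalIdempotents homogeneousBasis
      (fun c i v l hi => ?_) (fun i l => ?_) (fun c i j l hij => ?_) (fun c i => ?_)
    · obtain rfl : i = Sum.inl v := p.basis.injective (hi.trans (p.basis_inl v).symm)
      exact if_neg fun h => h.2 (Sum.inl v) (by simp) rfl
    · simp only [hval]
      split_ifs with h
      · rcases i with v | u
        · exact absurd rfl (h.2 (Sum.inl v) (by simp))
        · rw [basisSrc, ← leftIdem_eq u.2.1]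
          have : p.leftIdem u.1 =
              p.leftIdem ((Sum.inr u :: l).map p.wordOf).flatten := by
            rw [List.map_cons, List.flatten_cons]
            exact (leftIdem_append u.2.1 _).symm
          rw [this, leftIdem_mul_parallelProj]
      · rw [mul_zero]
    · simp only [hval]
      split_ifs with h
      · rcases i with v | u
        · exact absurd rfl (h.2 (Sum.inl v) (by simp))
        rcases j with v | w
        · exact absurd rfl (h.2 (Sum.inl v) (by simp))
        refine parallelProj_of_not_composable (fun hc => hij ?_) _
        have hc' : p.Composable (u.1 ++ w.1) := by
          refine List.IsChain.infix hc ?_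
          simp only [List.map_append, List.map_cons, List.flatten_append, List.flatten_cons]
          exact ⟨(c.map p.wordOf).flatten, (l.map p.wordOf).flatten, by simp [wordOf]⟩
        exact (List.isChain_append.1 hc').2.2 _ (List.getLast?_eq_some_getLast u.2.1) _
          (List.head?_eq_some_head w.2.1)
      · rfl
    · simp only [hval]
      split_ifs with h
      · rcases i with v | u
        · exact absurd rfl (h.2 (Sum.inl v) (by simp))
        · rw [basisTgt, ← rightIdem_eq u.2.1]
          have : p.rightIdem u.1 =
              p.rightIdem ((c ++ [Sum.inr u]).map p.wordOf).flatten := by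
            rw [List.map_append, List.flatten_append, List.map_singleton, List.flatten_singleton]
            exact (rightIdem_append _ u.2.1).symm
          rw [this, parallelProj_mul_rightIdem]
      · rw [zero_mul]
  · set m : List (V ⊕ {u : List X // u ≠ [] ∧ u.IsChain p.rel}) :=
      L.attach.map fun u : {u // u ∈ L} => Sum.inr ⟨u.1, hw u.1 u.2⟩ with hm
    have h1 : m.map p.wordOf = L := by
      simp [hm, Function.comp_def, wordOf]
    have h2 : m.map p.basis = L.map p.word := by
      simp only [hm, List.map_map, Function.comp_def, basis_inr']
      rw [List.attach_map_val]
    rw [← h2, hf', extendBasis_map]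
    simp only [hval]
    rw [h1, if_pos]
    refine ⟨by simp [hm, hL], fun i hi => ?_⟩
    obtain ⟨u, -, rfl⟩ := List.mem_map.1 hi
    exact (hw u.1 u.2).1

/-- A cochain that vanishes on the idempotents and on all tuples of basis words is zero. -/
theorem eq_zero_of_words {n : ℕ} {f : Cochain k A n}
    (hb : ∀ c v l, evalList f (c ++ p.e v :: l) = 0)
    (h : ∀ L : List (List X), (∀ u ∈ L, p.IsWord u) → evalList f (L.map p.word) = 0) : f = 0 := by
  refine ext_evalList fun l _ => ?_
  rw [evalList_zero]
  refine (slotwiseLinear_evalList f).eq_zero_of_basis p.basis (fun m => ?_) l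
  by_cases hm : ∃ v, Sum.inl v ∈ m
  · obtain ⟨v, hv⟩ := hm
    obtain ⟨m₁, m₂, rfl⟩ := List.append_of_mem hv
    rw [List.map_append, List.map_cons, p.basis_inl, hb]
  · have h1 : m.map p.basis = (m.map p.wordOf).map p.word := by
      rw [List.map_map]
      refine List.map_congr_left fun i hi => ?_
      rcases i with v | u
      · exact absurd ⟨v, hi⟩ hm
      · exact basis_inr' u
    rw [h1]
    refine h _ fun u hu => ?_
    obtain ⟨i, hi, rfl⟩ := List.mem_map.1 hu
    rcases i with v | u
    · exact absurd ⟨v, hi⟩ hm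
    · exact u.2

/-! ### Cocycles that vanish on chains of arrows are coboundaries -/

variable (p)

open Classical in
/-- The part of the primitive of `Φ` at tuples of words whose first words are single arrows
with vanishing consecutive products; these have been inserted in `Φ`, and `x` is the last of them.
-/
noncomputable def tailPrimitive : (List (List X) → A) → X → List (List X) → A
  | _, _, [] => 0
  | _, _, [] :: _ => 0
  | Φ, x, (y :: u) :: L =>
    if p.rel x y then 0
    else if u = [] then -tailPrimitive (fun M => Φ ([y] :: M)) y L
    else -Φ ([y] :: u :: L)

/-- The primitive of `Φ` at the tuple with first word `w`. -/
noncomputable def headPrimitive (Φ : List (List X) → A) : List X → List (List X) → A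
  | [], _ => 0
  | [x], L => -p.tailPrimitive (fun M => Φ ([x] :: M)) x L
  | x :: y :: u, L => p.ar x * headPrimitive Φ (y :: u) L - Φ ([x] :: (y :: u) :: L)

/-- The contraction of the bar resolution onto the chains of arrows with vanishing consecutive
products, on tuples of words: split the first letter off the first word of length at least two, as
long as all products before it vanish. If this is the first word of the tuple, its
other letters are split off as well, and the letters before them act from the left. -/
noncomputable def primitive (Φ : List (List X) → A) : List (List X) → A
  | [] => 0
  | w :: L => p.headPrimitive Φ w L

variable {p}

theorem tailPrimitive_singletons (Φ : List (List X) → A) (x : X) (c : List X) :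
    p.tailPrimitive Φ x (c.map fun y => [y]) = 0 := by
  induction c generalizing Φ x with
  | nil => rfl
  | cons y c ih => simp [tailPrimitive, ih]

theorem primitive_singletons (Φ : List (List X) → A) (c : List X) :
    p.primitive Φ (c.map fun y => [y]) = 0 := by
  cases c with
  | nil => rfl
  | cons x c => simp [primitive, headPrimitive, tailPrimitive_singletons]

theorem tailPrimitive_of_rel (Φ : List (List X) → A) (x : X) (c : List X) {y z : X}
    (h : p.rel y z) (u : List X) (L : List (List X)) :
    p.tailPrimitive Φ x ((c.map fun y => [y]) ++ [y] :: (z :: u) :: L) = 0 := by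
  induction c generalizing Φ x with
  | nil => simp [tailPrimitive, h]
  | cons y c ih => simp [tailPrimitive, ih]

theorem primitive_of_rel (Φ : List (List X) → A) (c : List X) {y z : X}
    (h : p.rel y z) (u : List X) (L : List (List X)) :
    p.primitive Φ ((c.map fun y => [y]) ++ [y] :: (z :: u) :: L) = 0 := by
  cases c with
  | nil => simp [primitive, headPrimitive, tailPrimitive, h]
  | cons x c => simp [primitive, headPrimitive, tailPrimitive_of_rel _ _ _ h]

theorem tailPrimitive_split (Φ : List (List X) → A) (x : X) (c : List X) {y : X}
    (h : (x :: (c ++ [y])).IsChain p.zrel) {u : List X} (hu : u ≠ []) (L : List (List X)) :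
    p.tailPrimitive Φ x ((c.map fun y => [y]) ++ (y :: u) :: L) =
      (-1 : k) ^ (c.length + 1) • Φ ((c.map fun y => [y]) ++ [y] :: u :: L) := by
  induction c generalizing Φ x with
  | nil =>
    have := (List.isChain_cons_cons.1 h).1.2
    simp [tailPrimitive, hu, this]
  | cons z c ih =>
    have h' := List.isChain_cons_cons.1 h
    simp only [List.map_cons, List.cons_append, tailPrimitive, if_neg h'.1.2, if_true]
    rw [ih (fun M => Φ ([z] :: M)) z h'.2, List.length_cons, pow_succ (-1 : k) (c.length + 1)]
    simp

theorem primitive_split (Φ : List (List X) → A) (x : X) (c : List X) {y : X}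
    (h : (x :: (c ++ [y])).IsChain p.zrel) {u : List X} (hu : u ≠ []) (L : List (List X)) :
    p.primitive Φ (((x :: c).map fun y => [y]) ++ (y :: u) :: L) =
      (-1 : k) ^ c.length • Φ (((x :: c).map fun y => [y]) ++ [y] :: u :: L) := by
  simp only [List.map_cons, List.cons_append, primitive, headPrimitive]
  rw [tailPrimitive_split (k := k) _ x c h hu L, pow_succ]
  simp

/-- On tuples that begin with a chain of arrows with vanishing consecutive products, the
differential only sees the rest of the tuple. -/
theorem barTail_chain_append {F : List A → A} (hF : SlotwiseLinear k F) (x : X) (c : List X) (y : X)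
    (l : List A) (h : (x :: (c ++ [y])).IsChain p.zrel) :
    barTail F (p.ar x) (c.map p.ar ++ p.ar y :: l) =
      (-1 : k) ^ (c.length + 1) •
        barTail (fun m => F ((x :: c).map p.ar ++ m)) (p.ar y) l := by
  induction c generalizing F x with
  | nil =>
    have h0 : F ((p.ar x * p.ar y) :: l) = 0 := by
      rw [p.ar_mul_ar x y (List.isChain_cons_cons.1 h).1.2]
      exact hF.map_zero [] l
    simp [barTail_cons, h0]
  | cons z c ih =>
    have h' := List.isChain_cons_cons.1 h
    have h0 : F ((p.ar x * p.ar z) :: (c.map p.ar ++ p.ar y :: l)) = 0 := by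
      rw [p.ar_mul_ar x z h'.1.2]
      exact hF.map_zero [] _
    rw [List.map_cons, List.cons_append, barTail_cons, h0, ih (hF.cons (p.ar x)) z h'.2,
      List.length_cons, pow_succ (-1 : k) (c.length + 1)]
    simp

theorem barTail_words_eq_zero {F : List A → A}
    (h : ∀ L : List (List X), (∀ u ∈ L, u ≠ []) → F (L.map p.word) = 0) {w : List X} (hw : w ≠ [])
    {L : List (List X)} (hL : ∀ u ∈ L, u ≠ []) : barTail F (p.word w) (L.map p.word) = 0 := by
  induction L generalizing F w with
  | nil => rw [List.map_nil, barTail_nil, show F [] = 0 from h [] (by simp), zero_mul]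
  | cons v L ih =>
    have hv : v ≠ [] := hL v (by simp)
    have hL' : ∀ u ∈ L, u ≠ [] := fun u hu => hL u (by simp [hu])
    have h1 : F (p.word (w ++ v) :: L.map p.word) = 0 := by
      refine h ((w ++ v) :: L) fun u hu => ?_
      rcases List.mem_cons.1 hu with rfl | hu
      · simp [hw]
      · exact hL' u hu
    rw [List.map_cons, barTail_cons, ← word_append, h1, zero_sub, neg_eq_zero]
    refine ih (fun M hM => ?_) hv hL'
    refine h (w :: M) fun u hu => ?_
    rcases List.mem_cons.1 hu with rfl | hu
    · exact hw
    · exact hM u hu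

/-- If `F` vanishes on the empty tuple and on all tuples whose first word begins with `y`, then the
terms of the differential that keep or lengthen a first word beginning with `y` vanish. -/
theorem barTail_word_eq_zero {F : List A → A} (h0 : F [] = 0) {y : X}
    (h : ∀ (u : List X) (L : List (List X)), (∀ u ∈ L, u ≠ []) →
      F (p.word (y :: u) :: L.map p.word) = 0) (u : List X)
    {L : List (List X)} (hL : ∀ u ∈ L, u ≠ []) :
    barTail F (p.word (y :: u)) (L.map p.word) = 0 := by
  cases L with
  | nil => rw [List.map_nil, barTail_nil, h0, zero_mul]
  | cons v L =>
    have hL' : ∀ u ∈ L, u ≠ [] := fun u hu => hL u (by simp [hu])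
    rw [List.map_cons, barTail_cons, ← word_append, List.cons_append, h _ _ hL', zero_sub,
      neg_eq_zero]
    exact barTail_words_eq_zero (fun M hM => h u M hM) (hL v (by simp)) hL'

/-- The cochain `WordPresentation.primitive` of `f`, described by its values: it vanishes on chains
of arrows and on tuples in which splitting a word would be undone by the next merging, and otherwise
it splits a word. -/
theorem exists_primitive {n : ℕ} {f : Cochain k A (n + 1)} (hb : Balanced p.e (evalList f)) :
    ∃ g : Cochain k A n, Balanced p.e (evalList g) ∧
      (∀ c : List X, evalList g (c.map p.ar) = 0) ∧
      (∀ (c : List X) (y z : X) (u : List X) (L : List (List X)), p.rel y z → (∀ u ∈ L, u ≠ []) →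
        evalList g (c.map p.ar ++ p.ar y :: p.word (z :: u) :: L.map p.word) = 0) ∧
      (∀ (x : X) (c : List X) (y : X) (u : List X) (L : List (List X)),
        (x :: (c ++ [y])).IsChain p.zrel → u ≠ [] → p.IsWord (y :: u) → (∀ u ∈ L, u ≠ []) →
        evalList g ((x :: c).map p.ar ++ p.word (y :: u) :: L.map p.word) =
          (-1 : k) ^ c.length •
            evalList f ((x :: c).map p.ar ++ p.ar y :: p.word u :: L.map p.word)) ∧
      (∀ (x y : X) (u : List X) (L : List (List X)), p.IsWord (x :: y :: u) → (∀ u ∈ L, u ≠ []) →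
        evalList g (p.word (x :: y :: u) :: L.map p.word) =
          p.ar x * evalList g (p.word (y :: u) :: L.map p.word) -
            evalList f (p.ar x :: p.word (y :: u) :: L.map p.word)) := by
  set Φ : List (List X) → A := fun L => evalList f (L.map p.word) with hΦ
  obtain ⟨g, hgb, hg⟩ := p.exists_balanced_extension n (p.primitive Φ)
  have hg0 : ∀ L : List (List X), (∀ u ∈ L, u ≠ []) → p.primitive Φ L = 0 →
      evalList g (L.map p.word) = 0 := by
    intro L hL hp
    by_cases hl : L.length = n
    swap
    · exact evalList_of_length_ne g (by simpa using hl)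
    by_cases hw : ∀ u ∈ L, u.IsChain p.rel
    · rw [hg L hl fun u hu => ⟨hL u hu, hw u hu⟩, hp, map_zero]
    · exact map_word_eq_zero (slotwiseLinear_evalList g) hw
  have hmem : ∀ (c : List X) (L : List (List X)), (∀ u ∈ L, u ≠ []) →
      ∀ u ∈ (c.map fun y => [y]) ++ L, u ≠ [] := by
    intro c L hL u hu
    rcases List.mem_append.1 hu with hu | hu
    · obtain ⟨y, -, rfl⟩ := List.mem_map.1 hu
      simp
    · exact hL u hu
  have hflat : ∀ L : List (List X), L ≠ [] → (∀ u ∈ L, u ≠ []) →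
      p.parallelProj L.flatten (Φ L) = Φ L := fun L h h' =>
    balanced_parallel (slotwiseLinear_evalList f) hb h h'
  refine ⟨g, hgb, fun c => ?_, fun c y z u L h hL => ?_, fun x c y u L h hu hw hL => ?_,
    fun x y u L hw hL => ?_⟩
  · rw [← map_word_singletons]
    refine hg0 _ (fun u hu => ?_) (primitive_singletons Φ c)
    obtain ⟨y, -, rfl⟩ := List.mem_map.1 hu
    simp
  · have := hg0 _ (hmem c ([y] :: (z :: u) :: L) (by simpa using hL)) (primitive_of_rel Φ c h u L)
    simpa [word_singleton, Function.comp_def] using this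
  · have hL1 := hmem (x :: c) ((y :: u) :: L) (by simpa using hL)
    have hL2 := hmem (x :: c) ([y] :: u :: L) (by simpa [hu] using hL)
    have e1 : (((x :: c).map fun y => [y]) ++ (y :: u) :: L).map p.word =
        (x :: c).map p.ar ++ p.word (y :: u) :: L.map p.word := by
      rw [List.map_append, map_word_singletons]
      simp only [List.map_cons]
    have e2 : (((x :: c).map fun y => [y]) ++ [y] :: u :: L).map p.word =
        (x :: c).map p.ar ++ p.ar y :: p.word u :: L.map p.word := by
      rw [List.map_append, map_word_singletons]
      simp only [List.map_cons, word_singleton]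
    rw [← e1, ← e2]
    by_cases hl : (((x :: c).map fun y => [y]) ++ (y :: u) :: L).length = n
    swap
    · rw [evalList_of_length_ne g (by simpa using hl), evalList_of_length_ne f (by
        simp at hl ⊢; omega), smul_zero]
    by_cases hLw : ∀ v ∈ L, v.IsChain p.rel
    · rw [hg _ hl fun v hv => ⟨hL1 v hv, ?_⟩, primitive_split (k := k) Φ x c h hu L, map_smul]
      · congr 1
        refine Eq.trans ?_ (hflat _ (by simp) hL2)
        rw [show (((x :: c).map fun y => [y]) ++ (y :: u) :: L).flatten =
          (((x :: c).map fun y => [y]) ++ [y] :: u :: L).flatten by simp]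
      · rcases List.mem_append.1 hv with hv | hv
        · obtain ⟨z, -, rfl⟩ := List.mem_map.1 hv
          exact .singleton z
        · rcases List.mem_cons.1 hv with rfl | hv
          · exact hw.2
          · exact hLw v hv
    · rw [map_word_eq_zero (slotwiseLinear_evalList g) fun h' =>
          hLw fun v hv => h' v (by simp [hv]),
        map_word_eq_zero (slotwiseLinear_evalList f) fun h' =>
          hLw fun v hv => h' v (by simp [hv]),
        smul_zero]
  · have e1 : ((x :: y :: u) :: L).map p.word = p.word (x :: y :: u) :: L.map p.word := rfl
    have e2 : ([x] :: (y :: u) :: L).map p.word =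
        p.ar x :: p.word (y :: u) :: L.map p.word := by
      rw [List.map_cons, List.map_cons, word_singleton]
    have e3 : ((y :: u) :: L).map p.word = p.word (y :: u) :: L.map p.word := rfl
    rw [← e1, ← e2, ← e3]
    by_cases hl : L.length + 1 = n
    swap
    · rw [evalList_of_length_ne g (by simpa using hl), evalList_of_length_ne g (by simpa using hl),
        evalList_of_length_ne f (by simpa using hl), mul_zero, sub_zero]
    by_cases hLw : ∀ v ∈ L, v.IsChain p.rel
    swap
    · rw [map_word_eq_zero (slotwiseLinear_evalList g) fun h' =>
          hLw fun v hv => h' v (by simp [hv]),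
        map_word_eq_zero (slotwiseLinear_evalList g) fun h' =>
          hLw fun v hv => h' v (by simp [hv]),
        map_word_eq_zero (slotwiseLinear_evalList f) fun h' =>
          hLw fun v hv => h' v (by simp [hv]),
        mul_zero, sub_zero]
    have hW : ∀ v ∈ L, p.IsWord v := fun v hv => ⟨hL v hv, hLw v hv⟩
    rw [hg _ (by simpa using hl) (by simpa [hw] using hW),
      hg _ (by simpa using hl) (by simpa [hw.tail] using hW)]
    have h3 := hflat ([x] :: (y :: u) :: L) (by simp) (by simpa using hL)
    have e4 : ([x] :: (y :: u) :: L).flatten = ((x :: y :: u) :: L).flatten := by simp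
    rw [e4] at h3
    simp only [primitive, headPrimitive, map_sub]
    rw [h3]
    congr 1
    have hxy : p.tgt x = p.src y := p.tgt_eq_src x y (List.isChain_cons_cons.1 hw.2).1
    by_cases hc : p.Composable ((y :: u) :: L).flatten
    · have hc' : p.Composable ((x :: y :: u) :: L).flatten :=
        List.isChain_cons_cons.2 ⟨hxy, hc⟩
      have e5 : ((x :: y :: u) :: L).flatten = [x] ++ ((y :: u) :: L).flatten := by simp
      have e6 : p.leftIdem ((y :: u) :: L).flatten = p.e (p.tgt x) := by simp [hxy]
      rw [parallelProj_of_composable hc, parallelProj_of_composable hc', e5,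
        rightIdem_append _ (by simp), e6, ← mul_assoc (p.ar x), p.ar_mul_e,
        List.singleton_append, leftIdem_cons, mul_assoc (p.ar x), ← mul_assoc, p.e_mul_ar]
    · rw [parallelProj_of_not_composable hc, mul_zero, parallelProj_of_not_composable]
      exact fun h => hc (List.isChain_cons_cons.1 h).2

/-- A cocycle that vanishes on the idempotents and on the chains of arrows with vanishing
consecutive products is a coboundary: these chains generate the bimodules in the minimal resolution
of a quadratic monomial algebra. -/
theorem mem_coboundaries_of_chains {n : ℕ} {f : Cochain k A (n + 1)} (hf : d (n + 1) f = 0)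
    (hb : Balanced p.e (evalList f))
    (h0 : ∀ c : List X, c.IsChain p.zrel → evalList f (c.map p.ar) = 0) :
    f ∈ coboundaries k A (n + 1) := by
  obtain ⟨g, hgb, hg1, hg2, hg3, hg4⟩ := exists_primitive hb
  suffices hD0 : f - d n g = 0 from ⟨g, (sub_eq_zero.1 hD0).symm⟩
  set D := evalList (f - d n g) with hD
  have hDl : SlotwiseLinear k D := slotwiseLinear_evalList _
  have hDd : ∀ l, barD D l = 0 :=
    barD_evalList_of_cocycle (by rw [map_sub, hf, d_d, sub_zero])
  have hgl : SlotwiseLinear k (evalList g) := slotwiseLinear_evalList g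
  have hDv : ∀ c v l, D (c ++ p.e v :: l) = 0 := fun c v l => by
    rw [hD, evalList_sub_d, hb.vanishes, hgb.barD_vanishes (hg1 []), sub_zero]
  have hDb : Balanced p.e D := .of_cocycle k hDd fun r c v l _ => hDv c v l
  -- The given cochain and `d n g` agree on chains of arrows followed by a word that extends the
  -- last arrow.
  have hA : ∀ (c : List X) (y z : X) (u : List X) (L : List (List X)),
      (c ++ [y]).IsChain p.zrel → p.rel y z → (∀ u ∈ L, u ≠ []) →
      D (c.map p.ar ++ p.ar y :: p.word (z :: u) :: L.map p.word) = 0 := by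
    intro c y z u L hc hyz hL
    by_cases hzu : (z :: u).IsChain p.rel
    swap
    · rw [word_eq_zero hzu]
      have := hDl.map_zero (c.map p.ar ++ [p.ar y]) (L.map p.word)
      simpa using this
    have hyzu : p.IsWord (y :: z :: u) := ⟨by simp, List.isChain_cons_cons.2 ⟨hyz, hzu⟩⟩
    have hz : barTail (fun m => evalList g (c.map p.ar ++ p.ar y :: m)) (p.word (z :: u))
        (L.map p.word) = 0 := by
      refine barTail_word_eq_zero ?_ (fun u L hL => hg2 c y z u L hyz hL) u hL
      have := hg1 (c ++ [y])
      simpa using this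
    rw [hD, evalList_sub_d, sub_eq_zero]
    cases c with
    | nil =>
      simp only [List.map_nil, List.nil_append] at hz ⊢
      rw [barD_cons, barTail_cons, hz, ← word_cons, hg4 y z u L hyzu hL]
      abel
    | cons x c =>
      rw [List.map_cons, List.cons_append, barD_cons, hg2 c y z u L hyz hL, mul_zero,
        barTail_chain_append (k := k) hgl x c y _ hc, barTail_cons]
      simp only [List.map_cons, List.cons_append] at hz ⊢
      rw [hz, ← word_cons]
      have := hg3 x c y (z :: u) L hc (by simp) hyzu hL
      rw [List.map_cons, List.cons_append] at this
      rw [this, sub_zero, smul_smul, ← pow_add]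
      have e : c.length + 1 + c.length = 2 * c.length + 1 := by omega
      rw [e, pow_succ, pow_mul]
      simp
  have hB : ∀ c : List X, c.IsChain p.zrel → D (c.map p.ar) = 0 := by
    intro c hc
    rw [hD, evalList_sub_d, h0 c hc, zero_sub, neg_eq_zero]
    cases c with
    | nil => rfl
    | cons x c =>
      rw [List.map_cons, barD_cons, hg1, mul_zero, zero_sub, neg_eq_zero]
      rcases List.eq_nil_or_concat c with rfl | ⟨c, y, rfl⟩
      · rw [List.map_nil, barTail_nil, show evalList g [] = 0 from hg1 [], zero_mul]
      · rw [List.map_concat, List.concat_eq_append,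
          barTail_chain_append (k := k) hgl x c y [] (by simpa using hc),
          barTail_nil, List.append_nil, hg1, zero_mul, smul_zero]
  have hAB : ∀ (c : List X) (y z : X) (u : List X) (L : List (List X)),
      (c ++ [y]).IsChain p.zrel → p.rel y z → (∀ u ∈ L, u ≠ []) →
      barTail (fun m => D (c.map p.ar ++ p.ar y :: m)) (p.word (z :: u)) (L.map p.word) = 0 := by
    intro c y z u L hc hyz hL
    refine barTail_word_eq_zero ?_ (fun u L hL => hA c y z u L hc hyz hL) u hL
    have := hB (c ++ [y]) hc
    simpa using this
  -- The remaining values follow from the cocycle condition for the difference.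
  have hC : ∀ (x : X) (c : List X) (y z : X) (u : List X) (L : List (List X)),
      (x :: (c ++ [y])).IsChain p.zrel → p.rel y z → (∀ u ∈ L, u ≠ []) →
      D ((x :: c).map p.ar ++ p.word (y :: z :: u) :: L.map p.word) = 0 := by
    intro x c y z u L hc hyz hL
    have h1 := hDd ((x :: c).map p.ar ++ p.ar y :: p.word (z :: u) :: L.map p.word)
    have h2 := hAB (x :: c) y z u L hc hyz hL
    rw [List.map_cons, List.cons_append, barD_cons, hA c y z u L hc.tail hyz hL, mul_zero,
      zero_sub, neg_eq_zero, barTail_chain_append (k := k) hDl x c y _ hc, barTail_cons] at h1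
    have h3 := (smul_eq_zero.1 h1).resolve_left (pow_ne_zero _ (neg_ne_zero.2 one_ne_zero))
    rw [h2, sub_zero, ← word_cons] at h3
    exact h3
  have hE : ∀ (L : List (List X)), (∀ u ∈ L, p.IsWord u) → ∀ (c : List X) (x : X),
      (c ++ [x]).IsChain p.zrel → D ((c ++ [x]).map p.ar ++ L.map p.word) = 0 := by
    intro L
    induction L with
    | nil =>
      intro _ c x hc
      rw [List.map_nil, List.append_nil]
      exact hB _ hc
    | cons w L ih =>
      intro hL c x hc
      have hL' : ∀ u ∈ L, p.IsWord u := fun u hu => hL u (by simp [hu])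
      have hL'' : ∀ u ∈ L, u ≠ [] := fun u hu => (hL' u hu).1
      have hw := hL w (by simp)
      obtain ⟨y, u, rfl⟩ := List.exists_cons_of_ne_nil hw.1
      by_cases hxy : p.rel x y
      · have := hA c x y u L hc hxy hL''
        simpa using this
      by_cases hxy' : p.tgt x = p.src y
      swap
      · have := balanced_eq_zero hDl hDb (u := [x]) (v := y :: u) (by simp) (by simp)
          (by simpa using hxy') (c.map p.ar) (L.map p.word)
        simpa [word_singleton] using this
      have hc' : (c ++ [x] ++ [y]).IsChain p.zrel := by
        rw [List.append_assoc, List.singleton_append, List.isChain_append_cons_cons]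
        exact ⟨hc, ⟨hxy', hxy⟩, .singleton y⟩
      cases u with
      | nil =>
        have := ih hL' (c ++ [x]) y hc'
        simpa [word_singleton] using this
      | cons z u =>
        have hyz := (List.isChain_cons_cons.1 hw.2).1
        cases c with
        | nil => exact hC x [] y z u L hc' hyz hL''
        | cons x' c => exact hC x' (c ++ [x]) y z u L hc' hyz hL''
  refine eq_zero_of_words hDv fun L hL => ?_
  cases L with
  | nil => exact evalList_of_length_ne _ (by simp)
  | cons w L =>
    have hL' : ∀ u ∈ L, p.IsWord u := fun u hu => hL u (by simp [hu])
    have hw := hL w (by simp)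
    clear hL
    induction w with
    | nil => exact absurd rfl hw.1
    | cons x u ih =>
      cases u with
      | nil =>
        have := hE L hL' [] x (by simp)
        simpa [word_singleton] using this
      | cons y u =>
        have hxy := (List.isChain_cons_cons.1 hw.2).1
        have hL'' : ∀ u ∈ L, u ≠ [] := fun u hu => (hL' u hu).1
        have h1 := hDd (p.ar x :: p.word (y :: u) :: L.map p.word)
        have h2 := hAB [] x y u L (by simp) hxy hL''
        have h3 := ih hw.tail
        rw [List.map_cons] at h3 ⊢
        simp only [List.map_nil, List.nil_append] at h2
        rw [barD_cons, barTail_cons, h2, ← word_cons, sub_zero] at h1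
        rw [← hD] at h3
        rw [h3, mul_zero, zero_sub, neg_eq_zero] at h1
        exact h1

/-! ### Coefficients of words -/

variable (p)

open Classical in
/-- The coefficient of a word in the basis, and zero for all other words. -/
noncomputable def coeff (u : List X) : A →ₗ[k] k :=
  if h : p.IsWord u then p.basis.coord (Sum.inr ⟨u, h⟩) else 0

/-- No nonempty composable word has the same source and target. -/
def NoCycles : Prop :=
  ∀ x u y, p.Composable (x :: u) → (x :: u).getLast? = some y → p.src x ≠ p.tgt y

/-- An arrow has at most one nonzero continuation on either side. -/
structure UniqueContinuation : Prop where
  right : ∀ x y y', p.rel x y → p.rel x y' → y = y'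
  left : ∀ x x' y, p.rel x y → p.rel x' y → x = x'

/-- The two words have the same source and the same target. -/
def Parallel (u v : List X) : Prop :=
  u.head?.map p.src = v.head?.map p.src ∧ u.getLast?.map p.tgt = v.getLast?.map p.tgt

variable {p}

theorem linearMap_ext {M : Type*} [AddCommMonoid M] [Module k M] {φ ψ : A →ₗ[k] M}
    (he : ∀ v, φ (p.e v) = ψ (p.e v)) (hw : ∀ u, p.IsWord u → φ (p.word u) = ψ (p.word u)) :
    φ = ψ := by
  refine p.basis.ext fun i => ?_
  rcases i with v | u
  · rw [p.basis_inl, he]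
  · rw [basis_inr', hw _ u.2]

theorem coeff_e (u : List X) (v : V) : p.coeff u (p.e v) = 0 := by
  rw [coeff]
  split_ifs with h
  · rw [← p.basis_inl]; simp
  · rfl

theorem coeff_word [DecidableEq (List X)] {u v : List X} (hu : p.IsWord u) (hv : v ≠ []) :
    p.coeff u (p.word v) = if u = v then 1 else 0 := by
  rw [coeff, dif_pos hu]
  by_cases h : v.IsChain p.rel
  · rw [← basis_inr' ⟨v, hv, h⟩, Module.Basis.coord_apply, Module.Basis.repr_self]
    by_cases huv : u = v
    · subst huv
      rw [if_pos rfl]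
      exact Finsupp.single_eq_same
    · rw [if_neg huv]
      refine Finsupp.single_eq_of_ne fun h' => huv ?_
      exact congrArg Subtype.val (Sum.inr_injective h')
  · rw [word_eq_zero h, map_zero, if_neg]
    rintro rfl
    exact h hu.2

theorem coeff_ar_mul {x : X} {u : List X} (hu : u ≠ []) (h : p.IsWord (x :: u)) (a : A) :
    p.coeff (x :: u) (p.ar x * a) = p.coeff u a := by
  classical
  have hu' : p.IsWord u := ⟨hu, h.2.tail⟩
  suffices (p.coeff (x :: u)).comp (LinearMap.mulLeft k (p.ar x)) = p.coeff u from
    LinearMap.congr_fun this a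
  refine p.linearMap_ext (fun v => ?_) fun w hw => ?_
  · rw [LinearMap.comp_apply, LinearMap.mulLeft_apply, coeff_e]
    by_cases hv : p.tgt x = v
    · rw [← hv, p.ar_mul_e, ← word_singleton, coeff_word h (by simp), if_neg (by simpa using hu)]
    · rw [← p.ar_mul_e, mul_assoc, p.idem.ortho hv, mul_zero, map_zero]
  · rw [LinearMap.comp_apply, LinearMap.mulLeft_apply, ← word_cons, coeff_word h (by simp),
      coeff_word hu' hw.1]
    simp

theorem coeff_ar_mul_of_ne {x y : X} (hxy : y ≠ x) (u : List X) (a : A) :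
    p.coeff (y :: u) (p.ar x * a) = 0 := by
  classical
  by_cases h : p.IsWord (y :: u)
  swap
  · rw [coeff, dif_neg h, LinearMap.zero_apply]
  suffices (p.coeff (y :: u)).comp (LinearMap.mulLeft k (p.ar x)) = 0 from
    LinearMap.congr_fun this a
  refine p.linearMap_ext (fun v => ?_) fun w hw => ?_
  · rw [LinearMap.comp_apply, LinearMap.mulLeft_apply, LinearMap.zero_apply]
    by_cases hv : p.tgt x = v
    · rw [← hv, p.ar_mul_e, ← word_singleton, coeff_word h (by simp), if_neg (by simp [hxy])]
    · rw [← p.ar_mul_e, mul_assoc, p.idem.ortho hv, mul_zero, map_zero]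
  · rw [LinearMap.comp_apply, LinearMap.mulLeft_apply, ← word_cons, coeff_word h (by simp),
      if_neg (by simp [hxy]), LinearMap.zero_apply]

theorem coeff_mul_ar {x : X} {u : List X} (hu : u ≠ []) (h : p.IsWord (u ++ [x])) (a : A) :
    p.coeff (u ++ [x]) (a * p.ar x) = p.coeff u a := by
  classical
  have hu' : p.IsWord u := ⟨hu, h.2.left_of_append⟩
  suffices (p.coeff (u ++ [x])).comp (LinearMap.mulRight k (p.ar x)) = p.coeff u from
    LinearMap.congr_fun this a
  refine p.linearMap_ext (fun v => ?_) fun w hw => ?_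
  · rw [LinearMap.comp_apply, LinearMap.mulRight_apply, coeff_e]
    by_cases hv : v = p.src x
    · rw [hv, p.e_mul_ar, ← word_singleton, coeff_word h (by simp), if_neg (by simpa using hu)]
    · rw [← p.e_mul_ar, ← mul_assoc, p.idem.ortho hv, zero_mul, map_zero]
  · rw [LinearMap.comp_apply, LinearMap.mulRight_apply, ← word_singleton, ← word_append,
      coeff_word h (by simp), coeff_word hu' hw.1]
    simp

theorem coeff_mul_ar_of_ne {x y : X} (hxy : y ≠ x) (u : List X) (a : A) :
    p.coeff (u ++ [y]) (a * p.ar x) = 0 := by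
  classical
  by_cases h : p.IsWord (u ++ [y])
  swap
  · rw [coeff, dif_neg h, LinearMap.zero_apply]
  suffices (p.coeff (u ++ [y])).comp (LinearMap.mulRight k (p.ar x)) = 0 from
    LinearMap.congr_fun this a
  refine p.linearMap_ext (fun v => ?_) fun w hw => ?_
  · rw [LinearMap.comp_apply, LinearMap.mulRight_apply, LinearMap.zero_apply]
    by_cases hv : v = p.src x
    · rw [hv, p.e_mul_ar, ← word_singleton, coeff_word h (by simp), if_neg]
      intro h'
      rw [List.append_eq_singleton_iff] at h'
      simp [hxy] at h'
    · rw [← p.e_mul_ar, ← mul_assoc, p.idem.ortho hv, zero_mul, map_zero]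
  · rw [LinearMap.comp_apply, LinearMap.mulRight_apply, ← word_singleton, ← word_append,
      coeff_word h (by simp), if_neg, LinearMap.zero_apply]
    intro h'
    exact hxy (by simpa using (List.append_inj' h' rfl).2)

theorem parallelProj_word {u v : List X} (hv : p.Composable v) (hv0 : v ≠ []) (hu : u ≠ [])
    (h : p.Parallel u v) : p.parallelProj v (p.word u) = p.word u := by
  have h1 : p.src (v.head hv0) = p.src (u.head hu) := by
    have := h.1
    rw [List.head?_eq_some_head hu, List.head?_eq_some_head hv0] at this
    simpa using this.symm
  have h2 : p.tgt (v.getLast hv0) = p.tgt (u.getLast hu) := by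
    have := h.2
    rw [List.getLast?_eq_some_getLast hu, List.getLast?_eq_some_getLast hv0] at this
    simpa using this.symm
  rw [parallelProj_of_composable hv, leftIdem_eq hv0, rightIdem_eq hv0, h1, h2, ← leftIdem_eq hu,
    ← rightIdem_eq hu, word_mul_rightIdem hu, leftIdem_mul_word hu]

theorem parallelProj_word_of_not_parallel {u v : List X} (hv0 : v ≠ []) (hu : u ≠ [])
    (h : ¬ p.Parallel u v) : p.parallelProj v (p.word u) = 0 := by
  by_cases hv : p.Composable v
  swap
  · exact parallelProj_of_not_composable hv _
  rw [parallelProj_of_composable hv, leftIdem_eq hv0, rightIdem_eq hv0]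
  by_cases h1 : p.src (v.head hv0) = p.src (u.head hu)
  · have h2 : p.tgt (u.getLast hu) ≠ p.tgt (v.getLast hv0) := by
      intro h2
      refine h ⟨?_, ?_⟩
      · rw [List.head?_eq_some_head hu, List.head?_eq_some_head hv0, Option.map_some,
          Option.map_some, h1]
      · rw [List.getLast?_eq_some_getLast hu, List.getLast?_eq_some_getLast hv0, Option.map_some,
          Option.map_some, h2]
    rw [← word_mul_rightIdem hu, rightIdem_eq hu, mul_assoc, p.idem.ortho h2, mul_zero, mul_zero]
  · rw [← leftIdem_mul_word hu, leftIdem_eq hu, ← mul_assoc, ← mul_assoc, p.idem.ortho h1,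
      zero_mul, zero_mul]

/-- Without oriented cycles, a composable word is not parallel to a trivial path. -/
theorem parallelProj_e (hac : p.NoCycles) {v : List X} (hv0 : v ≠ []) (w : V) :
    p.parallelProj v (p.e w) = 0 := by
  by_cases hv : p.Composable v
  swap
  · exact parallelProj_of_not_composable hv _
  obtain ⟨x, u, rfl⟩ := List.exists_cons_of_ne_nil hv0
  have h := hac x u _ hv (List.getLast?_eq_some_getLast hv0)
  rw [parallelProj_of_composable hv, leftIdem_cons, rightIdem_eq hv0]
  by_cases hw : p.src x = w
  · rw [← hw, p.idem.ortho h, mul_zero]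
  · rw [← mul_assoc, p.idem.ortho hw, zero_mul]

theorem coeff_parallelProj {u v : List X} (hv : p.Composable v) (hv0 : v ≠ [])
    (hac : p.NoCycles)
    (h : p.Parallel u v) (a : A) : p.coeff u (p.parallelProj v a) = p.coeff u a := by
  classical
  by_cases hu : p.IsWord u
  swap
  · rw [coeff, dif_neg hu, LinearMap.zero_apply, LinearMap.zero_apply]
  suffices (p.coeff u).comp (p.parallelProj v) = p.coeff u from LinearMap.congr_fun this a
  refine p.linearMap_ext (fun w => ?_) fun w hw => ?_
  · rw [LinearMap.comp_apply, parallelProj_e hac hv0, coeff_e, map_zero]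
  · rw [LinearMap.comp_apply]
    by_cases hwv : p.Parallel w v
    · rw [parallelProj_word hv hv0 hw.1 hwv]
    · rw [parallelProj_word_of_not_parallel hv0 hw.1 hwv, map_zero, coeff_word hu hw.1, if_neg]
      rintro rfl
      exact hwv h

theorem coeff_parallelProj_of_not_parallel {u v : List X} (hv0 : v ≠ [])
    (hac : p.NoCycles)
    (h : ¬ p.Parallel u v) (a : A) : p.coeff u (p.parallelProj v a) = 0 := by
  classical
  by_cases hu : p.IsWord u
  swap
  · rw [coeff, dif_neg hu, LinearMap.zero_apply]
  suffices (p.coeff u).comp (p.parallelProj v) = 0 from LinearMap.congr_fun this a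
  refine p.linearMap_ext (fun w => ?_) fun w hw => ?_
  · rw [LinearMap.comp_apply, parallelProj_e hac hv0, map_zero, LinearMap.zero_apply]
  · rw [LinearMap.comp_apply, LinearMap.zero_apply]
    by_cases hwv : p.Parallel w v
    · by_cases hv : p.Composable v
      · rw [parallelProj_word hv hv0 hw.1 hwv, coeff_word hu hw.1, if_neg]
        rintro rfl
        exact h hwv
      · rw [parallelProj_of_not_composable hv, map_zero]
    · rw [parallelProj_word_of_not_parallel hv0 hw.1 hwv, map_zero]

theorem coeff_of_isWord (u : {u : List X // u ≠ [] ∧ u.IsChain p.rel}) (a : A) :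
    p.coeff u.1 a = p.basis.repr a (Sum.inr u) := by
  have h : p.IsWord u.1 := u.2
  rw [coeff, dif_pos h]
  rfl

theorem repr_inl_eq_zero {v : List X} (hv0 : v ≠ [])
    (hac : p.NoCycles)
    {a : A} (ha : p.parallelProj v a = a) (w : V) : p.basis.repr a (Sum.inl w) = 0 := by
  have : (p.basis.coord (Sum.inl w)).comp (p.parallelProj v) = 0 := by
    refine p.linearMap_ext (fun w => ?_) fun u hu => ?_
    · rw [LinearMap.comp_apply, parallelProj_e hac hv0, map_zero, LinearMap.zero_apply]
    · rw [LinearMap.comp_apply, LinearMap.zero_apply]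
      by_cases hv : p.Composable v
      swap
      · rw [parallelProj_of_not_composable hv, map_zero]
      by_cases hwv : p.Parallel u v
      · rw [parallelProj_word hv hv0 hu.1 hwv, ← basis_inr' ⟨u, hu⟩]
        simp
      · rw [parallelProj_word_of_not_parallel hv0 hu.1 hwv, map_zero]
  have h' := LinearMap.congr_fun this a
  rwa [LinearMap.comp_apply, ha] at h'

/-- An element parallel to a nonempty word is determined by its coefficients at the words. -/
theorem eq_zero_of_coeff {v : List X} (hv0 : v ≠ [])
    (hac : p.NoCycles)
    {a : A} (ha : p.parallelProj v a = a) (h : ∀ u, p.IsWord u → p.coeff u a = 0) : a = 0 := by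
  refine p.basis.ext_elem fun i => ?_
  rw [map_zero, Finsupp.zero_apply]
  rcases i with w | u
  · exact repr_inl_eq_zero hv0 hac ha w
  · rw [← coeff_of_isWord, h u.1 u.2]

theorem mem_span_words {v : List X} (hv0 : v ≠ [])
    (hac : p.NoCycles)
    {a : A} (ha : p.parallelProj v a = a) :
    a ∈ Submodule.span k {b | ∃ u, p.IsWord u ∧ p.coeff u a ≠ 0 ∧ b = p.word u} := by
  refine Submodule.span_mono ?_ (p.basis.mem_span_repr_support a)
  rintro _ ⟨i, hi, rfl⟩
  have hi' : p.basis.repr a i ≠ 0 := Finsupp.mem_support_iff.1 hi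
  rcases i with w | u
  · exact absurd (repr_inl_eq_zero hv0 hac ha w) hi'
  · exact ⟨u.1, u.2, by rwa [coeff_of_isWord], basis_inr' u⟩

/-- If the coefficient of a word in a product is nonzero, then the word is a concatenation of words
that occur in the factors. -/
theorem exists_of_coeff_mul_ne_zero
    (hac : p.NoCycles)
    {v w : List X} (hv0 : v ≠ []) (hw0 : w ≠ []) {a b : A} (ha : p.parallelProj v a = a)
    (hb : p.parallelProj w b = b) {P : List X} (hP : p.IsWord P) (h : p.coeff P (a * b) ≠ 0) :
    ∃ u u', p.IsWord u ∧ p.IsWord u' ∧ p.coeff u a ≠ 0 ∧ p.coeff u' b ≠ 0 ∧ P = u ++ u' := by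
  classical
  by_contra! H
  have h1 : ∀ u, p.IsWord u → p.coeff u a ≠ 0 → p.coeff P (p.word u * b) = 0 := by
    intro u hu hua
    have : Submodule.span k {c | ∃ u, p.IsWord u ∧ p.coeff u b ≠ 0 ∧ c = p.word u} ≤
        LinearMap.ker ((p.coeff P).comp (LinearMap.mulLeft k (p.word u))) := by
      rw [Submodule.span_le]
      rintro _ ⟨u', hu', hub, rfl⟩
      rw [SetLike.mem_coe, LinearMap.mem_ker, LinearMap.comp_apply, LinearMap.mulLeft_apply,
        ← word_append, coeff_word hP (by simp [hu.1]), if_neg (H u u' hu hu' hua hub)]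
    exact this (mem_span_words hw0 hac hb)
  have : Submodule.span k {c | ∃ u, p.IsWord u ∧ p.coeff u a ≠ 0 ∧ c = p.word u} ≤
      LinearMap.ker ((p.coeff P).comp (LinearMap.mulRight k b)) := by
    rw [Submodule.span_le]
    rintro _ ⟨u, hu, hua, rfl⟩
    exact h1 u hu hua
  exact h (this (mem_span_words hv0 hac ha))

theorem barD_chain {F : List A → A} (hF : SlotwiseLinear k F) {x z : X} {c : List X}
    (h : (x :: (c ++ [z])).IsChain p.zrel) :
    barD F ((x :: (c ++ [z])).map p.ar) = p.ar x * F ((c ++ [z]).map p.ar) -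
      (-1 : k) ^ (c.length + 1) • (F ((x :: c).map p.ar) * p.ar z) := by
  have h1 : (x :: (c ++ [z])).map p.ar = p.ar x :: (c.map p.ar ++ p.ar z :: []) := by simp
  rw [h1, barD_cons, barTail_chain_append (k := k) hF x c z [] h, barTail_nil, List.append_nil,
    List.map_append, List.map_singleton]

/-! ### Cocycles supported on words that share an end with the chain -/

theorem composable_of_zrel {c : List X} (h : c.IsChain p.zrel) : p.Composable c :=
  h.imp fun _ _ h => h.1

theorem balanced_chain {F : List A → A} (hF : SlotwiseLinear k F) (hb : Balanced p.e F)
    {c : List X} (hc : c ≠ []) : p.parallelProj c (F (c.map p.ar)) = F (c.map p.ar) := by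
  have := balanced_parallel hF hb (L := c.map fun x => [x]) (by simpa using hc) fun u hu => by
    obtain ⟨y, -, rfl⟩ := List.mem_map.1 hu
    simp
  rwa [map_word_singletons, flatten_singletons] at this

theorem parallel_of_coeff_ne_zero (hac : p.NoCycles) {v u : List X} (hv0 : v ≠ []) {a : A}
    (ha : p.parallelProj v a = a) (h : p.coeff u a ≠ 0) : p.Parallel u v := by
  by_contra hn
  rw [← ha] at h
  exact h (coeff_parallelProj_of_not_parallel hv0 hac hn a)

theorem Parallel.of_cons {x : X} {u v : List X} (hu : p.Composable (x :: u))
    (hv : p.Composable (x :: v)) (hu0 : u ≠ []) (hv0 : v ≠ [])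
    (h : p.Parallel (x :: u) (x :: v)) : p.Parallel u v := by
  obtain ⟨y, u, rfl⟩ := List.exists_cons_of_ne_nil hu0
  obtain ⟨z, v, rfl⟩ := List.exists_cons_of_ne_nil hv0
  refine ⟨?_, by simpa using h.2⟩
  simp [← (List.isChain_cons_cons.1 hu).1, ← (List.isChain_cons_cons.1 hv).1]

theorem Parallel.of_append {z : X} {u v : List X} (hu : p.Composable (u ++ [z]))
    (hv : p.Composable (v ++ [z])) (hu0 : u ≠ []) (hv0 : v ≠ [])
    (h : p.Parallel (u ++ [z]) (v ++ [z])) : p.Parallel u v := by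
  refine ⟨?_, ?_⟩
  · have := h.1
    rwa [List.head?_append_of_ne_nil _ hu0, List.head?_append_of_ne_nil _ hv0] at this
  · have h1 := (List.isChain_append.1 hu).2.2 _ (List.getLast?_eq_some_getLast hu0) z (by simp)
    have h2 := (List.isChain_append.1 hv).2.2 _ (List.getLast?_eq_some_getLast hv0) z (by simp)
    rw [List.getLast?_eq_some_getLast hu0, List.getLast?_eq_some_getLast hv0, Option.map_some,
      Option.map_some, h1, h2]

theorem UniqueContinuation.cons_inj (hu : p.UniqueContinuation) {x x' : X} {u : List X}
    (hu0 : u ≠ []) (h : (x :: u).IsChain p.rel) (h' : (x' :: u).IsChain p.rel) : x = x' := by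
  obtain ⟨y, u, rfl⟩ := List.exists_cons_of_ne_nil hu0
  exact hu.left x x' y (List.isChain_cons_cons.1 h).1 (List.isChain_cons_cons.1 h').1

theorem UniqueContinuation.append_inj (hu : p.UniqueContinuation) {x x' : X} {u : List X}
    (hu0 : u ≠ []) (h : (u ++ [x]).IsChain p.rel) (h' : (u ++ [x']).IsChain p.rel) : x = x' :=
  hu.right _ x x'
    ((List.isChain_append.1 h).2.2 _ (List.getLast?_eq_some_getLast hu0) x (by simp))
    ((List.isChain_append.1 h').2.2 _ (List.getLast?_eq_some_getLast hu0) x' (by simp))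

variable (p)

open Classical in
/-- The coefficient of the word `u` in the value at the chain `c` of the primitive of `F`: it is
read off from `F` at a chain `x :: c`, if `x` prolongs both `c` and `u`, and otherwise at a chain
`c ++ [y]`, if `y` prolongs both. The second rule is suspended when `c` and `u` have the same first
arrow, because `F` at `c ++ [y]` is then already accounted for by the first rule. -/
noncomputable def chainPrimitiveCoeff (F : List A → A) (c u : List X) : k :=
  if h : ∃ x, (x :: c).IsChain p.zrel ∧ (x :: u).IsChain p.rel then
    p.coeff (h.choose :: u) (F ((h.choose :: c).map p.ar))
  else if c.head? = u.head? then 0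
  else if h : ∃ y, (c ++ [y]).IsChain p.zrel ∧ (u ++ [y]).IsChain p.rel then
    (-1) ^ (c.length + 1) * p.coeff (u ++ [h.choose]) (F ((c ++ [h.choose]).map p.ar))
  else 0

variable {p}

theorem chainPrimitiveCoeff_cons (hu : p.UniqueContinuation) (F : List A → A) {x : X}
    {c u : List X} (hu0 : u ≠ []) (hc : (x :: c).IsChain p.zrel) (h : (x :: u).IsChain p.rel) :
    p.chainPrimitiveCoeff F c u = p.coeff (x :: u) (F ((x :: c).map p.ar)) := by
  have hex : ∃ x, (x :: c).IsChain p.zrel ∧ (x :: u).IsChain p.rel := ⟨x, hc, h⟩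
  rw [chainPrimitiveCoeff, dif_pos hex, hu.cons_inj hu0 hex.choose_spec.2 h]

theorem chainPrimitiveCoeff_of_head_eq (F : List A → A) {x : X} {c u : List X} :
    p.chainPrimitiveCoeff F (x :: c) (x :: u) = 0 := by
  rw [chainPrimitiveCoeff, dif_neg, if_pos (by simp)]
  rintro ⟨y, h, h'⟩
  exact (List.isChain_cons_cons.1 h).1.2 (List.isChain_cons_cons.1 h').1

theorem chainPrimitiveCoeff_append (hu : p.UniqueContinuation) (F : List A → A) {z : X}
    {c u : List X} (hu0 : u ≠ []) (hc : (c ++ [z]).IsChain p.zrel) (h : (u ++ [z]).IsChain p.rel)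
    (hn : ¬ ∃ x, (x :: c).IsChain p.zrel ∧ (x :: u).IsChain p.rel) (hne : c.head? ≠ u.head?) :
    p.chainPrimitiveCoeff F c u =
      (-1) ^ (c.length + 1) * p.coeff (u ++ [z]) (F ((c ++ [z]).map p.ar)) := by
  have hex : ∃ y, (c ++ [y]).IsChain p.zrel ∧ (u ++ [y]).IsChain p.rel := ⟨z, hc, h⟩
  rw [chainPrimitiveCoeff, dif_neg hn, if_neg hne, dif_pos hex,
    hu.append_inj hu0 hex.choose_spec.2 h]

/-- A cocycle is a coboundary if all words that occur in its values at chains of arrows with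
vanishing consecutive products share with the chain the first or the last arrow. Removing the shared
first arrow, or else the shared last arrow, gives a primitive. -/
theorem mem_coboundaries_of_shared_end [Finite (V ⊕ {u : List X // u ≠ [] ∧ u.IsChain p.rel})]
    (hac : p.NoCycles) (hu : p.UniqueContinuation) {n : ℕ} (hn : 0 < n)
    {f : Cochain k A (n + 1)} (hf : d (n + 1) f = 0) (hb : Balanced p.e (evalList f))
    (hs : ∀ c : List X, c.length = n + 1 → c.IsChain p.zrel → ∀ u, p.IsWord u →
      p.coeff u (evalList f (c.map p.ar)) ≠ 0 →
      u.head? = c.head? ∨ u.getLast? = c.getLast?) :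
    f ∈ coboundaries k A (n + 1) := by
  classical
  have _ := Fintype.ofFinite (V ⊕ {u : List X // u ≠ [] ∧ u.IsChain p.rel})
  set F := evalList f with hF
  obtain ⟨g, hgb, hg⟩ := p.exists_balanced_extension n fun L =>
    p.basis.equivFun.symm fun i => p.chainPrimitiveCoeff F L.flatten (p.wordOf i)
  set G := evalList g with hG
  have hGl : SlotwiseLinear k G := slotwiseLinear_evalList g
  have hG0 : G [] = 0 := evalList_of_length_ne g (by simpa using hn.ne)
  have hgc : ∀ c : List X, c.length = n → c.IsChain p.zrel → ∀ u, p.IsWord u → p.Parallel u c →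
      p.coeff u (G (c.map p.ar)) = p.chainPrimitiveCoeff F c u := by
    intro c hc hcz u hw hpar
    have hc0 : c ≠ [] := by rintro rfl; simp at hc; omega
    have h1 := hg (c.map fun x => [x]) (by simpa using hc) fun u hu => by
      obtain ⟨y, -, rfl⟩ := List.mem_map.1 hu
      exact isWord_singleton y
    rw [map_word_singletons, flatten_singletons] at h1
    rw [h1, coeff_parallelProj (composable_of_zrel hcz) hc0 hac hpar,
      coeff_of_isWord ⟨u, hw⟩, ← Module.Basis.equivFun_apply, LinearEquiv.apply_symm_apply]
    rfl
  suffices h : f - d n g ∈ coboundaries k A (n + 1) by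
    have h' : d n g ∈ coboundaries k A (n + 1) := ⟨g, rfl⟩
    simpa using add_mem h h'
  have hd : d (n + 1) (f - d n g) = 0 := by rw [map_sub, hf, d_d, sub_zero]
  have hDb : Balanced p.e (evalList (f - d n g)) :=
    .of_cocycle k (barD_evalList_of_cocycle hd) fun r c v l _ => by
      rw [evalList_sub_d, ← hF, hb.vanishes, hgb.barD_vanishes hG0, sub_zero]
  refine mem_coboundaries_of_chains hd hDb fun c hc => ?_
  by_cases hl : c.length = n + 1
  swap
  · exact evalList_of_length_ne _ (by simpa using hl)
  obtain ⟨x, c, rfl⟩ := List.exists_cons_of_ne_nil (show c ≠ [] by rintro rfl; simp at hl)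
  rcases List.eq_nil_or_concat c with rfl | ⟨c, z, rfl⟩
  · exact absurd hl (by simp; omega)
  rw [List.concat_eq_append] at hc hl ⊢
  have hcn : c.length + 1 = n := by simpa using hl
  have hcomp := composable_of_zrel hc
  have hpar := balanced_chain (slotwiseLinear_evalList (f - d n g)) hDb
    (c := x :: (c ++ [z])) (by simp)
  refine eq_zero_of_coeff (by simp) hac hpar fun P hP => ?_
  by_cases hPpar : p.Parallel P (x :: (c ++ [z]))
  swap
  · rw [← hpar]
    exact coeff_parallelProj_of_not_parallel (by simp) hac hPpar _
  have hxz : p.tgt x ≠ p.tgt z := by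
    cases c with
    | nil =>
      have h1 := (List.isChain_cons_cons.1 hcomp).1
      rw [h1]
      exact hac z [] z (.singleton z) rfl
    | cons w c =>
      have h1 := (List.isChain_cons_cons.1 hcomp)
      rw [h1.1]
      exact hac w (c ++ [z]) z h1.2 (by rw [← List.cons_append, List.getLast?_concat])
  have hxy : p.src x ≠ p.src z := by
    intro h
    have hcomp' : ((x :: c) ++ [z]).IsChain fun x y => p.tgt x = p.src y := hcomp
    have hc' : p.Composable (x :: c) := hcomp'.left_of_append
    refine hac x c _ hc' (List.getLast?_eq_some_getLast (by simp)) (h.trans ?_)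
    exact ((List.isChain_append.1 hcomp').2.2 _
      (List.getLast?_eq_some_getLast (by simp)) z (by simp)).symm
  rw [evalList_sub_d, ← hF, ← hG, map_sub, barD_chain (k := k) hGl hc, map_sub, map_smul]
  obtain ⟨y, P, rfl⟩ := List.exists_cons_of_ne_nil hP.1
  by_cases hyx : y = x
  · -- The first arrow is shared: it is the left multiplication by it that contributes.
    subst hyx
    have hP0 : P ≠ [] := by
      rintro rfl
      have := hPpar.2
      rw [← List.cons_append, List.getLast?_concat] at this
      exact hxz (by simpa using this)
    have hP' : p.IsWord P := ⟨hP0, hP.2.tail⟩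
    have h1 : p.coeff (y :: P) (p.ar y * G ((c ++ [z]).map p.ar)) =
        p.coeff (y :: P) (F ((y :: (c ++ [z])).map p.ar)) := by
      rw [coeff_ar_mul hP0 hP, hgc (c ++ [z]) (by simpa using hcn) hc.tail P hP'
        (hPpar.of_cons hP.composable hcomp hP0 (by simp)),
        chainPrimitiveCoeff_cons hu F hP0 hc hP.2]
    have h2 : p.coeff (y :: P) (G ((y :: c).map p.ar) * p.ar z) = 0 := by
      rcases List.eq_nil_or_concat P with rfl | ⟨P, w, rfl⟩
      · exact absurd rfl hP0
      rw [List.concat_eq_append] at hP hPpar ⊢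
      rw [← List.cons_append] at hP hPpar ⊢
      by_cases hwz : w = z
      · subst hwz
        have hPy : p.IsWord (y :: P) := ⟨by simp, hP.2.left_of_append⟩
        rw [coeff_mul_ar (by simp) hP, hgc (y :: c) (by simpa using hcn)
          (List.IsChain.left_of_append (l₂ := [w]) hc) _ hPy
          (Parallel.of_append hP.composable (v := y :: c) hcomp (by simp) (by simp) hPpar),
          chainPrimitiveCoeff_of_head_eq]
      · exact coeff_mul_ar_of_ne hwz _ _
    rw [h1, h2, smul_zero, sub_zero, sub_self]
  · rw [coeff_ar_mul_of_ne hyx, zero_sub, sub_neg_eq_add]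
    obtain ⟨P', w, hP'⟩ : ∃ P' w, y :: P = P' ++ [w] :=
      ⟨_, _, (List.dropLast_append_getLast (List.cons_ne_nil y P)).symm⟩
    rw [hP'] at hP hPpar ⊢
    by_cases hwz : w = z
    swap
    · -- No arrow is shared.
      rw [coeff_mul_ar_of_ne hwz, smul_zero, add_zero]
      by_contra hne
      rcases hs _ hl hc _ hP hne with h | h
      · rw [← hP'] at h
        simp [hyx] at h
      · rw [List.getLast?_concat, ← List.cons_append, List.getLast?_concat] at h
        exact hwz (by simpa using h)
    -- Only the last arrow is shared.
    subst hwz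
    have hP0 : P' ≠ [] := by
      rintro rfl
      have := hPpar.1
      simp at this
      exact hxy this.symm
    have hPw : p.IsWord P' := ⟨hP0, hP.2.left_of_append⟩
    have hcz : (x :: c).IsChain p.zrel := List.IsChain.left_of_append (l₂ := [w]) hc
    have hhead : P'.head? = some y := by
      have := congrArg List.head? hP'
      rw [List.head?_append_of_ne_nil _ hP0] at this
      exact this.symm
    rw [coeff_mul_ar hP0 hP, hgc (x :: c) (by simpa using hcn) hcz _ hPw
      (Parallel.of_append hP.composable (v := x :: c) hcomp hP0 (by simp) hPpar)]
    by_cases hex : ∃ x', (x' :: x :: c).IsChain p.zrel ∧ (x' :: P').IsChain p.rel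
    · obtain ⟨x', h1, h2⟩ := hex
      have h3 : (x' :: (x :: c ++ [w])).IsChain p.zrel :=
        List.isChain_cons_cons.2 ⟨(List.isChain_cons_cons.1 h1).1, hc⟩
      have h4 : p.IsWord ((x' :: P') ++ [w]) := by
        obtain ⟨a, Q, rfl⟩ := List.exists_cons_of_ne_nil hP0
        exact ⟨by simp, List.isChain_cons_cons.2 ⟨(List.isChain_cons_cons.1 h2).1, hP.2⟩⟩
      have h5 := barD_evalList_of_cocycle hf ((x' :: (x :: c ++ [w])).map p.ar)
      rw [barD_chain (k := k) (slotwiseLinear_evalList f) h3, ← hF] at h5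
      have h6 := congrArg (p.coeff ((x' :: P') ++ [w])) h5
      rw [map_sub, map_smul, map_zero, coeff_mul_ar (by simp) h4, List.cons_append,
        coeff_ar_mul (u := P' ++ [w]) (by simp) h4] at h6
      rw [chainPrimitiveCoeff_cons hu F hP0 h1 h2]
      simp only [List.length_cons, pow_succ, mul_neg, mul_one, neg_neg, neg_smul] at h6 ⊢
      simpa [sub_eq_add_neg] using h6
    · rw [chainPrimitiveCoeff_append hu F hP0 hc hP.2 hex (by
        rw [hhead]; simpa using Ne.symm hyx), smul_eq_mul, ← mul_assoc, ← pow_add]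
      have e : c.length + 1 + ((x :: c).length + 1) = 2 * (c.length + 1) + 1 := by
        simp; omega
      rw [e, pow_succ, pow_mul]
      simp

/-- The words occurring in the product of the values of two cocycles at the two parts of a chain of
arrows with vanishing consecutive products share with the chain its first or its last arrow. Indeed,
for such a product of words to be nonzero, one of the factors must leave its part of the chain where
the two parts meet. By the uniqueness of nonzero continuations this part can then be prolonged at
this end by the adjacent arrow of the other factor, and the cocycle condition at the prolonged chain
forces the factor that leaves to share the outer arrow of its part. -/
theorem shared_end_of_coeff_mul_ne_zero (hac : p.NoCycles) (hu : p.UniqueContinuation)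
    {n m : ℕ} {f : Cochain k A n} {g : Cochain k A m}
    (hf : d n f = 0) (hg : d m g = 0) (hfb : Balanced p.e (evalList f))
    (hgb : Balanced p.e (evalList g)) {c c' : List X} (hc0 : c ≠ []) (hc0' : c' ≠ [])
    (hc : (c ++ c').IsChain p.zrel) {u : List X} (hw : p.IsWord u)
    (h : p.coeff u (evalList f (c.map p.ar) * evalList g (c'.map p.ar)) ≠ 0) :
    u.head? = (c ++ c').head? ∨ u.getLast? = (c ++ c').getLast? := by
  have hfl := slotwiseLinear_evalList f
  have hgl := slotwiseLinear_evalList g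
  have hfp := balanced_chain hfl hfb hc0
  have hgp := balanced_chain hgl hgb hc0'
  obtain ⟨v, w, hv, hw', hva, hwb, rfl⟩ :=
    exists_of_coeff_mul_ne_zero hac hc0 hc0' hfp hgp hw h
  have hvpar := parallel_of_coeff_ne_zero hac hc0 hfp hva
  have hwpar := parallel_of_coeff_ne_zero hac hc0' hgp hwb
  rw [List.head?_append_of_ne_nil _ hv.1, List.head?_append_of_ne_nil _ hc0,
    List.getLast?_append_of_ne_nil _ hw'.1, List.getLast?_append_of_ne_nil _ hc0']
  obtain ⟨v₀, x, rfl⟩ : ∃ v₀ x, v = v₀ ++ [x] :=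
    ⟨_, _, (List.dropLast_append_getLast hv.1).symm⟩
  obtain ⟨y, w₀, rfl⟩ := List.exists_cons_of_ne_nil hw'.1
  obtain ⟨c₀, a, rfl⟩ : ∃ c₀ a, c = c₀ ++ [a] :=
    ⟨_, _, (List.dropLast_append_getLast hc0).symm⟩
  obtain ⟨b, c₁, rfl⟩ := List.exists_cons_of_ne_nil hc0'
  have hxy : p.rel x y := by
    have := hw.2
    rw [List.append_assoc, List.singleton_append, List.isChain_append_cons_cons] at this
    exact this.2.1
  have hab : p.zrel a b ∧ (c₀ ++ [a]).IsChain p.zrel ∧ (b :: c₁).IsChain p.zrel := by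
    rw [List.append_assoc, List.singleton_append, List.isChain_append_cons_cons] at hc
    exact ⟨hc.2.1, hc.1, hc.2.2⟩
  have hxa : p.tgt x = p.tgt a := by simpa using hvpar.2
  have hyb : p.src y = p.src b := by simpa using hwpar.1
  have hcomp : p.tgt x = p.src y := p.tgt_eq_src x y hxy
  by_cases hne : y = b
  · -- The first factor leaves the chain, so the first part is prolonged by `y`.
    subst hne
    have hxa' : x ≠ a := by rintro rfl; exact hab.1.2 hxy
    have hz : p.zrel a y := ⟨hxa ▸ hcomp, fun h => hxa' (hu.left x a y hxy h)⟩
    obtain ⟨t, c₂, ht⟩ := List.exists_cons_of_ne_nil hc0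
    have h1 : (t :: (c₂ ++ [y])).IsChain p.zrel := by
      rw [← List.cons_append, ← ht, List.append_assoc, List.singleton_append,
        List.isChain_append_cons_cons]
      exact ⟨hab.2.1, hz, .singleton y⟩
    have h2 := barD_evalList_of_cocycle hf ((t :: (c₂ ++ [y])).map p.ar)
    rw [barD_chain (k := k) hfl h1, sub_eq_zero, ← ht] at h2
    have h3 := congrArg (p.coeff (v₀ ++ [x] ++ [y])) h2
    have hvy : p.IsWord (v₀ ++ [x] ++ [y]) := by
      refine ⟨by simp, ?_⟩
      rw [List.append_assoc, List.singleton_append, List.isChain_append_cons_cons]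
      exact ⟨hv.2, hxy, .singleton y⟩
    rw [map_smul, coeff_mul_ar (by simp) hvy] at h3
    left
    by_contra hhead
    obtain ⟨s, v₁, hs⟩ := List.exists_cons_of_ne_nil hv.1
    rw [ht, hs] at hhead
    have hst : s ≠ t := by simpa using hhead
    rw [hs, List.cons_append, coeff_ar_mul_of_ne hst, ← hs] at h3
    exact (smul_ne_zero (pow_ne_zero _ (neg_ne_zero.2 one_ne_zero)) hva) h3.symm
  · -- The second factor leaves the chain, so the second part is prolonged by `x`.
    have hz : p.zrel x b := ⟨hcomp.trans hyb, fun h => hne (hu.right x y b hxy h)⟩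
    obtain ⟨c₂, z, hz'⟩ : ∃ c₂ z, b :: c₁ = c₂ ++ [z] :=
      ⟨_, _, (List.dropLast_append_getLast (List.cons_ne_nil b c₁)).symm⟩
    have h1 : (x :: (c₂ ++ [z])).IsChain p.zrel := by
      rw [← hz']
      exact List.isChain_cons_cons.2 ⟨hz, hab.2.2⟩
    have h2 := barD_evalList_of_cocycle hg ((x :: (c₂ ++ [z])).map p.ar)
    rw [barD_chain (k := k) hgl h1, sub_eq_zero, ← hz'] at h2
    have h3 := congrArg (p.coeff (x :: y :: w₀)) h2
    rw [coeff_ar_mul (by simp) ⟨by simp, List.isChain_cons_cons.2 ⟨hxy, hw'.2⟩⟩] at h3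
    right
    by_contra hlast
    obtain ⟨w₁, t, ht⟩ : ∃ w₁ t, y :: w₀ = w₁ ++ [t] :=
      ⟨_, _, (List.dropLast_append_getLast (List.cons_ne_nil y w₀)).symm⟩
    rw [ht, hz'] at hlast
    have htz : t ≠ z := by simpa using hlast
    refine hwb (h3.trans ?_)
    rw [map_smul, ht, ← List.cons_append, coeff_mul_ar_of_ne htz, smul_zero]

end WordPresentation

/-! ### Vanishing of the cup products -/

section

variable {k A : Type*} [Field k] [Ring A] [Algebra k A]

theorem evalList_cup {n m : ℕ} (f : Cochain k A n) (g : Cochain k A m) {l : List A}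
    (hl : l.length = n + m) :
    evalList (cup f g) l = evalList f (l.take n) * evalList g (l.drop n) := by
  rw [evalList_of_length _ hl, evalList_of_length _ (by simp; omega),
    evalList_of_length _ (by simp; omega), ev_cup]
  congr 1
  · refine ev_congr f fun i hi => ?_
    simp [hi]
  · refine ev_congr g fun i hi => ?_
    simp [List.getElem?_drop]

theorem d_cup {n m : ℕ} {f : Cochain k A n} {g : Cochain k A m} (hf : d n f = 0)
    (hg : d m g = 0) : d (n + m) (cup f g) = 0 :=
  ext_ev fun s => by
    rw [leibniz, hf, hg, cup_zero', zero_cup', ev_zero, ev_zero, smul_zero, add_zero]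

theorem balanced_cup {V : Type*} {e : V → A} {n m : ℕ} {f : Cochain k A n} {g : Cochain k A m}
    (hf : d n f = 0) (hg : d m g = 0) (hfb : Balanced e (evalList f))
    (hgb : Balanced e (evalList g)) : Balanced e (evalList (cup f g)) := by
  refine .of_cocycle k (barD_evalList_of_cocycle (d_cup hf hg)) fun r c v l _ => ?_
  by_cases hl : (c ++ e v :: l).length = n + m
  swap
  · exact evalList_of_length_ne _ hl
  rw [evalList_cup f g hl]
  by_cases hc : c.length < n
  · obtain ⟨j, hj⟩ : ∃ j, n - c.length = j + 1 := ⟨n - c.length - 1, by omega⟩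
    rw [List.take_append, List.take_of_length_le hc.le, hj, List.take_succ_cons, hfb.vanishes,
      zero_mul]
  · rw [List.drop_append_of_le_length (by omega), hgb.vanishes, mul_zero]

end

namespace WordPresentation

variable {k A V X : Type*} [Field k] [Ring A] [Algebra k A] [Fintype V]
  {p : WordPresentation k A V X}

variable (p) in
/-- Every cohomology class of positive degree is represented by a balanced cocycle. -/
theorem exists_balanced_cocycle {n : ℕ} (x : HH k A (n + 1)) :
    ∃ f : Cocycle k A (n + 1), Submodule.Quotient.mk f = x ∧
      Balanced p.e (evalList (Cocycle.incl (n + 1) f)) := by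
  obtain ⟨f, rfl⟩ := Submodule.Quotient.mk_surjective _ x
  obtain ⟨g, hg⟩ := exists_vanishesBefore p.idem (Cocycle.d_incl f)
  have hd : d (n + 1) (Cocycle.incl (n + 1) f - d n g) = 0 := by
    rw [map_sub, Cocycle.d_incl, d_d, sub_zero]
  obtain ⟨f', hf'⟩ : ∃ f' : Cocycle k A (n + 1),
      Cocycle.incl (n + 1) f' = Cocycle.incl (n + 1) f - d n g := ⟨⟨_, hd⟩, rfl⟩
  rw [← hf'] at hg hd
  refine ⟨f', ?_, .of_cocycle k (barD_evalList_of_cocycle hd) hg⟩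
  rw [eq_comm, Submodule.Quotient.eq]
  refine ⟨g, ?_⟩
  rw [map_sub, hf', sub_sub_cancel]

theorem positiveCupProductsVanish [Finite (V ⊕ {u : List X // u ≠ [] ∧ u.IsChain p.rel})]
    (hac : p.NoCycles) (hu : p.UniqueContinuation) : PositiveCupProductsVanish k A := by
  intro n m hn hm x y
  obtain ⟨n, rfl⟩ : ∃ i, n = i + 1 := ⟨n - 1, by omega⟩
  obtain ⟨m, rfl⟩ : ∃ i, m = i + 1 := ⟨m - 1, by omega⟩
  obtain ⟨f, rfl, hfb⟩ := p.exists_balanced_cocycle x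
  obtain ⟨g, rfl, hgb⟩ := p.exists_balanced_cocycle y
  rw [cupHH_mk, Submodule.Quotient.mk_eq_zero]
  have hf := Cocycle.d_incl f
  have hg := Cocycle.d_incl g
  refine mem_coboundaries_of_shared_end (p := p) (n := n + 1 + m) hac hu (by omega)
    (d_cup hf hg) (balanced_cup hf hg hfb hgb) fun c hc hcz u hw h => ?_
  obtain ⟨c₁, c₂, rfl, h1, h2⟩ : ∃ c₁ c₂, c = c₁ ++ c₂ ∧ c₁.length = n + 1 ∧ c₂.length = m + 1 :=
    ⟨c.take (n + 1), c.drop (n + 1), (List.take_append_drop _ _).symm, by simp; omega,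
      by simp; omega⟩
  refine shared_end_of_coeff_mul_ne_zero hac hu hf hg hfb hgb (by rintro rfl; simp at h1)
    (by rintro rfl; simp at h2) hcz hw ?_
  have e := evalList_cup (Cocycle.incl (n + 1) f) (Cocycle.incl (m + 1) g)
    (l := (c₁ ++ c₂).map p.ar) (by simp; omega)
  rw [List.map_append, List.take_left' (by simpa using h1), List.drop_left' (by simpa using h1),
    ← List.map_append] at e
  rw [← e]
  exact h

end WordPresentation

end Hochschild

/-! ### The words of a quadratic monomial quotient of a path algebra -/

namespace BoundQuiver

open PathAlgebra

variable {k Q : Type*} [Field k] [Quiver Q]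

/-- The arrows of a quiver, with their source and target. -/
abbrev Arrow (Q : Type*) [Quiver Q] : Type _ := Σ a b : Q, a ⟶ b

/-- The element of the path algebra given by an arrow. -/
noncomputable def ofArrow (k : Type*) {Q : Type*} [Field k] [Quiver Q] (x : Arrow Q) :
    PathAlgebra k Q := PathAlgebra.arrow x.2.2

/-- The list of arrows of a path. -/
def arrows {a : Q} : {b : Q} → Quiver.Path a b → List (Arrow Q)
  | _, .nil => []
  | _, .cons q α => arrows q ++ [⟨_, _, α⟩]

theorem arrows_comp {a b c : Q} (q : Quiver.Path a b) (r : Quiver.Path b c) :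
    arrows (q.comp r) = arrows q ++ arrows r := by
  induction r with
  | nil => simp [arrows]
  | cons r α ih => rw [Quiver.Path.comp_cons, arrows, ih, arrows, List.append_assoc]

theorem length_arrows {a b : Q} (q : Quiver.Path a b) : (arrows q).length = q.length := by
  induction q with
  | nil => rfl
  | cons q α ih => simp [arrows, ih]

/-- A nonempty list of consecutive arrows is the list of arrows of a path. -/
theorem exists_path (x : Arrow Q) (u : List (Arrow Q))
    (h : (x :: u).IsChain fun x y => x.2.1 = y.1) :
    ∃ (b : Q) (q : Quiver.Path x.1 b), arrows q = x :: u ∧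
      ∀ y, (x :: u).getLast? = some y → y.2.1 = b := by
  induction u generalizing x with
  | nil =>
    refine ⟨x.2.1, x.2.2.toPath, rfl, ?_⟩
    rintro y hy
    rw [List.getLast?_singleton, Option.some_inj] at hy
    rw [hy]
  | cons y u ih =>
    obtain ⟨h1, h2⟩ := List.isChain_cons_cons.1 h
    obtain ⟨b, q, hq, hb⟩ := ih y h2
    obtain ⟨a, a', α⟩ := x
    obtain ⟨c, c', β⟩ := y
    obtain rfl : a' = c := h1
    refine ⟨b, α.toPath.comp q, ?_, fun z hz => hb z (by simpa using hz)⟩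
    rw [arrows_comp, hq]
    rfl

variable [Fintype Q]

theorem ofPath_eq_prod {a b : Q} (q : Quiver.Path a b) (h : arrows q ≠ []) :
    ofPath q = ((arrows q).map (ofArrow k)).prod := by
  induction q with
  | nil => exact absurd rfl h
  | cons q α ih =>
    have h1 : ofPath (k := k) (q.cons α) = ofPath q * ofArrow k ⟨_, _, α⟩ :=
      (ofPath_mul_ofPath q α.toPath).symm
    rw [h1, arrows, List.map_append, List.prod_append, List.map_singleton, List.prod_singleton]
    by_cases hq : arrows q = []
    · cases q with
      | nil =>
        have h2 : ofPath (k := k) (Quiver.Path.nil : Quiver.Path a a) * ofArrow k ⟨_, _, α⟩ =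
            ofArrow k ⟨_, _, α⟩ := by
          rw [ofArrow, PathAlgebra.arrow, ofPath_mul_ofPath, Quiver.Path.nil_comp]
        rw [h2, hq]
        simp
      | cons q β => simp [arrows] at hq
    · rw [ih hq]

theorem ofArrow_mul_eq_zero {x y : Arrow Q} (h : x.2.1 ≠ y.1) :
    ofArrow k x * ofArrow k y = 0 := ofPath_mul_ofPath_of_ne _ _ h

/-- A linear span that is closed under multiplication by paths is a two-sided ideal. -/
noncomputable def spanIdeal (T : Set (PathAlgebra k Q))
    (hl : ∀ x ∈ T, ∀ {a b : Q} (q : Quiver.Path a b), ofPath q * x ∈ Submodule.span k T)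
    (hr : ∀ x ∈ T, ∀ {a b : Q} (q : Quiver.Path a b), x * ofPath q ∈ Submodule.span k T) :
    TwoSidedIdeal (PathAlgebra k Q) :=
  TwoSidedIdeal.mk' (Submodule.span k T) (zero_mem _) (fun h h' => add_mem h h')
    (fun h => neg_mem h)
    (by
      intro y x hx
      induction y using PathAlgebra.ind with
      | zero => rw [PathAlgebra.zero_mul']; exact zero_mem _
      | add y y' hy hy' => rw [PathAlgebra.add_mul']; exact add_mem hy hy'
      | path q r =>
        rw [PathAlgebra.smul_mul']
        refine Submodule.smul_mem _ _ ?_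
        induction hx using Submodule.span_induction with
        | mem x hx => exact hl x hx q
        | zero => rw [PathAlgebra.mul_zero']; exact zero_mem _
        | add x x' _ _ hx hx' => rw [PathAlgebra.mul_add']; exact add_mem hx hx'
        | smul r x _ hx => rw [PathAlgebra.mul_smul']; exact Submodule.smul_mem _ _ hx)
    (by
      intro x y hx
      induction y using PathAlgebra.ind with
      | zero => rw [PathAlgebra.mul_zero']; exact zero_mem _
      | add y y' hy hy' => rw [PathAlgebra.mul_add']; exact add_mem hy hy'
      | path q r =>
        rw [PathAlgebra.mul_smul']
        refine Submodule.smul_mem _ _ ?_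
        induction hx using Submodule.span_induction with
        | mem x hx => exact hr x hx q
        | zero => rw [PathAlgebra.zero_mul']; exact zero_mem _
        | add x x' _ _ hx hx' => rw [PathAlgebra.add_mul']; exact add_mem hx hx'
        | smul r x _ hx => rw [PathAlgebra.smul_mul']; exact Submodule.smul_mem _ _ hx)

theorem mem_spanIdeal {T : Set (PathAlgebra k Q)} {hl hr} {x : PathAlgebra k Q} :
    x ∈ spanIdeal T hl hr ↔ x ∈ Submodule.span k T :=
  TwoSidedIdeal.mem_mk' _ _ _ _ _ _ _

/-- The coefficient of a path in an element of the path algebra. -/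
noncomputable def coeffAt (q : QuiverPath Q) : PathAlgebra k Q →ₗ[k] k := Finsupp.lapply q

theorem coeffAt_ofPath [DecidableEq (QuiverPath Q)] (q : QuiverPath Q) {a b : Q}
    (r : Quiver.Path a b) : coeffAt q (ofPath r : PathAlgebra k Q) = if ⟨r⟩ = q then 1 else 0 :=
  Finsupp.single_apply

/-- The paths satisfying a predicate, as elements of the path algebra. -/
def pathSet (k : Type*) {Q : Type*} [Field k] [Quiver Q] (P : QuiverPath Q → Prop) :
    Set (PathAlgebra k Q) := {x | ∃ q : QuiverPath Q, P q ∧ x = ofPath q.path}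

theorem mem_span_pathSet {P : QuiverPath Q → Prop} {x : PathAlgebra k Q} :
    x ∈ Submodule.span k (pathSet k P) ↔ ∀ q, coeffAt q x ≠ 0 → P q := by
  classical
  constructor
  · intro hx
    induction hx using Submodule.span_induction with
    | mem x hx =>
      obtain ⟨r, hr, rfl⟩ := hx
      intro q hq
      rw [coeffAt_ofPath] at hq
      obtain rfl : r = q := by
        by_contra h
        exact hq (if_neg h)
      exact hr
    | zero => intro q hq; simp at hq
    | add x y _ _ hx hy =>
      intro q hq
      rw [map_add] at hq
      by_cases h : coeffAt q x = 0
      · rw [h, zero_add] at hq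
        exact hy q hq
      · exact hx q h
    | smul r x _ hx =>
      intro q hq
      rw [map_smul] at hq
      exact hx q fun h => hq (by rw [h, smul_zero])
  · intro h
    have hx : x = Finsupp.sum x fun q r => r • (ofPath q.path : PathAlgebra k Q) := by
      conv_lhs => rw [← Finsupp.sum_single x]
      refine Finsupp.sum_congr fun q _ => ?_
      exact (Finsupp.smul_single_one q _).symm
    rw [hx]
    refine Submodule.sum_mem _ fun q hq => Submodule.smul_mem _ _ (Submodule.subset_span ?_)
    exact ⟨q, h q (Finsupp.mem_support_iff.1 hq), rfl⟩

/-- The product of two arrows is nonzero modulo `I`. -/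
def arrowRel (I : TwoSidedIdeal (PathAlgebra k Q)) (x y : Arrow Q) : Prop :=
  ofArrow k x * ofArrow k y ∉ I

variable {I : TwoSidedIdeal (PathAlgebra k Q)}

theorem tgt_eq_src_of_arrowRel {x y : Arrow Q} (h : arrowRel I x y) : x.2.1 = y.1 := by
  by_contra hne
  refine h ?_
  rw [ofArrow_mul_eq_zero hne]
  exact I.zero_mem

theorem prod_mem_of_not_isChain {u : List (Arrow Q)} (h : ¬ u.IsChain (arrowRel I)) :
    (u.map (ofArrow k)).prod ∈ I := by
  induction u with
  | nil => exact absurd .nil h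
  | cons x u ih =>
    cases u with
    | nil => exact absurd (.singleton x) h
    | cons y u =>
      rw [List.map_cons, List.prod_cons]
      by_cases hxy : arrowRel I x y
      · exact I.mul_mem_left _ _ (ih fun hu => h (List.isChain_cons_cons.2 ⟨hxy, hu⟩))
      · rw [List.map_cons, List.prod_cons, ← mul_assoc]
        exact I.mul_mem_right _ _ (not_not.1 hxy)

theorem ofPath_mem_of_not_isChain {a b : Q} {q : Quiver.Path a b}
    (h : ¬ (arrows q).IsChain (arrowRel I)) : ofPath q ∈ I := by
  rw [ofPath_eq_prod q (by intro hq; rw [hq] at h; exact h .nil)]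
  exact prod_mem_of_not_isChain h

/-- Multiplying a path on the left by a path gives a path or zero, so a set of paths that is
preserved in this way is closed under multiplication by paths. -/
theorem ofPath_mul_mem_span {P : QuiverPath Q → Prop}
    (hP : ∀ {a b c : Q} (r : Quiver.Path a b) (q : Quiver.Path b c), P ⟨q⟩ → P ⟨r.comp q⟩)
    (x : PathAlgebra k Q) (hx : x ∈ pathSet k P) {a b : Q} (r : Quiver.Path a b) :
    ofPath r * x ∈ Submodule.span k (pathSet k P) := by
  obtain ⟨⟨q⟩, hq, rfl⟩ := hx
  rename_i c d
  by_cases h : b = c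
  · subst h
    rw [ofPath_mul_ofPath]
    exact Submodule.subset_span ⟨⟨r.comp q⟩, hP r q hq, rfl⟩
  · rw [ofPath_mul_ofPath_of_ne _ _ h]
    exact zero_mem _

theorem mul_ofPath_mem_span {P : QuiverPath Q → Prop}
    (hP : ∀ {a b c : Q} (q : Quiver.Path a b) (r : Quiver.Path b c), P ⟨q⟩ → P ⟨q.comp r⟩)
    (x : PathAlgebra k Q) (hx : x ∈ pathSet k P) {a b : Q} (r : Quiver.Path a b) :
    x * ofPath r ∈ Submodule.span k (pathSet k P) := by
  obtain ⟨⟨q⟩, hq, rfl⟩ := hx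
  rename_i c d
  by_cases h : d = a
  · subst h
    rw [ofPath_mul_ofPath]
    exact Submodule.subset_span ⟨⟨q.comp r⟩, hP q r hq, rfl⟩
  · rw [ofPath_mul_ofPath_of_ne _ _ h]
    exact zero_mem _

/-- A monomial ideal contains all paths that occur in its elements. -/
theorem IsMonomial.ofPath_mem (hI : IsMonomial I) {x : PathAlgebra k Q} (hx : x ∈ I)
    (q : QuiverPath Q) (hq : coeffAt q x ≠ 0) : ofPath q.path ∈ I := by
  obtain ⟨S, hS, hIS⟩ := hI
  have hle : I ≤ spanIdeal (pathSet k fun q : QuiverPath Q => (ofPath q.path : PathAlgebra k Q) ∈ I)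
      (ofPath_mul_mem_span fun r q hq => by
        rw [← ofPath_mul_ofPath]; exact I.mul_mem_left _ _ hq)
      (mul_ofPath_mem_span fun q r hq => by
        rw [← ofPath_mul_ofPath]; exact I.mul_mem_right _ _ hq) := by
    conv_lhs => rw [hIS]
    rw [TwoSidedIdeal.span_le]
    intro y hy
    obtain ⟨a, b, r, rfl⟩ := hS y hy
    refine mem_spanIdeal.2 (Submodule.subset_span ⟨⟨r⟩, ?_, rfl⟩)
    rw [hIS]
    exact TwoSidedIdeal.subset_span hy
  exact mem_span_pathSet.1 (mem_spanIdeal.1 (hle hx)) q hq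

/-- A quadratic monomial ideal is spanned by the paths that contain two consecutive arrows whose
product lies in the ideal. -/
theorem not_isChain_of_mem (hI : IsMonomial I) (hI' : IsQuadratic I) {x : PathAlgebra k Q}
    (hx : x ∈ I) (q : QuiverPath Q) (hq : coeffAt q x ≠ 0) :
    ¬ (arrows q.path).IsChain (arrowRel I) := by
  obtain ⟨S, hS, hIS⟩ := hI'
  have hle : I ≤ spanIdeal
      (pathSet k fun q : QuiverPath Q => ¬ (arrows q.path).IsChain (arrowRel I))
      (ofPath_mul_mem_span fun r q hq h => by
        rw [arrows_comp] at h
        exact hq h.right_of_append)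
      (mul_ofPath_mem_span fun q r hq h => by
        rw [arrows_comp] at h
        exact hq h.left_of_append) := by
    conv_lhs => rw [hIS]
    rw [TwoSidedIdeal.span_le]
    intro y hy
    have hyI : y ∈ I := by
      rw [hIS]
      exact TwoSidedIdeal.subset_span hy
    refine mem_spanIdeal.2 (mem_span_pathSet.2 fun r hr hch => ?_)
    have h2 : y ∈ Submodule.span k (pathSet k fun q : QuiverPath Q => q.path.length = 2) := by
      refine Submodule.span_mono ?_ (hS y hy)
      rintro _ ⟨a, b, r, h, rfl⟩
      exact ⟨⟨r⟩, h, rfl⟩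
    have hlen := mem_span_pathSet.1 h2 r hr
    have hmem := hI.ofPath_mem hyI r hr
    rw [← length_arrows] at hlen
    obtain ⟨α, β, h⟩ := List.length_eq_two.1 hlen
    rw [ofPath_eq_prod _ (by rw [h]; simp), h] at hmem
    rw [h] at hch
    exact (List.isChain_cons_cons.1 hch).1 (by simpa using hmem)
  exact mem_span_pathSet.1 (mem_spanIdeal.1 (hle hx)) q hq

/-- The quotient map from the path algebra. -/
noncomputable def quotientMap (I : TwoSidedIdeal (PathAlgebra k Q)) :
    PathAlgebra k Q →ₐ[k] QuotientAlgebra I := I.ringCon.mkₐ k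

theorem quotientMap_eq_zero {x : PathAlgebra k Q} : quotientMap I x = 0 ↔ x ∈ I := by
  rw [← map_zero (quotientMap I)]
  exact (RingCon.eq _).trans (TwoSidedIdeal.mem_iff _ _).symm

theorem quotientMap_surjective : Function.Surjective (quotientMap I) :=
  I.ringCon.mk'_surjective

/-- The paths that form a basis of the quotient by a quadratic monomial ideal. -/
noncomputable def wordElement (I : TwoSidedIdeal (PathAlgebra k Q)) :
    Q ⊕ {u : List (Arrow Q) // u ≠ [] ∧ u.IsChain (arrowRel I)} → QuotientAlgebra I
  | .inl v => quotientMap I (ofPath (Quiver.Path.nil : Quiver.Path v v))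
  | .inr u => (u.1.map fun x => quotientMap I (ofArrow k x)).prod

theorem quotientMap_ofPath {a b : Q} (q : Quiver.Path a b) (h : arrows q ≠ []) :
    quotientMap I (ofPath q) = ((arrows q).map fun x => quotientMap I (ofArrow k x)).prod := by
  rw [ofPath_eq_prod q h, map_list_prod, List.map_map]
  rfl

/-- Each element of the basis is the class of a path that recovers its index. -/
theorem exists_path_wordElement
    (i : Q ⊕ {u : List (Arrow Q) // u ≠ [] ∧ u.IsChain (arrowRel I)}) :
    ∃ q : QuiverPath Q, quotientMap I (ofPath q.path) = wordElement I i ∧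
      (arrows q.path).IsChain (arrowRel I) ∧
      match i with
      | .inl v => q = ⟨(Quiver.Path.nil : Quiver.Path v v)⟩
      | .inr u => arrows q.path = u.1 := by
  rcases i with v | ⟨u, hu0, hu⟩
  · exact ⟨⟨(Quiver.Path.nil : Quiver.Path v v)⟩, rfl, .nil, rfl⟩
  · obtain ⟨x, u, rfl⟩ := List.exists_cons_of_ne_nil hu0
    obtain ⟨b, q, hq, -⟩ := exists_path x u (hu.imp fun x y h => tgt_eq_src_of_arrowRel h)
    refine ⟨⟨q⟩, ?_, by rw [hq]; exact hu, hq⟩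
    rw [quotientMap_ofPath q (by rw [hq]; simp), hq]
    rfl

theorem linearIndependent_wordElement (hI : IsMonomial I) (hI' : IsQuadratic I) :
    LinearIndependent k (wordElement I) := by
  choose path h1 h2 h3 using exists_path_wordElement (I := I)
  have hinj : Function.Injective path := by
    intro i j hij
    have hi := h3 i
    have hj := h3 j
    rw [hij] at hi
    rcases i with v | u <;> rcases j with w | u' <;> simp only at hi hj
    · rw [hi] at hj
      injection hj with hj
      rw [hj]
    · rw [hi] at hj
      exact absurd hj.symm u'.2.1
    · rw [hj] at hi
      exact absurd hi.symm u.2.1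
    · exact congrArg Sum.inr (Subtype.ext (hi.symm.trans hj))
  rw [linearIndependent_iff]
  intro l hl
  have hx : quotientMap I (Finsupp.mapDomain path l : PathAlgebra k Q) = 0 := by
    rw [← hl, Finsupp.linearCombination_apply, Finsupp.mapDomain, Finsupp.sum]
    refine (map_sum (quotientMap I) (fun i => Finsupp.single (path i) (l i)) _).trans ?_
    refine Finset.sum_congr rfl fun i _ => ?_
    have hs : (Finsupp.single (path i) (l i) : PathAlgebra k Q) = l i • ofPath (path i).path :=
      (Finsupp.smul_single_one (path i) (l i)).symm
    have h4 : quotientMap I (l i • ofPath (path i).path) = l i • wordElement I i := by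
      rw [map_smul, h1]
    exact (congrArg (quotientMap I) hs).trans h4
  ext i
  by_contra hi
  refine not_isChain_of_mem hI hI' (quotientMap_eq_zero.1 hx) (path i) ?_ (h2 i)
  exact fun h => hi ((Finsupp.mapDomain_apply hinj l i).symm.trans h)

theorem span_wordElement : ⊤ ≤ Submodule.span k (Set.range (wordElement I)) := by
  rintro a -
  obtain ⟨x, rfl⟩ := quotientMap_surjective a
  induction x using PathAlgebra.ind with
  | zero => rw [map_zero]; exact zero_mem _
  | add x y hx hy => rw [map_add]; exact add_mem hx hy
  | path q r =>
    rw [map_smul]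
    refine Submodule.smul_mem _ _ ?_
    by_cases hq : (arrows q).IsChain (arrowRel I)
    · by_cases hq0 : arrows q = []
      · cases q with
        | nil => exact Submodule.subset_span ⟨Sum.inl _, rfl⟩
        | cons q α => simp [arrows] at hq0
      · rw [quotientMap_ofPath q hq0]
        exact Submodule.subset_span ⟨Sum.inr ⟨arrows q, hq0, hq⟩, rfl⟩
    · rw [quotientMap_eq_zero.2 (ofPath_mem_of_not_isChain hq)]
      exact zero_mem _

/-- The quotient of a path algebra by a quadratic monomial ideal, presented by words. -/
noncomputable def wordPresentation (hI : IsMonomial I) (hI' : IsQuadratic I) :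
    Hochschild.WordPresentation k (QuotientAlgebra I) Q (Arrow Q) where
  src x := x.1
  tgt x := x.2.1
  rel := arrowRel I
  e v := quotientMap I (ofPath (Quiver.Path.nil : Quiver.Path v v))
  ar x := quotientMap I (ofArrow k x)
  idem :=
    { idem := fun v => by
        rw [IsIdempotentElem, ← map_mul, ofPath_mul_ofPath, Quiver.Path.nil_comp]
      ortho := fun v w h => by
        change quotientMap I _ * quotientMap I _ = 0
        rw [← map_mul, ofPath_mul_ofPath_of_ne _ _ h, map_zero]
      complete := by rw [← map_sum, ← one_def, map_one] }
  e_mul_ar x := by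
    rw [← map_mul, ofArrow, PathAlgebra.arrow, ofPath_mul_ofPath, Quiver.Path.nil_comp]
  ar_mul_e x := by
    rw [← map_mul, ofArrow, PathAlgebra.arrow, ofPath_mul_ofPath, Quiver.Path.comp_nil]
  tgt_eq_src _ _ h := tgt_eq_src_of_arrowRel h
  ar_mul_ar x y h := by
    rw [← map_mul]
    exact quotientMap_eq_zero.2 (not_not.1 h)
  basis := Module.Basis.mk (linearIndependent_wordElement hI hI') span_wordElement
  basis_inl v := Module.Basis.mk_apply _ _ _
  basis_inr u := Module.Basis.mk_apply _ _ _

theorem noCycles_wordPresentation (hQ : Quiver.NoOrientedCycles Q) (hI : IsMonomial I)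
    (hI' : IsQuadratic I) : (wordPresentation hI hI').NoCycles := by
  intro x u y hu hy hxy
  obtain ⟨b, q, hq, hb⟩ := exists_path x u hu
  have hyb : y.2.1 = b := hb y hy
  have hxb : x.1 = b := hxy.trans hyb
  subst hxb
  rw [hQ _ q] at hq
  exact absurd hq (by simp [arrows])

theorem arrowRel_right_unique (hS : UniqueNonzeroContinuation I) {x y y' : Arrow Q}
    (h : arrowRel I x y) (h' : arrowRel I x y') : y = y' := by
  obtain ⟨a, b, α⟩ := x
  obtain ⟨c, d, β⟩ := y
  obtain ⟨c', d', β'⟩ := y'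
  obtain rfl : b = c := tgt_eq_src_of_arrowRel h
  obtain rfl : b = c' := tgt_eq_src_of_arrowRel h'
  have : (⟨d, β⟩ : Quiver.Star b) = ⟨d', β'⟩ := (hS α).1 h h'
  cases this
  rfl

theorem arrowRel_left_unique (hS : UniqueNonzeroContinuation I) {x x' y : Arrow Q}
    (h : arrowRel I x y) (h' : arrowRel I x' y) : x = x' := by
  obtain ⟨a, b, α⟩ := x
  obtain ⟨a', b', α'⟩ := x'
  obtain ⟨c, d, β⟩ := y
  have hb : b = c := tgt_eq_src_of_arrowRel h
  have hb' : b' = c := tgt_eq_src_of_arrowRel h'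
  subst hb hb'
  have h₁ : (⟨a, α⟩ : Quiver.Costar b') ∈
      {γ : Quiver.Costar b' | PathAlgebra.arrow γ.2 * PathAlgebra.arrow β ∉ I} := h
  have h₂ : (⟨a', α'⟩ : Quiver.Costar b') ∈
      {γ : Quiver.Costar b' | PathAlgebra.arrow γ.2 * PathAlgebra.arrow β ∉ I} := h'
  exact congrArg (fun γ : Quiver.Costar b' => (⟨γ.1, b', γ.2⟩ : Arrow Q)) ((hS β).2 h₁ h₂)

theorem uniqueContinuation_wordPresentation (hI : IsMonomial I) (hI' : IsQuadratic I)
    (hS : UniqueNonzeroContinuation I) : (wordPresentation hI hI').UniqueContinuation where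
  right _ _ _ h h' := arrowRel_right_unique hS h h'
  left _ _ _ h h' := arrowRel_left_unique hS h h'

/-- Words have bounded length, since an admissible ideal contains all long paths. -/
theorem finite_words [∀ a b : Q, Finite (a ⟶ b)] (hI : IsMonomial I) (hI' : IsQuadratic I)
    (hA : IsAdmissible I) :
    Finite (Q ⊕ {u : List (Arrow Q) // u ≠ [] ∧ u.IsChain (arrowRel I)}) := by
  classical
  obtain ⟨-, m, -, hm⟩ := hA
  have hfin : {u : List (Arrow Q) | u ≠ [] ∧ u.IsChain (arrowRel I)}.Finite := by
    refine (List.finite_length_lt (Arrow Q) m).subset fun u hu => ?_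
    obtain ⟨q, -, hch, hq⟩ := exists_path_wordElement (I := I) (Sum.inr ⟨u, hu⟩)
    change u.length < m
    by_contra hlt
    refine not_isChain_of_mem hI hI' (x := ofPath q.path) (hm (TwoSidedIdeal.subset_span ?_)) q ?_
      hch
    · refine ⟨_, _, q.path, ?_, rfl⟩
      have hq' : arrows q.path = u := hq
      rw [← length_arrows, hq']
      omega
    · rw [coeffAt_ofPath, if_pos rfl]
      exact one_ne_zero
  have := hfin.to_subtype
  exact (inferInstance : Finite (Q ⊕ ↥{u : List (Arrow Q) | u ≠ [] ∧ u.IsChain (arrowRel I)}))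

end BoundQuiver

theorem theorem3p1 {k Q : Type*} [Field k] [Quiver Q] [Fintype Q]
    [∀ a b : Q, Finite (a ⟶ b)] (hQ : Quiver.NoOrientedCycles Q)
    (I : TwoSidedIdeal (PathAlgebra k Q)) (hI : BoundQuiver.IsAdmissible I) :
    (BoundQuiver.IsString I → BoundQuiver.IsQuadratic I →
      Hochschild.PositiveCupProductsVanish k (BoundQuiver.QuotientAlgebra I)) ∧
    (BoundQuiver.IsMonomial I → BoundQuiver.IsQuadratic I →
      BoundQuiver.UniqueNonzeroContinuation I →
      Hochschild.PositiveCupProductsVanish k (BoundQuiver.QuotientAlgebra I)) ∧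
    (BoundQuiver.IsGentle I →
      Hochschild.PositiveCupProductsVanish k (BoundQuiver.QuotientAlgebra I)) := by
  have key : BoundQuiver.IsMonomial I → BoundQuiver.IsQuadratic I →
      BoundQuiver.UniqueNonzeroContinuation I →
      Hochschild.PositiveCupProductsVanish k (BoundQuiver.QuotientAlgebra I) := by
    intro hm hq hu
    have : Finite (Q ⊕ {u : List (BoundQuiver.Arrow Q) //
        u ≠ [] ∧ u.IsChain (BoundQuiver.wordPresentation hm hq).rel}) :=
      BoundQuiver.finite_words hm hq hI
    exact Hochschild.WordPresentation.positiveCupProductsVanish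
      (p := BoundQuiver.wordPresentation hm hq)
      (BoundQuiver.noCycles_wordPresentation hQ hm hq)
      (BoundQuiver.uniqueContinuation_wordPresentation hm hq hu)
  exact ⟨fun h hq => key h.monomial hq h.uniqueNonzero, key,
    fun h => key h.monomial h.quadratic h.uniqueNonzero⟩
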